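/- **Setting.** Words are read from right to left. Let $\Lambda$ be the quiver algebra over $\mathbb{C}$ with nodes $0,1,2$, arrows $z^i:0\to1$, $z^i:1\to2$, $w_i:1\to0$, $w_i:2\to1$ ($i=1,2,3$), idempotents $e_0,e_1,e_2$, and relations $z^iz^j=z^jz^i$ (from $0$ to $2$), $w_iw_j=w_jw_i$ (from $2$ to $0$), $z^iw_j=w_jz^i$ at node $1$, $\sum_i z^iw_i=0$ at nodes $1,2$ and $\sum_i w_iz^i=0$ at nodes $0,1$. A subscript $pq$ marks a path from node $q$ to node $p$. On $X=T^*\mathbb{P}^2=\{(z,w): z\in\mathbb{C}^3\setminus 0,\ w\in(\mathbb{C}^3)^*,\ w_iz^i=0\}/\mathbb{C}^*$, with $z\mapsto\lambda z$, $w\mapsto\lambda^{-1}w$, use the chart $z^3\ne0$ with $x^i=z^i/z^3$, $\xi_i=w_iz^3$ ($i=1,2$). Elements of $e_0\Lambda e_0$ are functions on $X$, through $w_iz^j$. **Reduction system.** Each rule $s\mapsto f_s$ replaces a tip $s$: - $(z^iz^j)_{20}\mapsto z^jz^i$ and $(w_iw_j)_{02}\mapsto w_jw_i$ for $i<j$;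 - $(z^iw_j)_{11}\mapsto w_jz^i$ for $(i,j)\neq(3,3)$, and $(z^3w_3)_{11},(w_3z^3)_{11}\mapsto -w_1z^1-w_2z^2$; - $(z^3w_3)_{22}\mapsto -z^1w_1-z^2w_2$ and $(w_3z^3)_{00}\mapsto -w_1z^1-w_2z^2$; - $(w_iz^kw_j)_{12}\mapsto w_jz^kw_i$ and $(z^iw_kz^j)_{21}\mapsto z^jw_kz^i$ for $i<j$ and $(k,j)\ne(3,3)$; - $(w_3w_1z^3)_{01}\mapsto -w_2w_1z^2-w_1w_1z^1$ and $(w_3w_2z^3)_{01}\mapsto -w_2w_2z^2-w_2w_1z^1$. For irreducible paths $u,v$ with $uv$ composable, $G_2[u|v]=\sum \alpha\otimes s\otimes \beta$, with coefficients, collects the tips used when $uv$ is reduced by always rewriting the rightmost tip, $\alpha s\beta\mapsto\alpha f_s\beta$. **Cochains.** A cochain assigns values to the relations $(z\cdot w)_{11}$, $(w\cdot z)_{11}$, $(z\cdot w)_{22}$, $(w\cdot z)_{00}$, the trace-free part of $[w_i,z^j]_{11}=(w_iz^j-z^jw_i)_{11}$, $[z^i,z^j]_{20}$ and $[w_i,w_j]_{02}$.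 Its value $g(s)$ on a tip is its value on $s-f_s$, written as a combination of these relations: by bilinearity for the tips of length two, and for those of length three by $$w_iz^kw_j-w_jz^kw_i=[w_i,z^k]w_j+z^k[w_i,w_j]-[w_j,z^k]w_i,$$ $$z^iw_kz^j-z^jw_kz^i=z^i[w_k,z^j]+[z^i,z^j]w_k-z^j[w_k,z^i],$$ $$\textstyle\sum_p w_pw_kz^p=\sum_p[w_p,w_k]z^p+w_k(w\cdot z),$$ where for $k=2$ one subtracts $[w_1,w_2]z^1$ from the last. Put $gG_2[u|v]=\sum\alpha\, g(s)\,\beta\in\Lambda$. Let $D_{ijk}=\bar D^{ijk}=1$ if $i,j,k$ are distinct and $0$ otherwise. All values not listed are $0$: - $g_{\mathbf{10}}$: $[z^i,z^j]_{20}\mapsto\epsilon^{ijr}D_{rkl}z^kz^l$, $\ [w_i,z^j]_{\rm tf}\mapsto\epsilon^{jlr}D_{rik}w_lz^k$; - $g_{\mathbf{10}^*}$: $[w_i,w_j]_{02}\mapsto-\epsilon_{ijr}\bar D^{rkl}w_kw_l$, $\ [w_i,z^j]_{\rm tf}\mapsto\epsilon_{rik}\bar D^{rjl}w_lz^k$;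 - $g_{\emptyset,0}$: $(z\cdot w)_{11},(w\cdot z)_{11},(z\cdot w)_{22},(w\cdot z)_{00}\mapsto e_1,-e_1,\tfrac13e_2,-\tfrac13e_0$; - $g_{\emptyset,1}$: the same four relations $\mapsto e_1,e_1,e_2,e_0$. For $a,b,c,t\in\mathbb{C}$ put $g=ag_{\mathbf{10}}+bg_{\mathbf{10}^*}+cg_{\emptyset,0}+tg_{\emptyset,1}$. **Poisson structure.** For $s\in\mathbb{C}$ let $$-i\Pi_s=s(\partial_{\xi_1}\wedge\partial_{x^1}+\partial_{\xi_2}\wedge\partial_{x^2})-\xi_1\xi_2\partial_{\xi_1}\wedge\partial_{\xi_2}+\xi_1x^2\partial_{\xi_1}\wedge\partial_{x^2}-\xi_2x^1\partial_{\xi_2}\wedge\partial_{x^1}-x^1x^2\partial_{x^1}\wedge\partial_{x^2},$$ and $\{f,h\}=-i\Pi_s(df,dh)$, where $(\partial_p\wedge\partial_q)(df,dh)=\partial_pf\,\partial_qh-\partial_qf\,\partial_ph$. **Lemma.** Let $s\in\mathbb{C}$. 1. $\{\cdot,\cdot\}$ satisfies the Jacobi identity. 2. For all $a,b,c,t\in\mathbb{C}$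 there is exactly one bilinear $m:\Lambda\times\Lambda\to\Lambda$ with $m(u,v)=gG_2[u|v]$ for composable irreducible paths $u,v$ of positive length, that vanishes on non-composable pairs of paths and whenever one argument is an $e_p$. It is a Hochschild $2$-cocycle. 3. $\Pi_s$ corresponds to $g$ exactly for $$a=-\tfrac16,\qquad b=\tfrac16,\qquad c=-\tfrac{3s}{2}$$ and any $t$: these equalities hold if and only if $m(u,v)-m(v,u)=\{u,v\}$ as functions for all $u,v\in e_0\Lambda e_0$, and if and only if this holds for all paths $u=w_iz^j$, $v=w_kz^l$ of length two. 4. The parameter $t$ corresponds to the Kodaira–Spencer deformation $w_iz^i=0\to w_iz^i=t$. Precisely, let $\tau\in\mathbb{C}$, $\varepsilon^2=0$, and let $X_{\tau\varepsilon}=\{w_iz^i=\tau\varepsilon,\ z\neq0\}/\mathbb{C}^*$, a deformation of $X$ over $\mathbb{C}[\varepsilon]$. The first-order deformation $u\star v=uv+\varepsilon\,m(u,v)$ of $\Lambda$ is equivalent to the endomorphism algebra of $\mathcal{O}\oplus\mathcal{O}(1)\oplus\mathcal{O}(2)$ on $X_{\tau\varepsilon}$ if and only if $a=b=c=0$ and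 $t=\tau$. Equivalent means isomorphic over $\mathbb{C}[\varepsilon]$ by a map that sends $e_0,e_1,e_2$ to the projections and that agrees modulo $\varepsilon$ with letting $z^i,w_i$ act by multiplication. -/

import Mathlib

noncomputable section

namespace CotangentP2

/-! ### The quiver algebra of the cotangent bundle of the projective plane

Words are read from right to left, as compositions of maps.  Indices `1, 2, 3` of the homogeneous
coordinates become `0, 1, 2 : Fin 3`; the nodes are `0, 1, 2 : Fin 3`. -/

/-- The twelve arrows: `zLo i : 0 → 1`, `zHi i : 1 → 2` (both written `z^i`), and
`wLo i : 1 → 0`, `wHi i : 2 → 1` (both written `w_i`). -/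
inductive Arrow
  | zLo (i : Fin 3)
  | zHi (i : Fin 3)
  | wLo (i : Fin 3)
  | wHi (i : Fin 3)

open Arrow

/-- The node where an arrow starts. -/
def Arrow.src : Arrow → Fin 3
  | zLo _ => 0
  | zHi _ => 1
  | wLo _ => 1
  | wHi _ => 2

/-- The node where an arrow ends. -/
def Arrow.tgt : Arrow → Fin 3
  | zLo _ => 1
  | zHi _ => 2
  | wLo _ => 0
  | wHi _ => 1

/-- The free algebra on the trivial paths and the arrows. -/
abbrev Free := FreeAlgebra ℂ (Fin 3 ⊕ Arrow)

/-- A trivial path in the free algebra. -/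
def freeE (a : Fin 3) : Free := FreeAlgebra.ι ℂ (Sum.inl a)

/-- An arrow in the free algebra. -/
def freeA (x : Arrow) : Free := FreeAlgebra.ι ℂ (Sum.inr x)

/-- The relations of the path algebra (the first four) and the relations of the quiver:
the `z`s commute, the `w`s commute, `z` and `w` commute at the node `1`, and
`∑ z^i w_i = 0` at the nodes `1, 2`, `∑ w_i z^i = 0` at the nodes `0, 1`. -/
inductive QuiverRel : Free → Free → Prop
  | idem (a b : Fin 3) : QuiverRel (freeE a * freeE b) (if a = b then freeE a else 0)
  | one : QuiverRel (∑ a, freeE a) 1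
  | tgt (x : Arrow) : QuiverRel (freeE x.tgt * freeA x) (freeA x)
  | src (x : Arrow) : QuiverRel (freeA x * freeE x.src) (freeA x)
  | zz (i j : Fin 3) : QuiverRel (freeA (zHi i) * freeA (zLo j)) (freeA (zHi j) * freeA (zLo i))
  | ww (i j : Fin 3) : QuiverRel (freeA (wLo i) * freeA (wHi j)) (freeA (wLo j) * freeA (wHi i))
  | zw (i j : Fin 3) : QuiverRel (freeA (zLo i) * freeA (wLo j)) (freeA (wHi j) * freeA (zHi i))
  | moment_zw1 : QuiverRel (∑ i, freeA (zLo i) * freeA (wLo i)) 0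
  | moment_wz1 : QuiverRel (∑ i, freeA (wHi i) * freeA (zHi i)) 0
  | moment_zw2 : QuiverRel (∑ i, freeA (zHi i) * freeA (wHi i)) 0
  | moment_wz0 : QuiverRel (∑ i, freeA (wLo i) * freeA (zLo i)) 0

/-- The quiver algebra `Λ`. -/
abbrev Lam := RingQuot QuiverRel

/-- The idempotent `e_a` of `Λ`. -/
def e (a : Fin 3) : Lam := RingQuot.mkAlgHom ℂ QuiverRel (freeE a)

/-- The class of an arrow in `Λ`. -/
def arr (x : Arrow) : Lam := RingQuot.mkAlgHom ℂ QuiverRel (freeA x)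

/-- The class of a word in `Λ`. -/
def cls (p : List Arrow) : Lam := (p.map arr).prod

/-- Paths of positive length: nonempty composable words. -/
def IsPath (p : List Arrow) : Prop := p ≠ [] ∧ p.IsChain (fun x y => x.src = y.tgt)

/-! ### The reduction system -/

/-- `rule s = some f` says that `s` is a tip, and that it is replaced by the combination `f_s`
which the list `f` of coefficients and words spells out. -/
def rule : List Arrow → Option (List (ℤ × List Arrow))
  | [zHi i, zLo j] => if i < j then some [(1, [zHi j, zLo i])] else none
  | [wLo i, wHi j] => if i < j then some [(1, [wLo j, wHi i])] else none
  | [zLo i, wLo j] =>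
      if i = 2 ∧ j = 2 then some [(-1, [wHi 0, zHi 0]), (-1, [wHi 1, zHi 1])]
      else some [(1, [wHi j, zHi i])]
  | [wHi i, zHi j] =>
      if i = 2 ∧ j = 2 then some [(-1, [wHi 0, zHi 0]), (-1, [wHi 1, zHi 1])] else none
  | [zHi i, wHi j] =>
      if i = 2 ∧ j = 2 then some [(-1, [zHi 0, wHi 0]), (-1, [zHi 1, wHi 1])] else none
  | [wLo i, zLo j] =>
      if i = 2 ∧ j = 2 then some [(-1, [wLo 0, zLo 0]), (-1, [wLo 1, zLo 1])] else none
  | [wHi i, zHi k, wHi j] =>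
      if i < j ∧ ¬(k = 2 ∧ j = 2) then some [(1, [wHi j, zHi k, wHi i])] else none
  | [zHi i, wHi k, zHi j] =>
      if i < j ∧ ¬(k = 2 ∧ j = 2) then some [(1, [zHi j, wHi k, zHi i])] else none
  | [wLo i, wHi k, zHi j] =>
      if i = 2 ∧ j = 2 then
        if k = 0 then some [(-1, [wLo 1, wHi 0, zHi 1]), (-1, [wLo 0, wHi 0, zHi 0])]
        else if k = 1 then some [(-1, [wLo 1, wHi 1, zHi 1]), (-1, [wLo 1, wHi 0, zHi 0])]
        else none
      else none
  | _ => none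

/-- The words that are tips. -/
def IsTip (s : List Arrow) : Bool := (rule s).isSome

/-- The combination `f_s` (empty if `s` is not a tip). -/
def replacement (s : List Arrow) : List (ℤ × List Arrow) := (rule s).getD []

/-- The rightmost occurrence `p = a s b` of a tip `s` in the word `p`, if there is one. (All tips
have length two or three, and none is a subword of another.) -/
def rightmostTip : List Arrow → Option (List Arrow × List Arrow × List Arrow)
  | [] => none
  | x :: p =>
    match rightmostTip p with
    | some (a, s, b) => some (x :: a, s, b)
    | none =>
      if IsTip ((x :: p).take 2) then some ([], (x :: p).take 2, (x :: p).drop 2)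
      else if IsTip ((x :: p).take 3) then some ([], (x :: p).take 3, (x :: p).drop 3)
      else none

/-- A word is irreducible if no tip occurs in it. -/
def Irred (p : List Arrow) : Prop := rightmostTip p = none

/-- The order of the letters, `z^1 < z^2 < z^3 < w_1 < w_2 < w_3`. -/
def rank : Arrow → ℕ
  | zLo i => i
  | zHi i => i
  | wLo i => 3 + i
  | wHi i => 3 + i

/-- The position of a word in the dictionary (read from right to left) of words of its length. -/
def dict (p : List Arrow) : ℕ := Nat.ofDigits 6 (p.map rank)

theorem rightmostTip_spec : ∀ (p a s b : List Arrow), rightmostTip p = some (a, s, b) →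
    p = a ++ s ++ b ∧ IsTip s = true := by
  intro p
  induction p with
  | nil => intro a s b h; simp [rightmostTip] at h
  | cons x p ih =>
    intro a s b h
    rw [rightmostTip] at h
    split at h
    · rename_i a' s' b' h'
      obtain ⟨h1, h2⟩ := ih _ _ _ h'
      simp only [Option.some.injEq, Prod.mk.injEq] at h
      obtain ⟨rfl, rfl, rfl⟩ := h
      exact ⟨by rw [h1]; simp, h2⟩
    · split_ifs at h with h1 h2
      · simp only [Option.some.injEq, Prod.mk.injEq] at h
        obtain ⟨rfl, rfl, rfl⟩ := h
        exact ⟨by rw [List.nil_append, List.take_append_drop], h1⟩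
      · simp only [Option.some.injEq, Prod.mk.injEq] at h
        obtain ⟨rfl, rfl, rfl⟩ := h
        exact ⟨by rw [List.nil_append, List.take_append_drop], h2⟩

theorem replacement_lt (s : List Arrow) :
    ∀ q ∈ replacement s, q.2.length = s.length ∧ dict q.2 < dict s := by
  intro q hq
  unfold replacement rule at hq
  split at hq <;> (try split_ifs at hq) <;>
    simp only [Option.getD_none, Option.getD_some, List.mem_cons, List.not_mem_nil, or_false] at hq
  all_goals
    first
    | exact hq.elim
    | (rcases hq with rfl | rfl)
  all_goals
    simp [dict, rank, Nat.ofDigits_cons]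
    omega

theorem replacement_decreases (p a s b : List Arrow) (h : rightmostTip p = some (a, s, b))
    (q : ℤ × List Arrow) (hq : q ∈ replacement s) : dict (a ++ q.2 ++ b) < dict p := by
  obtain ⟨rfl, -⟩ := rightmostTip_spec p a s b h
  obtain ⟨h1, h2⟩ := replacement_lt s q hq
  unfold dict at *
  simp only [List.map_append, Nat.ofDigits_append, List.length_append, List.length_map, h1]
  have : 0 < 6 ^ a.length := by positivity
  nlinarith

/-- The collection of tips used in the right reduction of a word `p`: in each step the rightmost
tip `s` of a word `a s b` is replaced by `f_s`, and `a ⊗ s ⊗ b` is recorded. -/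
def tipsUsed (p : List Arrow) : (List Arrow × List Arrow × List Arrow) →₀ ℂ :=
  match h : rightmostTip p with
  | none => 0
  | some (a, s, b) =>
      Finsupp.single (a, s, b) 1 +
        ((replacement s).attach.map
          (fun q => ((q.1.1 : ℤ) : ℂ) • tipsUsed (a ++ q.1.2 ++ b))).sum
termination_by dict p
decreasing_by exact replacement_decreases p a s b h q.1 q.2

/-- The comparison map `G₂` from the bar resolution, on `[u|v]` with `u`, `v` irreducible. -/
def G₂ (u v : List Arrow) : (List Arrow × List Arrow × List Arrow) →₀ ℂ := tipsUsed (u ++ v)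

/-! ### The cocycle -/

/-- Generators of the relations, the degree two part of the minimal resolution:
`z·w` at `1`, `w·z` at `1`, `z·w` at `2`, `w·z` at `0`, the trace free part of
`w_i z^j - z^j w_i` at `1`, then `z^i z^j - z^j z^i` and `w_i w_j - w_j w_i`. -/
inductive T₂
  | zw1
  | wz1
  | zw2
  | wz0
  | comm (i j : Fin 3)
  | zz (i j : Fin 3)
  | ww (i j : Fin 3)

/-- The Levi-Civita symbol. -/
def eps (i j k : Fin 3) : ℂ :=
  if j = i + 1 ∧ k = i + 2 then 1 else if j = i + 2 ∧ k = i + 1 then -1 else 0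

/-- The totally symmetric tensor with `D_{123} = 1` and zero entries at repeated indices. -/
def D (i j k : Fin 3) : ℂ := if i ≠ j ∧ j ≠ k ∧ i ≠ k then 1 else 0

/-- The cochain in the representation `10`. -/
def g10 : T₂ → Lam
  | .zz i j => ∑ r, ∑ k, ∑ l, (eps i j r * D r k l) • cls [zHi k, zLo l]
  | .comm i j => ∑ r, ∑ k, ∑ l, (eps j l r * D r i k) • cls [wHi l, zHi k]
  | _ => 0

/-- The cochain in the dual representation `10*`. -/
def g10dual : T₂ → Lam
  | .ww i j => -∑ r, ∑ k, ∑ l, (eps i j r * D r k l) • cls [wLo k, wHi l]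
  | .comm i j => ∑ r, ∑ k, ∑ l, (eps r i k * D r j l) • cls [wHi l, zHi k]
  | _ => 0

/-- The first invariant cochain. -/
def gInv0 : T₂ → Lam
  | .zw1 => e 1
  | .wz1 => -e 1
  | .zw2 => (1 / 3 : ℂ) • e 2
  | .wz0 => -((1 / 3 : ℂ) • e 0)
  | _ => 0

/-- The second invariant cochain. -/
def gInv1 : T₂ → Lam
  | .zw1 => e 1
  | .wz1 => e 1
  | .zw2 => e 2
  | .wz0 => e 0
  | _ => 0

/-- `g = a g₁₀ + b g₁₀* + c g_{∅,0} + t g_{∅,1}`. -/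
def g (a b c t : ℂ) (r : T₂) : Lam :=
  a • g10 r + b • g10dual r + c • gInv0 r + t • gInv1 r

/-- A cochain on the relation `w_i z^j - z^j w_i` at the node `1`, split into its trace free part
and its trace part. -/
def onComm (γ : T₂ → Lam) (i j : Fin 3) : Lam :=
  γ (.comm i j) + if i = j then (1 / 3 : ℂ) • (γ .wz1 - γ .zw1) else 0

/-- The value of a cochain at a tip `s`: the relation `s - f_s` is written as a combination of
terms `x r y` with `r` in `T₂`. For the words of length three,
`w_i z^k w_j - w_j z^k w_i = [w_i, z^k] w_j + z^k [w_i, w_j] - [w_j, z^k] w_i`,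
`z^i w_k z^j - z^j w_k z^i = z^i [w_k, z^j] + [z^i, z^j] w_k - z^j [w_k, z^i]`,
`∑_p w_p w_k z^p = ∑_p [w_p, w_k] z^p + w_k (w·z)`. -/
def onTip (γ : T₂ → Lam) : List Arrow → Lam
  | [zHi i, zLo j] => γ (.zz i j)
  | [wLo i, wHi j] => γ (.ww i j)
  | [zLo i, wLo j] =>
      if i = 2 ∧ j = 2 then γ .wz1 - onComm γ 2 2 else -onComm γ j i
  | [wHi _, zHi _] => γ .wz1
  | [zHi _, wHi _] => γ .zw2
  | [wLo _, zLo _] => γ .wz0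
  | [wHi i, zHi k, wHi j] =>
      onComm γ i k * arr (wHi j) + arr (zLo k) * γ (.ww i j) - onComm γ j k * arr (wHi i)
  | [zHi i, wHi k, zHi j] =>
      arr (zHi i) * onComm γ k j + γ (.zz i j) * arr (wLo k) - arr (zHi j) * onComm γ k i
  | [wLo _, wHi k, zHi _] =>
      (∑ p, γ (.ww p k) * arr (zHi p)) + arr (wLo k) * γ .wz1
        - (if k = 1 then γ (.ww 0 1) * arr (zHi 0) else 0)
  | _ => 0

/-- The bimodule map given by a cochain, on combinations of terms `a ⊗ s ⊗ b`. -/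
def evalCochain (γ : T₂ → Lam) : ((List Arrow × List Arrow × List Arrow) →₀ ℂ) →ₗ[ℂ] Lam :=
  Finsupp.lift Lam ℂ _ (fun q => cls q.1 * onTip γ q.2.1 * cls q.2.2)

/-- `m` is the bar cochain `γ G₂`, a normalised bilinear map on `Λ` relative to the idempotents,
with value `γ (G₂ [u|v])` for composable irreducible paths `u`, `v`. -/
structure IsBarCochain (γ : T₂ → Lam) (m : Lam →ₗ[ℂ] Lam →ₗ[ℂ] Lam) : Prop where
  left_e : ∀ a v, m (e a) v = 0
  right_e : ∀ a u, m u (e a) = 0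
  composable : ∀ u v : List Arrow, IsPath u → IsPath v → Irred u → Irred v →
    IsPath (u ++ v) → m (cls u) (cls v) = evalCochain γ (G₂ u v)
  not_composable : ∀ u v : List Arrow, IsPath u → IsPath v → ¬IsPath (u ++ v) →
    m (cls u) (cls v) = 0

/-- Hochschild 2-cocycles on `Λ`. -/
def IsCocycle (m : Lam →ₗ[ℂ] Lam →ₗ[ℂ] Lam) : Prop :=
  ∀ u v w : Lam, u * m v w - m (u * v) w + m u (v * w) - m u v * w = 0

/-! ### The Poisson structure -/

/-- Coordinates `x^1, x^2` (left) and `ξ_1, ξ_2` (right) of the cotangent bundle over the chart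
`z^3 ≠ 0` of the projective plane. -/
abbrev Chart := MvPolynomial (Fin 2 ⊕ Fin 2) ℂ

/-- The coordinate `x^{i+1} = z^{i+1} / z^3`. -/
def x (i : Fin 2) : Chart := MvPolynomial.X (Sum.inl i)

/-- The coordinate `ξ_{i+1} = w_{i+1} z^3`. -/
def ξ (i : Fin 2) : Chart := MvPolynomial.X (Sum.inr i)

/-- `∂_p ∧ ∂_q` applied to two functions. -/
def wedge (p q : Fin 2 ⊕ Fin 2) (f h : Chart) : Chart :=
  MvPolynomial.pderiv p f * MvPolynomial.pderiv q h
    - MvPolynomial.pderiv q f * MvPolynomial.pderiv p h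

open Sum in
/-- The bivector field `Π_s` applied to two functions. -/
def piBivector (s : ℂ) (f h : Chart) : Chart :=
  MvPolynomial.C Complex.I *
    (MvPolynomial.C s * (wedge (inr 0) (inl 0) f h + wedge (inr 1) (inl 1) f h)
      - ξ 0 * ξ 1 * wedge (inr 0) (inr 1) f h
      + ξ 0 * x 1 * wedge (inr 0) (inl 1) f h
      - ξ 1 * x 0 * wedge (inr 1) (inl 0) f h
      - x 0 * x 1 * wedge (inl 0) (inl 1) f h)

/-- The Poisson bracket `{f, h} = -i Π_s(df, dh)`. -/
def bracket (s : ℂ) (f h : Chart) : Chart := MvPolynomial.C (-Complex.I) * piBivector s f h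

/-- The coordinates `z` on the slice `z^3 = 1`. -/
def zChart : Fin 3 → Chart := ![x 0, x 1, 1]

/-- The coordinates `w` on the slice `z^3 = 1`, with `w_i z^i = 0`. -/
def wChart : Fin 3 → Chart := ![ξ 0, ξ 1, -(ξ 0 * x 0) - ξ 1 * x 1]

/-- The matrix unit times `z i` or `w i` that an arrow stands for; node `n` is the line
bundle `O(n)`. -/
def arrowMatrix {R : Type*} [CommRing R] (z w : Fin 3 → R) : Arrow → Matrix (Fin 3) (Fin 3) R
  | zLo i => Matrix.single 1 0 (z i)
  | zHi i => Matrix.single 2 1 (z i)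
  | wLo i => Matrix.single 0 1 (w i)
  | wHi i => Matrix.single 1 2 (w i)

theorem chart_moment : ∑ i, zChart i * wChart i = 0 := by
  simp only [Fin.sum_univ_three, zChart, wChart, Matrix.cons_val]
  ring

/-- Elements of `Λ` as matrices of functions in the chart. -/
def toChart : Lam →ₐ[ℂ] Matrix (Fin 3) (Fin 3) Chart :=
  RingQuot.liftAlgHom ℂ ⟨FreeAlgebra.lift ℂ
    (Sum.elim (fun a => Matrix.single a a 1) (arrowMatrix zChart wChart)), by
    intro p q h
    have hm := chart_moment
    have hm' : ∑ i, wChart i * zChart i = 0 := by rw [← hm]; simp only [mul_comm]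
    cases h with
    | idem a b =>
      by_cases hab : a = b
      · subst hab; simp [freeE]
      · simp [freeE, hab]
    | one =>
      simp only [freeE, map_sum, FreeAlgebra.lift_ι_apply, Sum.elim_inl, map_one]
      ext i j
      fin_cases i <;> fin_cases j <;>
        simp [Fin.sum_univ_three]
    | tgt y => cases y <;> simp [freeE, freeA, Arrow.tgt, arrowMatrix]
    | src y => cases y <;> simp [freeE, freeA, Arrow.src, arrowMatrix]
    | zz i j => simp [freeA, arrowMatrix, mul_comm]
    | ww i j => simp [freeA, arrowMatrix, mul_comm]
    | zw i j => simp [freeA, arrowMatrix, mul_comm]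
    | moment_zw1 =>
      simp only [freeA, map_sum, map_mul, FreeAlgebra.lift_ι_apply, Sum.elim_inr, arrowMatrix,
        Matrix.single_mul_single_same, map_zero]
      rw [← Matrix.single_zero 1 1, ← hm]
      exact (map_sum (Matrix.singleAddMonoidHom (α := Chart) (1 : Fin 3) (1 : Fin 3)) _ _).symm
    | moment_wz1 =>
      simp only [freeA, map_sum, map_mul, FreeAlgebra.lift_ι_apply, Sum.elim_inr, arrowMatrix,
        Matrix.single_mul_single_same, map_zero]
      rw [← Matrix.single_zero 1 1, ← hm']
      exact (map_sum (Matrix.singleAddMonoidHom (α := Chart) (1 : Fin 3) (1 : Fin 3)) _ _).symm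
    | moment_zw2 =>
      simp only [freeA, map_sum, map_mul, FreeAlgebra.lift_ι_apply, Sum.elim_inr, arrowMatrix,
        Matrix.single_mul_single_same, map_zero]
      rw [← Matrix.single_zero 2 2, ← hm]
      exact (map_sum (Matrix.singleAddMonoidHom (α := Chart) (2 : Fin 3) (2 : Fin 3)) _ _).symm
    | moment_wz0 =>
      simp only [freeA, map_sum, map_mul, FreeAlgebra.lift_ι_apply, Sum.elim_inr, arrowMatrix,
        Matrix.single_mul_single_same, map_zero]
      rw [← Matrix.single_zero 0 0, ← hm']
      exact (map_sum (Matrix.singleAddMonoidHom (α := Chart) (0 : Fin 3) (0 : Fin 3)) _ _).symm⟩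

/-- The function on the cotangent bundle, restricted to the chart, of a closed element at the
node `0`; for instance `w_i z^j` goes to the product of the two coordinates. -/
def fn (u : Lam) : Chart := toChart u 0 0

/-- The commutator of `m` at `u`, `v` is the Poisson bracket of the functions `u`, `v`. -/
def Matches (s : ℂ) (m : Lam →ₗ[ℂ] Lam →ₗ[ℂ] Lam) (u v : Lam) : Prop :=
  fn (m u v - m v u) = bracket s (fn u) (fn v)

/-! ### The Kodaira–Spencer deformation `w_i z^i = τ` -/

section Family

variable {k : Type} [CommRing k] (τ : k)

/-- Functions on the locus `w_i z^i = τ` in `V × V*`, over a base ring `k`. -/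
abbrev Coord := MvPolynomial (Fin 3 ⊕ Fin 3) k ⧸
  Ideal.span {(∑ i : Fin 3, MvPolynomial.X (Sum.inr i) * MvPolynomial.X (Sum.inl i) :
    MvPolynomial (Fin 3 ⊕ Fin 3) k) - MvPolynomial.C τ}

/-- The coordinate `z^i`. -/
def zc (i : Fin 3) : Coord τ := Ideal.Quotient.mk _ (MvPolynomial.X (Sum.inl i))

/-- The coordinate `w_i`. -/
def wc (i : Fin 3) : Coord τ := Ideal.Quotient.mk _ (MvPolynomial.X (Sum.inr i))

/-- The functions of weight `n` for the action `z ↦ λ z`, `w ↦ λ⁻¹ w`. -/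
def weightPart (n : ℤ) : Submodule k (Coord τ) :=
  (MvPolynomial.weightedHomogeneousSubmodule k
    (Sum.elim (fun _ => (1 : ℤ)) (fun _ => (-1 : ℤ)) : Fin 3 ⊕ Fin 3 → ℤ) n).map
    (Ideal.Quotient.mkₐ k _).toLinearMap

/-- Functions where `z^i ≠ 0`. -/
abbrev Loc (i : Fin 3) := Localization.Away (zc τ i)

/-- Functions where `z^i ≠ 0` and `z^j ≠ 0`. -/
abbrev Loc₂ (i j : Fin 3) := Localization.Away (zc τ i * zc τ j)

/-- Restriction from `z^i ≠ 0` to `z^i z^j ≠ 0`. -/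
def resLeft (i j : Fin 3) : Loc τ i →+* Loc₂ τ i j :=
  IsLocalization.Away.awayToAwayRight (zc τ i) (zc τ j)

/-- Restriction from `z^j ≠ 0` to `z^i z^j ≠ 0`. -/
def resRight (i j : Fin 3) : Loc τ j →+* Loc₂ τ i j :=
  IsLocalization.Away.awayToAwayLeft (zc τ j) (zc τ i)

/-- Functions on `{w_i z^i = τ, z ≠ 0}` in `(V ∖ 0) × V*`, glued from the opens `z^i ≠ 0`. -/
def Functions : Subalgebra (Coord τ) (∀ i, Loc τ i) where
  carrier := {f | ∀ i j, resLeft τ i j (f i) = resRight τ i j (f j)}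
  mul_mem' := by
    intro f h hf hh i j
    simp [hf i j, hh i j]
  add_mem' := by
    intro f h hf hh i j
    simp [hf i j, hh i j]
  algebraMap_mem' := by
    intro r i j
    simp [Pi.algebraMap_apply, resLeft, resRight, IsLocalization.Away.awayToAwayRight_eq,
      IsLocalization.Away.awayToAwayLeft_eq]

/-- A function of weight `n`, that is, a section of `O(n)` on the quotient
`X_τ = {w_i z^i = τ, z ≠ 0} / 𝔾_m`. -/
def HasWeight (n : ℤ) (f : Functions τ) : Prop :=
  ∀ i, ∃ (N : ℕ) (r : Coord τ), r ∈ weightPart τ (n + N) ∧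
    f.1 i * algebraMap (Coord τ) (Loc τ i) (zc τ i ^ N) = algebraMap (Coord τ) (Loc τ i) r

/-- Endomorphisms of `O ⊕ O(1) ⊕ O(2)` on `X_τ`, as matrices whose `(p, q)` entry is a section of
`O(p - q)`; composition is the product of matrices. -/
def tiltingEnd : Set (Matrix (Fin 3) (Fin 3) (Functions τ)) :=
  {A | ∀ p q : Fin 3, HasWeight τ ((p : ℤ) - (q : ℤ)) (A p q)}

/-- Multiplication of a matrix of functions by an element of the base ring. -/
def scal (r : k) (A : Matrix (Fin 3) (Fin 3) (Functions τ)) :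
    Matrix (Fin 3) (Fin 3) (Functions τ) :=
  algebraMap k (Coord τ) r • A

/-- The endomorphism of `O ⊕ O(1) ⊕ O(2)` that an arrow stands for. -/
def arrowEnd : Arrow → Matrix (Fin 3) (Fin 3) (Functions τ) :=
  arrowMatrix (fun i => algebraMap (Coord τ) (Functions τ) (zc τ i))
    (fun i => algebraMap (Coord τ) (Functions τ) (wc τ i))

end Family

/-- The dual number `ε`. -/
def ε : DualNumber ℂ := DualNumber.eps

/-- The first order deformation `u ⋆ v = u v + ε m(u, v)` of `Λ` is equivalent to the one given by
the endomorphism algebra of `O ⊕ O(1) ⊕ O(2)` on the first order deformation `w_i z^i = τ ε` of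
`w_i z^i = 0`: the map `u₀ + ε u₁ ↦ φ u₀ + ε φ u₁` is an isomorphism of algebras over the dual
numbers, takes idempotents to projections, and agrees modulo `ε` with the arrows `z^i`, `w_i`
acting by multiplication. -/
def IsKodairaSpencer (m : Lam →ₗ[ℂ] Lam →ₗ[ℂ] Lam) (τ : ℂ) : Prop :=
  ∃ φ : Lam →+ Matrix (Fin 3) (Fin 3) (Functions (τ • ε)),
    (∀ (r : ℂ) (u : Lam), φ (r • u) = scal (τ • ε) (algebraMap ℂ (DualNumber ℂ) r) (φ u)) ∧
    (∀ u, φ u ∈ tiltingEnd (τ • ε)) ∧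
    (∀ A ∈ tiltingEnd (τ • ε), ∃! p : Lam × Lam, A = φ p.1 + scal (τ • ε) ε (φ p.2)) ∧
    (∀ u v, φ u * φ v = φ (u * v) + scal (τ • ε) ε (φ (m u v))) ∧
    (∀ a, φ (e a) = Matrix.single a a 1) ∧
    (∀ y, ∃ Y, φ (arr y) = arrowEnd (τ • ε) y + scal (τ • ε) ε Y)

end CotangentP2

end

noncomputable section

namespace CotangentP2

open Arrow

/-! Indices in these comments run over 1, 2, 3, so `2 : Fin 3` belongs to z^3 and w_3.

The engine is the notion of a `Lift`: an algebra in which the arrows multiply as in Λ, except that a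
tip s and its replacement f_s differ by an infinitesimal Δ(g(s)), where Δ is compatible with the
bimodule structure of Λ. Rewriting a word from the right inside a lift yields its normal form plus Δ
of exactly the tips that G₂ collects (`Lift.word_eq`). The irreducible paths form a basis of Λ
(`irrBasis`), hence define a linear section of Λ into the lift, and the failure of this section to
be multiplicative is Δ ∘ m (`Lift.sec_mul`). Statements about m become statements about well-chosen
associative algebras, and m itself never has to be tabulated.

Basis. Rewriting shows that the irreducible paths span. They are sorted, so ends and letters
determine them, and they never contain both z^3 and w_3; hence paths with the same ends have
different leading monomials in the chart. This gives existence and uniqueness of m, and an embedding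
of Λ into matrices of functions on the chart (`toChart_injective`).

Cocycle. `chartLift` realises g by 3×3 matrices over pairs f₀ + ε f₁ of chart functions, with a
product twisted by the biderivation `bidiff` and with arrows corrected by `arrowShift`. A
biderivation of a commutative algebra is always a Hochschild cocycle, so the product is associative;
since Δ is injective, associativity is the cocycle identity for m.

Poisson structure. The corner at node 0 is commutative, so the commutator of m there is the
antisymmetrised `bidiff` (`fn_commutator`). The two brackets {ξ_1, ξ_2} and {ξ_1, ξ_1 x^1} already
recover a, b and c.

Kodaira–Spencer class. If a = b = c = 0, tips evaluated at commuting coordinates fail by multiples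
of the moment map, which is τε; so matrices of functions on the deformed locus form a lift
(`coordLift`). Since z^1, z^2 is a regular sequence there, functions extend across z = 0. Monomials
of weight p - q are values of paths from q to p, and restriction to the chart gives uniqueness, so
this lift is the endomorphism algebra. Conversely, two first-order deformations equivalent to the
same algebra differ by a coboundary (`exists_coboundary`). Coboundaries do not change commutators in
the corner, which forces a = b = c = 0. Then ∑ m(w_i, z^i) = t e_0, and at the origin of the chart a
coboundary contributes nothing to this sum, so t = τ. -/

/-! ### Paths with given ends -/

/-- Composable words from the node `q` to the node `p`; the empty word is allowed if `p = q`. -/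
def PathFrom (p q : Fin 3) : List Arrow → Prop
  | [] => p = q
  | y :: u => y.tgt = p ∧ PathFrom y.src q u

theorem pathFrom_append {p q : Fin 3} {u v : List Arrow} :
    PathFrom p q (u ++ v) ↔ ∃ r, PathFrom p r u ∧ PathFrom r q v := by
  induction u generalizing p with
  | nil => simp [PathFrom]
  | cons y u ih => simp [PathFrom, ih, and_assoc]

theorem PathFrom.src_unique {p q p' q' : Fin 3} {u : List Arrow} (h : PathFrom p q u)
    (h' : PathFrom p' q' u) (hu : u ≠ []) : p = p' ∧ q = q' := by
  induction u generalizing p p' with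
  | nil => exact absurd rfl hu
  | cons y u ih =>
    obtain ⟨rfl, h⟩ := h
    obtain ⟨rfl, h'⟩ := h'
    refine ⟨rfl, ?_⟩
    by_cases hu' : u = []
    · subst hu'
      exact h.symm.trans h'
    · exact (ih h h' hu').2

theorem isPath_cons_cons {x y : Arrow} {u : List Arrow} :
    IsPath (x :: y :: u) ↔ x.src = y.tgt ∧ IsPath (y :: u) := by
  simp [IsPath]

theorem isPath_iff {u : List Arrow} : IsPath u ↔ u ≠ [] ∧ ∃ p q, PathFrom p q u := by
  induction u with
  | nil => simp [IsPath]
  | cons x u ih =>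
    cases u with
    | nil => simp [IsPath, PathFrom]
    | cons y u =>
      rw [isPath_cons_cons, ih]
      simp only [PathFrom, ne_eq, reduceCtorEq, not_false_eq_true, true_and]
      constructor
      · rintro ⟨h, p, q, -, h'⟩
        exact ⟨_, q, rfl, h.symm, h'⟩
      · rintro ⟨p, q, -, h, h'⟩
        exact ⟨h.symm, _, q, rfl, h'⟩

theorem PathFrom.isPath {p q : Fin 3} {u : List Arrow} (h : PathFrom p q u) (hu : u ≠ []) :
    IsPath u :=
  isPath_iff.2 ⟨hu, p, q, h⟩

theorem PathFrom.isPath_append_iff {p q r s : Fin 3} {u v : List Arrow} (hu : PathFrom p q u)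
    (hv : PathFrom r s v) (hu' : u ≠ []) (hv' : v ≠ []) : IsPath (u ++ v) ↔ q = r := by
  constructor
  · intro h
    obtain ⟨-, p', s', h⟩ := isPath_iff.1 h
    obtain ⟨t, h1, h2⟩ := pathFrom_append.1 h
    exact ((hu.src_unique h1 hu').2).trans (hv.src_unique h2 hv').1.symm
  · rintro rfl
    exact (pathFrom_append.2 ⟨_, hu, hv⟩).isPath (by simp [hu'])

/-! ### Rewriting words -/

theorem replacement_pathFrom {s : List Arrow} {q : ℤ × List Arrow} (hq : q ∈ replacement s)
    {a b : Fin 3} (h : PathFrom a b s) : PathFrom a b q.2 := by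
  unfold replacement rule at hq
  split at hq <;> (try split_ifs at hq) <;>
    simp only [Option.getD_none, Option.getD_some, List.mem_cons, List.not_mem_nil, or_false] at hq
  all_goals
    first
    | exact hq.elim
    | (rcases hq with rfl | rfl)
  all_goals
    simpa [PathFrom, Arrow.src, Arrow.tgt] using h

/-- The combination of irreducible words to which the right reduction brings a word. -/
def normalForm (p : List Arrow) : List Arrow →₀ ℂ :=
  match h : rightmostTip p with
  | none => Finsupp.single p 1
  | some (a, s, b) =>
      ((replacement s).attach.map
        (fun q => ((q.1.1 : ℤ) : ℂ) • normalForm (a ++ q.1.2 ++ b))).sum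
termination_by dict p
decreasing_by exact replacement_decreases p a s b h q.1 q.2

theorem normalForm_of_irred {p : List Arrow} (h : Irred p) :
    normalForm p = Finsupp.single p 1 := by
  rw [normalForm]
  split
  · rfl
  · rename_i h'
    rw [Irred, h'] at h
    cases h

theorem tipsUsed_of_irred {p : List Arrow} (h : Irred p) : tipsUsed p = 0 := by
  rw [tipsUsed]
  split
  · rfl
  · rename_i h'
    rw [Irred, h'] at h
    cases h

theorem normalForm_of_tip {p a s b : List Arrow} (h : rightmostTip p = some (a, s, b)) :
    normalForm p =
      ((replacement s).map fun q => (q.1 : ℂ) • normalForm (a ++ q.2 ++ b)).sum := by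
  rw [normalForm]
  split
  · rename_i h'
    rw [h'] at h
    cases h
  · rename_i a' s' b' h'
    rw [h'] at h
    simp only [Option.some.injEq, Prod.mk.injEq] at h
    obtain ⟨rfl, rfl, rfl⟩ := h
    -- The recursion runs over `attach` only to have membership at hand for termination; mapping
    -- back to the bare list forgets it.
    conv_rhs => rw [← List.attach_map_subtype_val (replacement s'), List.map_map]
    rfl

theorem tipsUsed_of_tip {p a s b : List Arrow} (h : rightmostTip p = some (a, s, b)) :
    tipsUsed p = Finsupp.single (a, s, b) 1 +
      ((replacement s).map fun q => (q.1 : ℂ) • tipsUsed (a ++ q.2 ++ b)).sum := by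
  rw [tipsUsed]
  split
  · rename_i h'
    rw [h'] at h
    cases h
  · rename_i a' s' b' h'
    rw [h'] at h
    simp only [Option.some.injEq, Prod.mk.injEq] at h
    obtain ⟨rfl, rfl, rfl⟩ := h
    conv_rhs => rw [← List.attach_map_subtype_val (replacement s'), List.map_map]
    rfl

/-- Induction along the right reduction. -/
theorem reduction_induction {P : List Arrow → Prop} (irred : ∀ p, Irred p → P p)
    (tip : ∀ p a s b, rightmostTip p = some (a, s, b) →
      (∀ q ∈ replacement s, P (a ++ q.2 ++ b)) → P p) (p : List Arrow) : P p := by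
  induction hn : dict p using Nat.strong_induction_on generalizing p with
  | _ n ih =>
    subst hn
    rcases h : rightmostTip p with _ | ⟨a, s, b⟩
    · exact irred p h
    · exact tip p a s b h fun q hq => ih _ (replacement_decreases p a s b h q hq) _ rfl

/-- Rules preserve ends and length, so a linear condition on normal forms of nonempty paths need
only be tested on nonempty irreducible paths with the same ends. -/
theorem normalForm_mem (p : List Arrow) (S : Submodule ℂ (List Arrow →₀ ℂ)) {a b : Fin 3}
    (hp : PathFrom a b p) (hne : p ≠ [])
    (hS : ∀ u, PathFrom a b u → u ≠ [] → Irred u → Finsupp.single u 1 ∈ S) :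
    normalForm p ∈ S := by
  induction p using reduction_induction with
  | irred p h => rw [normalForm_of_irred h]; exact hS p hp hne h
  | tip p l s r h ih =>
    rw [normalForm_of_tip h]
    obtain ⟨rfl, htip⟩ := rightmostTip_spec _ _ _ _ h
    refine list_sum_mem fun f hf => ?_
    obtain ⟨q, hq, rfl⟩ := List.mem_map.1 hf
    refine S.smul_mem _ (ih q hq ?_ ?_)
    · obtain ⟨y, hy, hr⟩ := pathFrom_append.1 hp
      obtain ⟨z, hl, hs⟩ := pathFrom_append.1 hy
      exact pathFrom_append.2 ⟨y, pathFrom_append.2 ⟨z, hl, replacement_pathFrom hq hs⟩, hr⟩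
    · intro h0
      have h1 := congrArg List.length h0
      have h2 := (replacement_lt s q hq).1
      apply hne
      rw [← List.length_eq_zero_iff]
      simp only [List.length_append, List.length_nil] at h1 ⊢
      omega

/-! ### Relations of the quiver algebra -/

theorem mk_eq {p q : Free} (h : QuiverRel p q) :
    RingQuot.mkAlgHom ℂ QuiverRel p = RingQuot.mkAlgHom ℂ QuiverRel q :=
  RingQuot.mkAlgHom_rel ℂ h

theorem e_mul_e (a b : Fin 3) : e a * e b = if a = b then e a else 0 := by
  have := mk_eq (QuiverRel.idem a b)
  rw [map_mul] at this
  refine this.trans ?_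
  split_ifs <;> simp [e]

theorem sum_e : ∑ a, e a = 1 := by
  have := mk_eq QuiverRel.one
  rwa [map_sum, map_one] at this

theorem e_tgt_mul_arr (y : Arrow) : e y.tgt * arr y = arr y := by
  simpa [e, arr] using mk_eq (QuiverRel.tgt y)

theorem arr_mul_e_src (y : Arrow) : arr y * e y.src = arr y := by
  simpa [e, arr] using mk_eq (QuiverRel.src y)

theorem arr_zz (i j : Fin 3) : arr (zHi i) * arr (zLo j) = arr (zHi j) * arr (zLo i) := by
  simpa [arr] using mk_eq (QuiverRel.zz i j)

theorem arr_ww (i j : Fin 3) : arr (wLo i) * arr (wHi j) = arr (wLo j) * arr (wHi i) := by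
  simpa [arr] using mk_eq (QuiverRel.ww i j)

theorem arr_zw (i j : Fin 3) : arr (zLo i) * arr (wLo j) = arr (wHi j) * arr (zHi i) := by
  simpa [arr] using mk_eq (QuiverRel.zw i j)

theorem arr_moment_wz1 : arr (wHi 2) * arr (zHi 2) =
    (-1 : ℂ) • (arr (wHi 0) * arr (zHi 0)) + (-1 : ℂ) • (arr (wHi 1) * arr (zHi 1)) := by
  have := mk_eq QuiverRel.moment_wz1
  simp only [Fin.sum_univ_three, map_add, map_mul, map_zero] at this
  simp only [arr]
  refine (eq_neg_of_add_eq_zero_right this).trans ?_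
  rw [neg_add]
  exact congrArg₂ _ (neg_one_smul ℂ _).symm (neg_one_smul ℂ _).symm

theorem arr_moment_zw2 : arr (zHi 2) * arr (wHi 2) =
    (-1 : ℂ) • (arr (zHi 0) * arr (wHi 0)) + (-1 : ℂ) • (arr (zHi 1) * arr (wHi 1)) := by
  have := mk_eq QuiverRel.moment_zw2
  simp only [Fin.sum_univ_three, map_add, map_mul, map_zero] at this
  simp only [arr]
  refine (eq_neg_of_add_eq_zero_right this).trans ?_
  rw [neg_add]
  exact congrArg₂ _ (neg_one_smul ℂ _).symm (neg_one_smul ℂ _).symm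

theorem arr_moment_wz0 : arr (wLo 2) * arr (zLo 2) =
    (-1 : ℂ) • (arr (wLo 0) * arr (zLo 0)) + (-1 : ℂ) • (arr (wLo 1) * arr (zLo 1)) := by
  have := mk_eq QuiverRel.moment_wz0
  simp only [Fin.sum_univ_three, map_add, map_mul, map_zero] at this
  simp only [arr]
  refine (eq_neg_of_add_eq_zero_right this).trans ?_
  rw [neg_add]
  exact congrArg₂ _ (neg_one_smul ℂ _).symm (neg_one_smul ℂ _).symm

/-- The rules of length three follow from quadratic relations by a detour through node 0: w_i z^k at
node 1 equals z^k w_i, which puts two w's next to each other. The next lemma uses the same detour to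
make two z's adjacent. -/
theorem arr_wzw (i j k : Fin 3) : arr (wHi i) * (arr (zHi k) * arr (wHi j)) =
    arr (wHi j) * (arr (zHi k) * arr (wHi i)) := by
  rw [← mul_assoc, ← arr_zw, mul_assoc, arr_ww, ← mul_assoc, arr_zw, mul_assoc]

theorem arr_zwz (i j k : Fin 3) : arr (zHi i) * (arr (wHi k) * arr (zHi j)) =
    arr (zHi j) * (arr (wHi k) * arr (zHi i)) := by
  rw [← arr_zw, ← mul_assoc, arr_zz, mul_assoc, arr_zw]

theorem arr_wwz (k : Fin 3) : arr (wLo 2) * (arr (wHi k) * arr (zHi 2)) =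
    (-1 : ℂ) • (arr (wLo 1) * (arr (wHi k) * arr (zHi 1))) +
      (-1 : ℂ) • (arr (wLo 0) * (arr (wHi k) * arr (zHi 0))) := by
  simp only [← mul_assoc]
  rw [arr_ww 2 k, arr_ww 1 k, arr_ww 0 k, mul_assoc, arr_moment_wz1, mul_add, mul_smul_comm,
    mul_smul_comm, add_comm, mul_assoc, mul_assoc]

theorem cls_cons (y : Arrow) (u : List Arrow) : cls (y :: u) = arr y * cls u := by
  simp [cls]

theorem cls_tip {s : List Arrow} (hs : IsTip s = true) :
    cls s = ((replacement s).map fun q => (q.1 : ℂ) • cls q.2).sum := by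
  unfold IsTip at hs
  unfold replacement
  unfold rule at hs ⊢
  split at hs <;> (try split_ifs at hs ⊢) <;>
    simp only [Option.isSome_none, Option.isSome_some, Bool.false_eq_true] at hs <;>
    simp_all [cls]
  · exact arr_zz _ _
  · exact arr_ww _ _
  · rw [arr_zw, arr_moment_wz1]
  · exact arr_zw _ _
  · exact arr_moment_wz1
  · exact arr_moment_zw2
  · exact arr_moment_wz0
  · exact arr_wzw _ _ _
  · exact arr_zwz _ _ _
  · exact arr_wwz 0
  -- The word w_1 w_2 z^1 is itself reducible, so the rule for k = 2 contains w_2 w_1 z^1 instead;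
  -- this is the source of the term [w_1, w_2] z^1 subtracted in `onTip`.
  · rw [arr_wwz 1, ← mul_assoc (arr (wLo 0)), arr_ww 0 1, mul_assoc]

/-! ### Algebras with a first order lift of the quiver relations -/

/-- An algebra `B` with idempotents `E`, arrows `X` and a copy `Δ` of the bimodule `Λ`, such that
a tip `s` and its replacement `f_s` differ by the value of the cochain `γ`. -/
structure Lift (γ : T₂ → Lam) (B : Type*) [Semiring B] [Algebra ℂ B] where
  /-- idempotents -/
  E : Fin 3 → B
  /-- arrows -/
  X : Arrow → B
  /-- the infinitesimal part -/
  Δ : Lam →ₗ[ℂ] B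
  idem : ∀ a b, E a * E b = if a = b then E a else 0
  tgt : ∀ y, E y.tgt * X y = X y
  src : ∀ y, X y * E y.src = X y
  E_mul : ∀ a v, E a * Δ v = Δ (e a * v)
  mul_E : ∀ a v, Δ v * E a = Δ (v * e a)
  X_mul : ∀ y v, X y * Δ v = Δ (arr y * v)
  mul_X : ∀ y v, Δ v * X y = Δ (v * arr y)
  tip : ∀ s, IsTip s = true → (s.map X).prod =
    ((replacement s).map fun q => (q.1 : ℂ) • (q.2.map X).prod).sum + Δ (onTip γ s)

/-- The quiver algebra itself. -/
def trivialLift (γ : T₂ → Lam) : Lift γ Lam where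
  E := e
  X := arr
  Δ := 0
  idem := e_mul_e
  tgt := e_tgt_mul_arr
  src := arr_mul_e_src
  E_mul := by simp
  mul_E := by simp
  X_mul := by simp
  mul_X := by simp
  tip s hs := by
    rw [LinearMap.zero_apply, add_zero]
    exact cls_tip hs

namespace Lift

variable {γ : T₂ → Lam} {B : Type*} [Semiring B] [Algebra ℂ B] (T : Lift γ B)

/-- The product of the arrows of a word. -/
def word (p : List Arrow) : B := (p.map T.X).prod

theorem word_nil : T.word [] = 1 := rfl

theorem word_cons (y : Arrow) (u : List Arrow) : T.word (y :: u) = T.X y * T.word u := by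
  simp [word]

theorem word_append (u v : List Arrow) : T.word (u ++ v) = T.word u * T.word v := by
  simp [word]

theorem word_mul_Δ (u : List Arrow) (v : Lam) : T.word u * T.Δ v = T.Δ (cls u * v) := by
  induction u with
  | nil => simp [word, cls]
  | cons y u ih => rw [word_cons, mul_assoc, ih, T.X_mul, cls_cons, mul_assoc]

theorem Δ_mul_word (u : List Arrow) (v : Lam) : T.Δ v * T.word u = T.Δ (v * cls u) := by
  induction u generalizing v with
  | nil => simp [word, cls]
  | cons y u ih => rw [word_cons, ← mul_assoc, T.mul_X, ih, cls_cons, mul_assoc]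

/-- Right reduction of a word in a lift. -/
theorem word_eq (p : List Arrow) : T.word p =
    Finsupp.linearCombination ℂ T.word (normalForm p) + T.Δ (evalCochain γ (tipsUsed p)) := by
  induction p using reduction_induction with
  | irred p h => simp [normalForm_of_irred h, tipsUsed_of_irred h]
  | tip p a s b h ih =>
    obtain ⟨rfl, hs⟩ := rightmostTip_spec _ _ _ _ h
    -- A single rewriting step inside a word: as Δ is a bimodule map, the defect of the tip becomes
    -- Δ(α g(s) β), which is the term that `tipsUsed` records.
    have h1 : T.word (a ++ s ++ b) =
        ((replacement s).map fun q => (q.1 : ℂ) • T.word (a ++ q.2 ++ b)).sum +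
          T.Δ (cls a * onTip γ s * cls b) := by
      have : T.word s = _ := T.tip s hs
      rw [word_append, word_append, this, mul_add, add_mul, word_mul_Δ, Δ_mul_word,
        ← List.sum_map_mul_left, ← List.sum_map_mul_right]
      simp [word, mul_assoc]
    rw [h1, normalForm_of_tip h, tipsUsed_of_tip h, map_add, map_add, map_list_sum, map_list_sum,
      map_list_sum, add_comm (T.Δ _) (List.sum _), ← add_assoc]
    congr 1
    · rw [List.map_map, List.map_map, List.map_map, ← List.sum_map_add]
      refine congrArg _ (List.map_congr_left fun q hq => ?_)
      rw [ih q hq]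
      simp
    · simp [evalCochain]

theorem E_mul_word {p q : Fin 3} {u : List Arrow} (h : PathFrom p q u) (hu : u ≠ []) (a : Fin 3) :
    T.E a * T.word u = if a = p then T.word u else 0 := by
  cases u with
  | nil => exact absurd rfl hu
  | cons y u =>
    obtain ⟨rfl, -⟩ := h
    rw [word_cons, ← mul_assoc, ← T.tgt y, ← mul_assoc, T.idem]
    split_ifs with h
    · subst h; rfl
    · simp

theorem word_mul_E {p q : Fin 3} {u : List Arrow} (h : PathFrom p q u) (hu : u ≠ []) (a : Fin 3) :
    T.word u * T.E a = if q = a then T.word u else 0 := by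
  induction u generalizing p with
  | nil => exact absurd rfl hu
  | cons y u ih =>
    obtain ⟨rfl, h⟩ := h
    by_cases hu' : u = []
    · subst hu'
      have h' : y.src = q := h
      subst h'
      rw [word_cons, word_nil, mul_one]
      conv_lhs => rw [← T.src y, mul_assoc, T.idem]
      split_ifs with h
      · rw [T.src]
      · simp
    · rw [word_cons, mul_assoc, ih h hu', mul_ite, mul_zero]

end Lift

/-! ### Irreducible paths -/

/-- Irreducible paths `u` from `q` to `p`, as triples `(p, q, u)`; the empty words stand for the
trivial paths. -/
abbrev IrrPath := {t : Fin 3 × Fin 3 × List Arrow // PathFrom t.1 t.2.1 t.2.2 ∧ Irred t.2.2}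

namespace Lift

variable {γ : T₂ → Lam} {B : Type*} [Semiring B] [Algebra ℂ B] (T : Lift γ B)

/-- The element of a lift given by an irreducible path. -/
def el (t : IrrPath) : B := T.E t.1.1 * T.word t.1.2.2

theorem E_mul_word_mul_E {p q : Fin 3} {u : List Arrow} (h : PathFrom p q u) (a : Fin 3) :
    T.E p * T.word u * T.E a = if q = a then T.E p * T.word u else 0 := by
  by_cases hu : u = []
  · subst hu
    have : p = q := h
    subst this
    rw [word_nil, mul_one, T.idem]
  · rw [mul_assoc, T.word_mul_E h hu, mul_ite, mul_zero]

theorem E_mul_word_self {p q : Fin 3} {u : List Arrow} (h : PathFrom p q u) (hu : u ≠ []) :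
    T.E p * T.word u = T.word u := by
  rw [T.E_mul_word h hu, if_pos rfl]

theorem path_mul_path {p q r s : Fin 3} {u v : List Arrow} (hu : PathFrom p q u)
    (hv : PathFrom r s v) : T.E p * T.word u * (T.E r * T.word v) =
      if q = r then T.E p * T.word (u ++ v) else 0 := by
  rw [← mul_assoc, T.E_mul_word_mul_E hu]
  split_ifs with h
  · rw [mul_assoc, ← word_append]
  · rw [zero_mul]

end Lift

/-- The element of `Λ` given by an irreducible path. -/
def irr (t : IrrPath) : Lam := e t.1.1 * cls t.1.2.2

theorem e_mul_cls {p q : Fin 3} {u : List Arrow} (h : PathFrom p q u) (hu : u ≠ []) :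
    e p * cls u = cls u :=
  (trivialLift 0).E_mul_word_self h hu

/-- The trivial lift has Δ = 0, so right reduction there is an identity in Λ. -/
theorem cls_eq_linearCombination (p : List Arrow) :
    cls p = Finsupp.linearCombination ℂ cls (normalForm p) := by
  have := (trivialLift 0).word_eq p
  rw [show (trivialLift 0).Δ = 0 from rfl, LinearMap.zero_apply, add_zero] at this
  exact this

theorem cls_mem_of_irr {p q : Fin 3} {u : List Arrow} (h : PathFrom p q u) (hu : u ≠ [])
    (S : Submodule ℂ Lam) (hS : ∀ t : IrrPath, t.1.1 = p → t.1.2.1 = q → t.1.2.2 ≠ [] → irr t ∈ S) :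
    cls u ∈ S := by
  rw [cls_eq_linearCombination]
  refine normalForm_mem u (S.comap (Finsupp.linearCombination ℂ cls)) h hu fun v hv hv0 hirr => ?_
  simp only [Submodule.mem_comap, Finsupp.linearCombination_single, one_smul]
  have := hS ⟨(p, q, v), hv, hirr⟩ rfl rfl hv0
  rwa [irr, e_mul_cls hv hv0] at this

theorem irred_nil : Irred [] := rfl

/-- The trivial path at a node. -/
def trivialPath (a : Fin 3) : IrrPath := ⟨(a, a, []), rfl, irred_nil⟩

theorem irr_trivialPath (a : Fin 3) : irr (trivialPath a) = e a := by
  simp [irr, trivialPath, cls]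

/-- The span is stable under left multiplication by idempotents and by arrows, because a path
lengthened by an arrow can be reduced again. It is therefore a left ideal, and it contains 1 = ∑
e_a. -/
theorem span_irr : Submodule.span ℂ (Set.range irr) = ⊤ := by
  set S := Submodule.span ℂ (Set.range irr) with hS
  have mem : ∀ t, irr t ∈ S := fun t => Submodule.subset_span ⟨t, rfl⟩
  have he : ∀ a, ∀ v ∈ S, e a * v ∈ S := by
    intro a v hv
    induction hv using Submodule.span_induction with
    | mem v hv =>
      obtain ⟨t, rfl⟩ := hv
      rw [irr, ← mul_assoc, e_mul_e]
      split_ifs with h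
      · rw [h]; exact mem t
      · rw [zero_mul]; exact S.zero_mem
    | zero => simp
    | add u v _ _ hu hv => rw [mul_add]; exact S.add_mem hu hv
    | smul c v _ hv => rw [mul_smul_comm]; exact S.smul_mem _ hv
  have ha : ∀ y, ∀ v ∈ S, arr y * v ∈ S := by
    intro y v hv
    induction hv using Submodule.span_induction with
    | mem v hv =>
      obtain ⟨t, rfl⟩ := hv
      rw [irr, ← mul_assoc, ← arr_mul_e_src, mul_assoc (arr y), e_mul_e]
      split_ifs with h
      · rw [arr_mul_e_src, ← cls_cons]
        exact cls_mem_of_irr (p := y.tgt) (q := t.1.2.1) (u := y :: t.1.2.2) ⟨rfl, h ▸ t.2.1⟩ (by simp) S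
          fun t _ _ _ => mem t
      · rw [mul_zero, zero_mul]; exact S.zero_mem
    | zero => simp
    | add u v _ _ hu hv => rw [mul_add]; exact S.add_mem hu hv
    | smul c v _ hv => rw [mul_smul_comm]; exact S.smul_mem _ hv
  have hmul : ∀ f : Free, ∀ v ∈ S, RingQuot.mkAlgHom ℂ QuiverRel f * v ∈ S := by
    intro f
    induction f using FreeAlgebra.induction with
    | grade0 r =>
      intro v hv
      rw [AlgHom.commutes, ← Algebra.smul_def]
      exact S.smul_mem _ hv
    | grade1 x =>
      rcases x with a | y
      · exact he a
      · exact ha y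
    | mul f h hf hh => intro v hv; rw [map_mul, mul_assoc]; exact hf _ (hh _ hv)
    | add f h hf hh => intro v hv; rw [map_add, add_mul]; exact S.add_mem (hf _ hv) (hh _ hv)
  rw [eq_top_iff]
  intro v _
  obtain ⟨f, rfl⟩ := RingQuot.mkAlgHom_surjective ℂ QuiverRel v
  rw [← mul_one (RingQuot.mkAlgHom ℂ QuiverRel f)]
  refine hmul f 1 ?_
  rw [← sum_e]
  exact S.sum_mem fun a _ => irr_trivialPath a ▸ mem _

/-! ### Irreducible paths are sorted -/

theorem irred_cons {x : Arrow} {u : List Arrow} : Irred (x :: u) ↔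
    Irred u ∧ ¬IsTip ((x :: u).take 2) = true ∧ ¬IsTip ((x :: u).take 3) = true := by
  unfold Irred
  rw [rightmostTip]
  rcases rightmostTip u with _ | ⟨a, s, b⟩
  · simp only [true_and]
    split_ifs <;> simp_all
  · simp

/-- The homogeneous coordinate that an arrow stands for. -/
def Arrow.coord : Arrow → Fin 3 ⊕ Fin 3
  | zLo i => Sum.inl i
  | zHi i => Sum.inl i
  | wLo i => Sum.inr i
  | wHi i => Sum.inr i

/-- Only an arrow w_j : 1 → 0 can stand to the right of z^i : 0 → 1, and all these pairs are tips.
So an irreducible path meets the arrow z : 0 → 1 only as its rightmost letter. -/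
theorem eq_nil_of_zLo {i : Fin 3} {u : List Arrow} {p q : Fin 3} (h : PathFrom p q (zLo i :: u))
    (hu : Irred (zLo i :: u)) : u = [] := by
  rcases u with _ | ⟨y, u⟩
  · rfl
  · obtain ⟨-, h1, -⟩ := h
    have h2 := (irred_cons.1 hu).2.1
    rcases y with j | j | j | j <;> simp [Arrow.src, Arrow.tgt] at h1
    simp only [IsTip, rule, List.take] at h2
    split_ifs at h2 <;> simp at h2

/-- Between nodes 1 and 2 the letters alternate, and z^i w_k z^l is a tip when i < l, except for k =
l = 3, where w_3 z^3 is a tip instead. Hence the indices of the z's do not increase from left to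
right; the recursion advances two letters at a time. -/
theorem le_of_zHi : ∀ (u : List Arrow) (i p q : Fin 3), PathFrom p q (zHi i :: u) →
    Irred (zHi i :: u) → ∀ j, Sum.inl j ∈ u.map coord → j ≤ i
  | [], i, p, q, _, _, j, hj => by simp at hj
  | [wHi k], i, p, q, _, _, j, hj => by simp [coord] at hj
  | zHi k :: u, i, p, q, h, _, j, hj => by simp [PathFrom, Arrow.src, Arrow.tgt] at h
  | wLo k :: u, i, p, q, h, _, j, hj => by simp [PathFrom, Arrow.src, Arrow.tgt] at h
  | zLo k :: u, i, p, q, h, hu, j, hj => by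
    have h0 := eq_nil_of_zLo h.2 (irred_cons.1 hu).1
    subst h0
    have h2 := (irred_cons.1 hu).2.1
    simp [IsTip, rule] at h2
    simp [coord] at hj
    subst hj
    exact h2
  | wHi k :: zLo l :: u, i, p, q, h, _, j, hj => by simp [PathFrom, Arrow.src, Arrow.tgt] at h
  | wHi k :: wLo l :: u, i, p, q, h, _, j, hj => by simp [PathFrom, Arrow.src, Arrow.tgt] at h
  | wHi k :: wHi l :: u, i, p, q, h, _, j, hj => by simp [PathFrom, Arrow.src, Arrow.tgt] at h
  | wHi k :: zHi l :: u, i, p, q, h, hu, j, hj => by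
    have h1 := (irred_cons.1 hu).2.2
    have h2 := (irred_cons.1 (irred_cons.1 hu).1).2.1
    have hl : l ≤ i := by
      by_contra hlt
      simp [IsTip, rule] at h1 h2
      by_cases hk : k = 2 ∧ l = 2
      · simp [hk] at h2
      · simp [not_le.1 hlt] at h1
        exact hk h1
    have := le_of_zHi u l _ q h.2.2 (irred_cons.1 (irred_cons.1 hu).1).1
    simp only [List.map_cons, List.mem_cons, coord, reduceCtorEq, false_or, Sum.inl.injEq] at hj
    rcases hj with rfl | hj
    · exact hl
    · exact (this j hj).trans hl

theorem le_of_wHi : ∀ (u : List Arrow) (i p q : Fin 3), PathFrom p q (wHi i :: u) →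
    Irred (wHi i :: u) → ∀ j, Sum.inr j ∈ u.map coord → j ≤ i
  | [], i, p, q, _, _, j, hj => by simp at hj
  | zLo k :: u, i, p, q, h, _, j, hj => by simp [PathFrom, Arrow.src, Arrow.tgt] at h
  | wLo k :: u, i, p, q, h, _, j, hj => by simp [PathFrom, Arrow.src, Arrow.tgt] at h
  | wHi k :: u, i, p, q, h, _, j, hj => by simp [PathFrom, Arrow.src, Arrow.tgt] at h
  | [zHi k], i, p, q, _, _, j, hj => by simp [coord] at hj
  | zHi k :: zLo l :: u, i, p, q, h, hu, j, hj => by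
    have h0 := eq_nil_of_zLo h.2.2 (irred_cons.1 (irred_cons.1 hu).1).1
    subst h0
    simp [coord] at hj
  | zHi k :: wLo l :: u, i, p, q, h, _, j, hj => by simp [PathFrom, Arrow.src, Arrow.tgt] at h
  | zHi k :: zHi l :: u, i, p, q, h, _, j, hj => by simp [PathFrom, Arrow.src, Arrow.tgt] at h
  | zHi k :: wHi l :: u, i, p, q, h, hu, j, hj => by
    have h1 := (irred_cons.1 hu).2.2
    have h2 := (irred_cons.1 (irred_cons.1 hu).1).2.1
    have hl : l ≤ i := by
      by_contra hlt
      simp [IsTip, rule] at h1 h2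
      by_cases hk : k = 2 ∧ l = 2
      · simp [hk] at h2
      · simp [not_le.1 hlt] at h1
        exact hk h1
    have := le_of_wHi u l _ q h.2.2 (irred_cons.1 (irred_cons.1 hu).1).1
    simp only [List.map_cons, List.mem_cons, coord, reduceCtorEq, false_or, Sum.inr.injEq] at hj
    rcases hj with rfl | hj
    · exact hl
    · exact (this j hj).trans hl

theorem le_of_wLo {u : List Arrow} {i p q : Fin 3} (h : PathFrom p q (wLo i :: u))
    (hu : Irred (wLo i :: u)) (j : Fin 3) (hj : Sum.inr j ∈ u.map coord) : j ≤ i := by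
  obtain ⟨-, h⟩ := h
  obtain ⟨hu, h2, -⟩ := irred_cons.1 hu
  rcases u with _ | ⟨y, u⟩
  · simp at hj
  · rcases y with k | k | k | k
    · have h0 := eq_nil_of_zLo h hu
      subst h0
      simp [coord] at hj
    · simp [PathFrom, Arrow.src, Arrow.tgt] at h
    · simp [PathFrom, Arrow.src, Arrow.tgt] at h
    · have hk : k ≤ i := by simpa [IsTip, rule] using h2
      simp only [List.map_cons, List.mem_cons, coord, Sum.inr.injEq] at hj
      rcases hj with rfl | hj
      · exact hk
      · exact (le_of_wHi u k _ _ h hu j hj).trans hk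

/-- An irreducible path does not contain both `z^3` and `w_3`. -/
theorem not_z_and_w {p q : Fin 3} {u : List Arrow} (h : PathFrom p q u) (hu : Irred u)
    (hz : Sum.inl 2 ∈ u.map coord) (hw : Sum.inr 2 ∈ u.map coord) : False := by
  rcases u with _ | ⟨x, u⟩
  · simp at hz
  obtain ⟨hu', t2, t3⟩ := irred_cons.1 hu
  have top : ∀ i : Fin 3, 2 ≤ i → i = 2 := by decide
  rcases x with i | i | i | i
  · have h0 := eq_nil_of_zLo h hu
    subst h0
    simp [coord] at hw
  -- The leading z carries the largest index, hence is z^3; the first w after it is w_3 for the same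
  -- reason, and z^3 w_3 is a tip. The other cases place the two largest letters next to each other
  -- in the same way.
  · have hi : i = 2 := by
      simp only [List.map_cons, List.mem_cons, coord, Sum.inl.injEq] at hz
      rcases hz with hz | hz
      · exact hz.symm
      · exact top i (le_of_zHi _ _ _ _ h hu 2 hz)
    subst hi
    rcases u with _ | ⟨y, u⟩
    · simp [coord] at hw
    rcases y with k | k | k | k
    · have h0 := eq_nil_of_zLo h.2 hu'
      subst h0
      simp [coord] at hw
    · simp [PathFrom, Arrow.src, Arrow.tgt] at h
    · simp [PathFrom, Arrow.src, Arrow.tgt] at h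
    · have hk : k = 2 := by
        simp only [List.map_cons, List.mem_cons, coord, Sum.inr.injEq, reduceCtorEq,
          false_or] at hw
        rcases hw with hw | hw
        · exact hw.symm
        · exact top k (le_of_wHi _ _ _ _ h.2 hu' 2 hw)
      subst hk
      simp [IsTip, rule] at t2
  · have hi : i = 2 := by
      simp only [List.map_cons, List.mem_cons, coord, Sum.inr.injEq] at hw
      rcases hw with hw | hw
      · exact hw.symm
      · exact top i (le_of_wLo h hu 2 hw)
    subst hi
    rcases u with _ | ⟨y, u⟩
    · simp [coord] at hz
    rcases y with k | k | k | k
    · have h0 := eq_nil_of_zLo h.2 hu'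
      subst h0
      have hk : k = 2 := by simpa [coord, eq_comm] using hz
      subst hk
      simp [IsTip, rule] at t2
    · simp [PathFrom, Arrow.src, Arrow.tgt] at h
    · simp [PathFrom, Arrow.src, Arrow.tgt] at h
    · rcases u with _ | ⟨x, u⟩
      · simp [coord] at hz
      obtain ⟨hu'', s2, -⟩ := irred_cons.1 hu'
      rcases x with l | l | l | l
      · simp [PathFrom, Arrow.src, Arrow.tgt] at h
      · have hl : l = 2 := by
          simp only [List.map_cons, List.mem_cons, coord, Sum.inl.injEq, reduceCtorEq,
            false_or] at hz
          rcases hz with hz | hz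
          · exact hz.symm
          · exact top l (le_of_zHi _ _ _ _ h.2.2 hu'' 2 hz)
        subst hl
        -- Here the word begins with w_3 w_k z^3: for k = 1, 2 this is a tip of length three, and
        -- for k = 3 its part w_3 z^3 is a tip.
        fin_cases k <;> simp [IsTip, rule] at t3 s2
      · simp [PathFrom, Arrow.src, Arrow.tgt] at h
      · simp [PathFrom, Arrow.src, Arrow.tgt] at h
  · have hi : i = 2 := by
      simp only [List.map_cons, List.mem_cons, coord, Sum.inr.injEq] at hw
      rcases hw with hw | hw
      · exact hw.symm
      · exact top i (le_of_wHi _ _ _ _ h hu 2 hw)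
    subst hi
    rcases u with _ | ⟨y, u⟩
    · simp [coord] at hz
    rcases y with k | k | k | k
    · simp [PathFrom, Arrow.src, Arrow.tgt] at h
    · have hk : k = 2 := by
        simp only [List.map_cons, List.mem_cons, coord, Sum.inl.injEq, reduceCtorEq,
          false_or] at hz
        rcases hz with hz | hz
        · exact hz.symm
        · exact top k (le_of_zHi _ _ _ _ h.2 hu' 2 hz)
      subst hk
      simp [IsTip, rule] at t2
    · simp [PathFrom, Arrow.src, Arrow.tgt] at h
    · simp [PathFrom, Arrow.src, Arrow.tgt] at h

/-- The first letter of an irreducible path is determined by its ends and its content. -/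
theorem head_eq {p q : Fin 3} {x y : Arrow} {u v : List Arrow} (hu : PathFrom p q (x :: u))
    (hv : PathFrom p q (y :: v)) (iu : Irred (x :: u)) (iv : Irred (y :: v))
    (h : ((x :: u).map coord).Perm ((y :: v).map coord)) : x = y := by
  have key : ∀ {c d : Fin 3 ⊕ Fin 3} {l m : List (Fin 3 ⊕ Fin 3)}, (c :: l).Perm (d :: m) →
      c = d ∨ c ∈ m := fun h => List.mem_cons.1 (h.subset (List.mem_cons_self))
  -- Two kinds of arrows end at node 1. A path beginning with z : 0 → 1 has length one; the other
  -- path then has length one too, and the sources 0 and 2 disagree.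
  have hzw : ∀ {i j : Fin 3} {u v : List Arrow}, PathFrom p q (zLo i :: u) →
      PathFrom p q (wHi j :: v) → Irred (zLo i :: u) →
      ((zLo i :: u).map coord).Perm ((wHi j :: v).map coord) → False := by
    intro i j u v hu hv iu h
    have h0 := eq_nil_of_zLo hu iu
    subst h0
    have hl := h.length_eq
    simp only [List.map_cons, List.map_nil, List.length_cons, List.length_nil, List.length_map,
      zero_add, Nat.right_eq_add, List.length_eq_zero_iff] at hl
    subst hl
    have h1 : (0 : Fin 3) = q := hu.2
    have h2 : (2 : Fin 3) = q := hv.2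
    rw [← h1] at h2
    simp at h2
  have ht : x.tgt = y.tgt := hu.1.trans hv.1.symm
  rcases x with i | i | i | i <;> rcases y with j | j | j | j <;>
    simp only [Arrow.tgt, Fin.isValue, Fin.reduceEq] at ht
  · have h0 := eq_nil_of_zLo hu iu
    have h1 := eq_nil_of_zLo hv iv
    subst h0 h1
    simp [coord] at h
    rw [h]
  · exact (hzw hu hv iu h).elim
  -- Both first letters are of the same kind. If they differ, each occurs further on in the other
  -- word, where the first letter has the largest index, so the indices agree.
  · rcases key h with h1 | h1
    · rw [Sum.inl.inj h1]
    rcases key h.symm with h2 | h2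
    · rw [Sum.inl.inj h2]
    rw [le_antisymm (le_of_zHi _ _ _ _ hv iv i h1) (le_of_zHi _ _ _ _ hu iu j h2)]
  · rcases key h with h1 | h1
    · rw [Sum.inr.inj h1]
    rcases key h.symm with h2 | h2
    · rw [Sum.inr.inj h2]
    rw [le_antisymm (le_of_wLo hv iv i h1) (le_of_wLo hu iu j h2)]
  · exact (hzw hv hu iv h.symm).elim
  · rcases key h with h1 | h1
    · rw [Sum.inr.inj h1]
    rcases key h.symm with h2 | h2
    · rw [Sum.inr.inj h2]
    rw [le_antisymm (le_of_wHi _ _ _ _ hv iv i h1) (le_of_wHi _ _ _ _ hu iu j h2)]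

/-- An irreducible path is determined by its ends and its content. -/
theorem eq_of_perm {p q : Fin 3} {u v : List Arrow} (hu : PathFrom p q u) (hv : PathFrom p q v)
    (iu : Irred u) (iv : Irred v) (h : (u.map coord).Perm (v.map coord)) : u = v := by
  induction u generalizing p v with
  | nil => exact (List.length_eq_zero_iff.1 (by simpa using h.length_eq.symm)).symm
  | cons x u ih =>
    cases v with
    | nil => simpa using h.length_eq
    | cons y v =>
      have hxy := head_eq hu hv iu iv h
      subst hxy
      rw [ih hu.2 hv.2 (irred_cons.1 iu).1 (irred_cons.1 iv).1 ((List.perm_cons _).1 h)]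

/-! ### Linear independence of the irreducible paths -/

/-- The order `x^1, x^2, ξ_1, ξ_2` of the coordinates of the chart. -/
abbrev chartLinearOrder : LinearOrder (Fin 2 ⊕ Fin 2) :=
  LinearOrder.lift' (finSumFinEquiv : Fin 2 ⊕ Fin 2 ≃ Fin 4) (Equiv.injective _)

theorem chart_wellFounded :
    @WellFoundedGT (Fin 2 ⊕ Fin 2) chartLinearOrder.toPartialOrder.toPreorder.toLT :=
  @Finite.to_wellFoundedGT _ _ chartLinearOrder.toPartialOrder.toPreorder

/-- The lexicographic order of the monomials in the chart. -/
def chartOrder : MonomialOrder (Fin 2 ⊕ Fin 2) :=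
  @MonomialOrder.lex _ chartLinearOrder chart_wellFounded

/-- Among the terms with nonzero coefficient, the one with the largest leading exponent cannot be
cancelled, since no other term has that exponent. -/
theorem eq_zero_of_sum_eq_zero_of_degree {σ R ι : Type*} [CommRing R] [IsDomain R]
    (m : MonomialOrder σ) (s : Finset ι) (f : ι → MvPolynomial σ R) (hf : ∀ i ∈ s, f i ≠ 0)
    (hinj : Set.InjOn (fun i => m.degree (f i)) s) (c : ι → R)
    (h : ∑ i ∈ s, c i • f i = 0) : ∀ i ∈ s, c i = 0 := by
  classical
  by_contra! hne
  obtain ⟨i₀, hi₀, hc₀⟩ := hne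
  obtain ⟨i, hi, hmax⟩ := (s.filter fun i => c i ≠ 0).exists_max_image
    (fun i => m.toSyn (m.degree (f i))) ⟨i₀, by simp [hi₀, hc₀]⟩
  rw [Finset.mem_filter] at hi
  have h1 := congrArg (MvPolynomial.coeff (m.degree (f i))) h
  rw [MvPolynomial.coeff_sum, Finset.sum_eq_single i] at h1
  · rw [MvPolynomial.coeff_smul, smul_eq_mul, MvPolynomial.coeff_zero, mul_eq_zero] at h1
    exact h1.elim hi.2 (m.coeff_degree_ne_zero_iff.2 (hf i hi.1))
  · intro j hj hji
    rw [MvPolynomial.coeff_smul]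
    by_cases hc : c j = 0
    · rw [hc, zero_smul]
    · rw [m.coeff_eq_zero_of_lt, smul_zero]
      refine lt_of_le_of_ne (hmax j (by simp [hj, hc])) fun heq => hji ?_
      exact hinj hj hi.1 (m.toSyn.injective heq)
  · exact fun hi' => absurd hi.1 hi'

/-- The coordinate of an arrow in the chart. -/
def chartVal : Fin 3 ⊕ Fin 3 → Chart := Sum.elim zChart wChart

/-- The leading exponent of a coordinate in the chart. -/
def lead : Fin 3 ⊕ Fin 3 → (Fin 2 ⊕ Fin 2 →₀ ℕ) :=
  Sum.elim ![Finsupp.single (Sum.inl 0) 1, Finsupp.single (Sum.inl 1) 1, 0]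
    ![Finsupp.single (Sum.inr 0) 1, Finsupp.single (Sum.inr 1) 1,
      Finsupp.single (Sum.inl 0) 1 + Finsupp.single (Sum.inr 0) 1]

/-- In the chart w_3 = -ξ_1 x^1 - ξ_2 x^2, and the lexicographic order puts x^1 first. -/
theorem degree_wChart_two : chartOrder.degree (wChart 2) =
    Finsupp.single (Sum.inl 0) 1 + Finsupp.single (Sum.inr 0) 1 := by
  have h0 : ∀ i : Fin 2, chartOrder.degree (ξ i * x i) =
      Finsupp.single (Sum.inl i) 1 + Finsupp.single (Sum.inr i) 1 := by
    intro i
    rw [x, ξ, MonomialOrder.degree_mul (MvPolynomial.X_ne_zero _) (MvPolynomial.X_ne_zero _),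
      MonomialOrder.degree_X, MonomialOrder.degree_X, add_comm]
  have hw : wChart 2 = -(ξ 0 * x 0) + -(ξ 1 * x 1) := by simp [wChart, sub_eq_add_neg]
  rw [hw, MonomialOrder.degree_add_of_lt, MonomialOrder.degree_neg, h0]
  rw [MonomialOrder.degree_neg, MonomialOrder.degree_neg, h0, h0]
  refine (@MonomialOrder.lex_lt_iff _ chartLinearOrder chart_wellFounded _ _).2 ?_
  refine (@Finsupp.Lex.lt_iff _ _ _ chartLinearOrder.toPartialOrder.toPreorder.toLT _ _ _).2 ?_
  refine ⟨Sum.inl 0, fun j hj => ?_, ?_⟩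
  · rcases j with j | j <;> fin_cases j <;> revert hj <;> decide
  · simp

theorem degree_chartVal (c : Fin 3 ⊕ Fin 3) : chartOrder.degree (chartVal c) = lead c := by
  rcases c with i | i <;> fin_cases i
  · simp [chartVal, lead, zChart, x, MonomialOrder.degree_X]
  · simp [chartVal, lead, zChart, x, MonomialOrder.degree_X]
  · simp [chartVal, lead, zChart]
  · simp [chartVal, lead, wChart, ξ, MonomialOrder.degree_X]
  · simp [chartVal, lead, wChart, ξ, MonomialOrder.degree_X]
  · exact degree_wChart_two

theorem chartVal_ne_zero (c : Fin 3 ⊕ Fin 3) : chartVal c ≠ 0 := by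
  rcases c with i | i <;> fin_cases i
  · exact MvPolynomial.X_ne_zero _
  · exact MvPolynomial.X_ne_zero _
  · exact one_ne_zero
  · exact MvPolynomial.X_ne_zero _
  · exact MvPolynomial.X_ne_zero _
  · intro h
    have h1 := degree_wChart_two
    rw [show wChart 2 = 0 from h, MonomialOrder.degree_zero] at h1
    have h2 := DFunLike.congr_fun h1 (Sum.inl 0)
    simp at h2

/-- The function of a word in the chart. -/
def chartWord (u : List Arrow) : Chart := (u.map fun y => chartVal y.coord).prod

theorem chartWord_ne_zero (u : List Arrow) : chartWord u ≠ 0 := by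
  refine List.prod_ne_zero fun h => ?_
  obtain ⟨y, -, hy⟩ := List.mem_map.1 h
  exact chartVal_ne_zero _ hy

theorem degree_chartWord (u : List Arrow) :
    chartOrder.degree (chartWord u) = (u.map fun y => lead y.coord).sum := by
  induction u with
  | nil => simp [chartWord]
  | cons y u ih =>
    have : chartWord (y :: u) = chartVal y.coord * chartWord u := by simp [chartWord]
    rw [this, MonomialOrder.degree_mul (chartVal_ne_zero _) (chartWord_ne_zero _),
      degree_chartVal, ih, List.map_cons, List.sum_cons]

/-- The multiplicity of a coordinate in a word. -/
def cnt (c : Fin 3 ⊕ Fin 3) (u : List Arrow) : ℕ :=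
  Multiset.count c (u.map coord : Multiset (Fin 3 ⊕ Fin 3))

theorem cnt_nil (c : Fin 3 ⊕ Fin 3) : cnt c [] = 0 := by simp [cnt]

theorem cnt_cons (c : Fin 3 ⊕ Fin 3) (y : Arrow) (u : List Arrow) :
    cnt c (y :: u) = cnt c u + if c = y.coord then 1 else 0 := by
  rw [cnt, List.map_cons, ← Multiset.cons_coe, Multiset.count_cons]
  rfl

theorem mem_of_cnt_ne_zero {c : Fin 3 ⊕ Fin 3} {u : List Arrow} (h : cnt c u ≠ 0) :
    c ∈ u.map coord :=
  Multiset.mem_coe.1 (Multiset.count_ne_zero.1 h)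

theorem degree_chartWord_count (u : List Arrow) :
    chartOrder.degree (chartWord u) (Sum.inl 0) =
        cnt (Sum.inl 0) u + cnt (Sum.inr 2) u ∧
      chartOrder.degree (chartWord u) (Sum.inl 1) = cnt (Sum.inl 1) u ∧
      chartOrder.degree (chartWord u) (Sum.inr 0) =
        cnt (Sum.inr 0) u + cnt (Sum.inr 2) u ∧
      chartOrder.degree (chartWord u) (Sum.inr 1) = cnt (Sum.inr 1) u := by
  rw [degree_chartWord]
  induction u with
  | nil => simp [cnt_nil]
  | cons y u ih =>
    simp only [List.map_cons, List.sum_cons, Finsupp.add_apply, cnt_cons, ih]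
    generalize y.coord = c
    rcases c with i | i <;> fin_cases i <;> simp [lead] <;> omega

theorem count_weight {p q : Fin 3} {u : List Arrow} (h : PathFrom p q u) :
    (cnt (Sum.inl 0) u : ℤ) + cnt (Sum.inl 1) u
      + cnt (Sum.inl 2) u + (q : ℕ) = cnt (Sum.inr 0) u
      + cnt (Sum.inr 1) u + cnt (Sum.inr 2) u + (p : ℕ) := by
  induction u generalizing p with
  | nil =>
    have : p = q := h
    simp [this, cnt_nil]
  | cons y u ih =>
    obtain ⟨rfl, h⟩ := h
    have := ih h
    simp only [cnt_cons]
    rcases y with i | i | i | i <;> fin_cases i <;>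
      simp [coord, Arrow.src, Arrow.tgt] at this ⊢ <;> omega

/-- The leading exponent gives four equations for the six multiplicities: n(z^1) + n(w_3), n(z^2),
n(w_1) + n(w_3) and n(w_2) are known. The weight, fixed by the ends, then gives n(z^3) - n(w_3). As
one of these two numbers is zero, all six are determined, and sortedness recovers the path. -/
theorem irrPath_ext_of_degree {t t' : IrrPath} (hp : t.1.1 = t'.1.1) (hq : t.1.2.1 = t'.1.2.1)
    (h : chartOrder.degree (chartWord t.1.2.2) = chartOrder.degree (chartWord t'.1.2.2)) :
    t = t' := by
  obtain ⟨⟨p, q, u⟩, hu, iu⟩ := t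
  obtain ⟨⟨p', q', v⟩, hv, iv⟩ := t'
  dsimp only at hp hq h hu hv iu iv
  subst hp hq
  have : u = v := by
    refine eq_of_perm hu hv iu iv (Multiset.coe_eq_coe.1 (Multiset.ext.2 ?_))
    obtain ⟨a1, a2, a3, a4⟩ := degree_chartWord_count u
    obtain ⟨b1, b2, b3, b4⟩ := degree_chartWord_count v
    rw [h] at a1 a2 a3 a4
    have wu := count_weight hu
    have wv := count_weight hv
    have zu : cnt (Sum.inl 2) u = 0 ∨ cnt (Sum.inr 2) u = 0 := by
      by_contra! hne
      exact not_z_and_w hu iu (mem_of_cnt_ne_zero hne.1) (mem_of_cnt_ne_zero hne.2)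
    have zv : cnt (Sum.inl 2) v = 0 ∨ cnt (Sum.inr 2) v = 0 := by
      by_contra! hne
      exact not_z_and_w hv iv (mem_of_cnt_ne_zero hne.1) (mem_of_cnt_ne_zero hne.2)
    change ∀ c, cnt c u = cnt c v
    rintro (i | i) <;> fin_cases i <;> simp only [Fin.zero_eta, Fin.mk_one, Fin.reduceFinMk] <;>
      omega
  subst this
  rfl

theorem toChart_e (a : Fin 3) : toChart (e a) = Matrix.single a a 1 := by
  simp [toChart, e, freeE]

theorem toChart_arr (y : Arrow) : toChart (arr y) = arrowMatrix zChart wChart y := by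
  simp [toChart, arr, freeA]

theorem arrowMatrix_eq {R : Type*} [CommRing R] (z w : Fin 3 → R) (y : Arrow) :
    arrowMatrix z w y = Matrix.single y.tgt y.src (Sum.elim z w y.coord) := by
  cases y <;> rfl

theorem toChart_path {p q : Fin 3} {u : List Arrow} (hu : PathFrom p q u) :
    toChart (e p * cls u) = Matrix.single p q (chartWord u) := by
  induction u generalizing p with
  | nil =>
    have : p = q := hu
    subst this
    simp [cls, toChart_e, chartWord]
  | cons y u ih =>
    obtain ⟨rfl, hu⟩ := hu
    rw [cls_cons, ← mul_assoc, e_tgt_mul_arr, ← arr_mul_e_src, mul_assoc, map_mul, ih hu,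
      toChart_arr, arrowMatrix_eq, Matrix.single_mul_single_same]
    simp [chartWord, chartVal]

theorem toChart_irr (t : IrrPath) :
    toChart (irr t) = Matrix.single t.1.1 t.1.2.1 (chartWord t.1.2.2) :=
  toChart_path t.2.1

/-- The position of the matrix entry separates paths with different ends; within one entry the
leading exponents are distinct. -/
theorem linearIndependent_toChart_irr :
    LinearIndependent ℂ fun t : IrrPath => toChart (irr t) := by
  classical
  rw [linearIndependent_iff']
  intro s c h t ht
  set s' := s.filter fun t' => t'.1.1 = t.1.1 ∧ t'.1.2.1 = t.1.2.1
  refine eq_zero_of_sum_eq_zero_of_degree chartOrder s' (fun t => chartWord t.1.2.2)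
    (fun _ _ => chartWord_ne_zero _) ?_ c ?_ t (by simp [s', ht])
  · intro a ha b hb hab
    simp only [s', Finset.coe_filter, Set.mem_ofPred_eq] at ha hb
    exact irrPath_ext_of_degree (ha.2.1.trans hb.2.1.symm) (ha.2.2.trans hb.2.2.symm) hab
  · have h1 := congrFun (congrFun h t.1.1) t.1.2.1
    rw [Matrix.sum_apply, Matrix.zero_apply] at h1
    rw [← h1, Finset.sum_filter]
    refine Finset.sum_congr rfl fun t' _ => ?_
    rw [Matrix.smul_apply, toChart_irr, Matrix.single_apply]
    split_ifs <;> simp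

theorem linearIndependent_irr : LinearIndependent ℂ irr :=
  LinearIndependent.of_comp toChart.toLinearMap linearIndependent_toChart_irr

/-- The irreducible paths form a basis of `Λ`. -/
def irrBasis : Module.Basis IrrPath ℂ Lam :=
  Module.Basis.mk linearIndependent_irr span_irr.ge

theorem irrBasis_apply (t : IrrPath) : irrBasis t = irr t := Module.Basis.mk_apply _ _ _

theorem toChart_injective : Function.Injective toChart := by
  refine LinearMap.injective_of_linearIndependent (f := toChart.toLinearMap) (v := irr) span_irr ?_
  exact linearIndependent_toChart_irr

/-! ### The bar cochain of a cochain -/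

/-- The value of the bar cochain on a pair of irreducible paths. -/
def barValue (γ : T₂ → Lam) (t t' : IrrPath) : Lam :=
  if t.1.2.2 = [] ∨ t'.1.2.2 = [] then 0
  else if t.1.2.1 = t'.1.1 then evalCochain γ (tipsUsed (t.1.2.2 ++ t'.1.2.2)) else 0

/-- The bar cochain of a cochain. -/
def barCochain (γ : T₂ → Lam) : Lam →ₗ[ℂ] Lam →ₗ[ℂ] Lam :=
  irrBasis.constr ℂ fun t => irrBasis.constr ℂ fun t' => barValue γ t t'

theorem barCochain_irr (γ : T₂ → Lam) (t t' : IrrPath) :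
    barCochain γ (irr t) (irr t') = barValue γ t t' := by
  rw [barCochain, ← irrBasis_apply, ← irrBasis_apply, Module.Basis.constr_basis,
    Module.Basis.constr_basis]

theorem irr_of_ne_nil {t : IrrPath} (h : t.1.2.2 ≠ []) : irr t = cls t.1.2.2 :=
  e_mul_cls t.2.1 h

theorem irr_of_eq_nil {t : IrrPath} (h : t.1.2.2 = []) : irr t = e t.1.1 := by
  rw [irr, h]
  simp [cls]

theorem isBarCochain_barCochain (γ : T₂ → Lam) : IsBarCochain γ (barCochain γ) where
  left_e a v := by
    have : barCochain γ (e a) = 0 := by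
      refine irrBasis.ext fun t => ?_
      rw [irrBasis_apply, ← irr_trivialPath, barCochain_irr, barValue,
        if_pos (Or.inl (show (trivialPath a).1.2.2 = [] from rfl)), LinearMap.zero_apply]
    rw [this, LinearMap.zero_apply]
  right_e a u := by
    have : (barCochain γ).flip (e a) = 0 := by
      refine irrBasis.ext fun t => ?_
      rw [irrBasis_apply, LinearMap.flip_apply, ← irr_trivialPath, barCochain_irr, barValue,
        if_pos (Or.inr (show (trivialPath a).1.2.2 = [] from rfl)), LinearMap.zero_apply]
    rw [← LinearMap.flip_apply, this, LinearMap.zero_apply]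
  composable u v hu hv iu iv huv := by
    obtain ⟨hu0, p, q, hu⟩ := isPath_iff.1 hu
    obtain ⟨hv0, r, s, hv⟩ := isPath_iff.1 hv
    have h := (hu.isPath_append_iff hv hu0 hv0).1 huv
    have := barCochain_irr γ ⟨(p, q, u), hu, iu⟩ ⟨(r, s, v), hv, iv⟩
    rw [irr_of_ne_nil hu0, irr_of_ne_nil hv0, barValue, if_neg (by simp [hu0, hv0]),
      if_pos h] at this
    exact this
  not_composable u v hu hv huv := by
    obtain ⟨hu0, p, q, hu⟩ := isPath_iff.1 hu
    obtain ⟨hv0, r, s, hv⟩ := isPath_iff.1 hv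
    have h : q ≠ r := fun h => huv ((hu.isPath_append_iff hv hu0 hv0).2 h)
    -- The condition concerns arbitrary paths, not only irreducible ones. Both arguments are
    -- reduced, which keeps their ends and hence their failure to compose.
    refine cls_mem_of_irr hu hu0 (LinearMap.ker ((barCochain γ).flip (cls v))) fun t h1 h2 h3 => ?_
    refine cls_mem_of_irr hv hv0 (LinearMap.ker (barCochain γ (irr t))) fun t' h1' h2' h3' => ?_
    rw [LinearMap.mem_ker, barCochain_irr, barValue, if_neg (by simp [h3, h3']), if_neg]
    rw [h2, h1']
    exact h

theorem isBarCochain_iff (γ : T₂ → Lam) (m : Lam →ₗ[ℂ] Lam →ₗ[ℂ] Lam) :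
    IsBarCochain γ m ↔ m = barCochain γ := by
  constructor
  · intro h
    refine irrBasis.ext fun t => irrBasis.ext fun t' => ?_
    rw [irrBasis_apply, irrBasis_apply, barCochain_irr, barValue]
    by_cases h1 : t.1.2.2 = []
    · rw [if_pos (Or.inl h1), irr_of_eq_nil h1, h.left_e]
    by_cases h2 : t'.1.2.2 = []
    · rw [if_pos (Or.inr h2), irr_of_eq_nil h2, h.right_e]
    rw [if_neg (by simp [h1, h2]), irr_of_ne_nil h1, irr_of_ne_nil h2]
    have hp := t.2.1.isPath_append_iff t'.2.1 h1 h2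
    split_ifs with h3
    · exact h.composable _ _ (t.2.1.isPath h1) (t'.2.1.isPath h2) t.2.2 t'.2.2 (hp.2 h3)
    · exact h.not_composable _ _ (t.2.1.isPath h1) (t'.2.1.isPath h2) (fun h4 => h3 (hp.1 h4))
  · rintro rfl
    exact isBarCochain_barCochain γ

/-! ### The linear section of a lift and its multiplicative defect -/

namespace Lift

section Semiring

variable {γ : T₂ → Lam} {B : Type*} [Semiring B] [Algebra ℂ B] (T : Lift γ B)

/-- The linear section given by the irreducible paths. -/
def sec : Lam →ₗ[ℂ] B := irrBasis.constr ℂ T.el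

theorem sec_irr (t : IrrPath) : T.sec (irr t) = T.el t := by
  rw [sec, ← irrBasis_apply, Module.Basis.constr_basis]

theorem sec_e (a : Fin 3) : T.sec (e a) = T.E a := by
  rw [← irr_trivialPath, sec_irr]
  simp [el, trivialPath, word_nil]

theorem word_eq_sec {p q : Fin 3} {u : List Arrow} (h : PathFrom p q u) (hu : u ≠ []) :
    T.word u = T.sec (cls u) + T.Δ (evalCochain γ (tipsUsed u)) := by
  rw [T.word_eq u]
  congr 1
  rw [cls_eq_linearCombination u]
  refine normalForm_mem u (LinearMap.eqLocus (Finsupp.linearCombination ℂ T.word)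
    (T.sec ∘ₗ Finsupp.linearCombination ℂ cls)) h hu fun v hv hv0 iv => ?_
  have := T.sec_irr ⟨(p, q, v), hv, iv⟩
  rw [irr_of_ne_nil hv0, el, T.E_mul_word_self hv hv0] at this
  simpa using this.symm

theorem irred_singleton (y : Arrow) : Irred [y] := by
  refine irred_cons.2 ⟨irred_nil, ?_, ?_⟩ <;> cases y <;> simp [IsTip, rule]

theorem sec_arr (y : Arrow) : T.sec (arr y) = T.X y := by
  have := T.word_eq_sec (p := y.tgt) (q := y.src) (u := [y]) ⟨rfl, rfl⟩ (by simp)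
  rw [tipsUsed_of_irred (irred_singleton y)] at this
  simpa [word, cls] using this.symm

/-- On irreducible paths the product in the lift is the concatenated word. Its right reduction
returns the section of the product in Λ together with the tips collected by G₂, so the defect is the
bar cochain. Trivial paths give no defect, as the concatenation is then already irreducible. -/
theorem sec_mul (u v : Lam) : T.sec u * T.sec v = T.sec (u * v) + T.Δ (barCochain γ u v) := by
  suffices h : (LinearMap.mul ℂ B).compl₁₂ T.sec T.sec =
      (LinearMap.mul ℂ Lam).compr₂ T.sec + (barCochain γ).compr₂ T.Δ by
    simpa using LinearMap.congr_fun (LinearMap.congr_fun h u) v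
  refine irrBasis.ext fun t => irrBasis.ext fun t' => ?_
  simp only [irrBasis_apply, LinearMap.compl₁₂_apply, LinearMap.mul_apply', LinearMap.add_apply,
    LinearMap.compr₂_apply, sec_irr, barCochain_irr]
  have h1 : T.el t * T.el t' = _ := T.path_mul_path t.2.1 t'.2.1
  have h2 : irr t * irr t' = _ := (trivialLift γ).path_mul_path t.2.1 t'.2.1
  change irr t * irr t' = if t.1.2.1 = t'.1.1 then e t.1.1 * cls (t.1.2.2 ++ t'.1.2.2) else 0 at h2
  rw [h1, h2, barValue]
  by_cases hq : t.1.2.1 = t'.1.1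
  · rw [if_pos hq, if_pos hq, if_pos hq]
    by_cases hu : t.1.2.2 = []
    · have hp : t.1.1 = t'.1.1 := by
        have := t.2.1
        rw [hu] at this
        exact Eq.trans this hq
      rw [if_pos (Or.inl hu), map_zero, add_zero, hu, List.nil_append, hp]
      exact (T.sec_irr t').symm
    by_cases hv : t'.1.2.2 = []
    · rw [if_pos (Or.inr hv), map_zero, add_zero, hv, List.append_nil]
      exact (T.sec_irr t).symm
    rw [if_neg (by simp [hu, hv])]
    have hp : PathFrom t.1.1 t'.1.2.1 (t.1.2.2 ++ t'.1.2.2) :=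
      pathFrom_append.2 ⟨_, t.2.1, hq ▸ t'.2.1⟩
    rw [T.E_mul_word_self hp (by simp [hu]), e_mul_cls hp (by simp [hu]),
      T.word_eq_sec hp (by simp [hu])]
  · rw [if_neg hq, if_neg hq, if_neg hq, ite_self, map_zero, map_zero, add_zero]

theorem sec_mul_Δ (u v : Lam) : T.sec u * T.Δ v = T.Δ (u * v) := by
  suffices h : (LinearMap.mul ℂ B).compl₁₂ T.sec T.Δ = (LinearMap.mul ℂ Lam).compr₂ T.Δ by
    simpa using LinearMap.congr_fun (LinearMap.congr_fun h u) v
  refine irrBasis.ext fun t => LinearMap.ext fun v => ?_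
  simp only [irrBasis_apply, LinearMap.compl₁₂_apply, LinearMap.mul_apply', LinearMap.compr₂_apply,
    sec_irr, el]
  rw [mul_assoc, T.word_mul_Δ, T.E_mul, irr, mul_assoc]

theorem Δ_mul_sec (u v : Lam) : T.Δ v * T.sec u = T.Δ (v * u) := by
  suffices h : ((LinearMap.mul ℂ B).flip).compl₁₂ T.sec T.Δ =
      ((LinearMap.mul ℂ Lam).flip).compr₂ T.Δ by
    simpa using LinearMap.congr_fun (LinearMap.congr_fun h u) v
  refine irrBasis.ext fun t => LinearMap.ext fun v => ?_
  simp only [irrBasis_apply, LinearMap.compl₁₂_apply, LinearMap.mul_apply', LinearMap.compr₂_apply,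
    LinearMap.flip_apply, sec_irr, el]
  rw [← mul_assoc, T.mul_E, T.Δ_mul_word, irr, mul_assoc]

end Semiring

variable {γ : T₂ → Lam} {B : Type*} [Ring B] [Algebra ℂ B] (T : Lift γ B)

/-- The bar cochain is a cocycle if there is a lift with a faithful infinitesimal part. -/
theorem isCocycle (hΔ : Function.Injective T.Δ) : IsCocycle (barCochain γ) := by
  intro u v w
  -- Both bracketings expand to the section of u v w plus a value of Δ; the cocycle identity is the
  -- equality of the two infinitesimal parts.
  have h := mul_assoc (T.sec u) (T.sec v) (T.sec w)
  rw [T.sec_mul u v, T.sec_mul v w, add_mul, mul_add, T.sec_mul, T.sec_mul, T.sec_mul_Δ,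
    T.Δ_mul_sec, mul_assoc, add_assoc, add_assoc, add_left_cancel_iff, ← map_add, ← map_add] at h
  have h' := hΔ h
  rw [sub_add_eq_add_sub, sub_sub, sub_eq_zero, h', add_comm]

end Lift

/-! ### The values of the cochain -/

/-- The sign of the transposition `i ↦ j` in the cyclic order. -/
def cyc (i j : Fin 3) : ℤ := if j = i + 1 then 1 else if i = j + 1 then -1 else 0

/-- In ε^{ijr} D_{rkl} the index r is the third one, so {k, l} = {i, j} and z^i z^j occurs twice.
The same count of indices gives the values on the other commutators. -/
theorem g_zz (a b c t : ℂ) (i j : Fin 3) :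
    g a b c t (.zz i j) = (2 * a * cyc i j) • cls [zHi i, zLo j] := by
  have h1 : cls [zHi 1, zLo 0] = cls [zHi 0, zLo 1] := by simp [cls, arr_zz 1 0]
  have h2 : cls [zHi 2, zLo 0] = cls [zHi 0, zLo 2] := by simp [cls, arr_zz 2 0]
  have h3 : cls [zHi 2, zLo 1] = cls [zHi 1, zLo 2] := by simp [cls, arr_zz 2 1]
  fin_cases i <;> fin_cases j <;>
    simp [g, g10, g10dual, gInv0, gInv1, Fin.sum_univ_three, eps, D, cyc, h1, h2, h3] <;> module

theorem g_ww (a b c t : ℂ) (i j : Fin 3) :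
    g a b c t (.ww i j) = (-2 * b * cyc i j) • cls [wLo i, wHi j] := by
  have h1 : cls [wLo 1, wHi 0] = cls [wLo 0, wHi 1] := by simp [cls, arr_ww 1 0]
  have h2 : cls [wLo 2, wHi 0] = cls [wLo 0, wHi 2] := by simp [cls, arr_ww 2 0]
  have h3 : cls [wLo 2, wHi 1] = cls [wLo 1, wHi 2] := by simp [cls, arr_ww 2 1]
  fin_cases i <;> fin_cases j <;>
    simp [g, g10, g10dual, gInv0, gInv1, Fin.sum_univ_three, eps, D, cyc, h1, h2, h3] <;> module

theorem g_comm_ne (a b c t : ℂ) (i j : Fin 3) (h : i ≠ j) : g a b c t (.comm i j) =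
    ((a - b) * if i = j + 1 then 1 else -1) • cls [wHi i, zHi j] := by
  fin_cases i <;> fin_cases j <;>
    simp [g, g10, g10dual, gInv0, gInv1, Fin.sum_univ_three, eps, D] at h ⊢ <;> module

theorem g_comm_self (a b c t : ℂ) (i : Fin 3) : g a b c t (.comm i i) =
    (a + b) • cls [wHi (i + 1), zHi (i + 1)] + (-(a + b)) • cls [wHi (i + 2), zHi (i + 2)] := by
  fin_cases i <;>
    simp [g, g10, g10dual, gInv0, gInv1, Fin.sum_univ_three, eps, D] <;> module

theorem toChart_cls {p q : Fin 3} {u : List Arrow} (hu : PathFrom p q u) (h : u ≠ []) :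
    toChart (cls u) = Matrix.single p q (chartWord u) := by
  rw [← e_mul_cls hu h, toChart_path hu]

theorem C_two : (MvPolynomial.C (2 : ℂ) : Chart) = 2 := map_ofNat MvPolynomial.C 2

theorem C_three : (MvPolynomial.C (3 : ℂ) : Chart) = 3 := map_ofNat MvPolynomial.C 3

theorem smul_single_chart (r : ℂ) (p q : Fin 3) (f : Chart) :
    r • Matrix.single p q f = Matrix.single p q (MvPolynomial.C r * f) := by
  rw [Matrix.smul_single, MvPolynomial.smul_eq_C_mul]

/-- The value of the cochain `g a b (3 k) t` on `w_i z^j - z^j w_i`. -/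
def commVal (a b k : ℂ) (i j : Fin 3) : Chart :=
  if i = j then (MvPolynomial.C a + MvPolynomial.C b) * (wChart (i + 1) * zChart (i + 1)
    - wChart (i + 2) * zChart (i + 2)) - 2 * MvPolynomial.C k
  else (MvPolynomial.C a - MvPolynomial.C b) * ((if i = j + 1 then 1 else -1)
    * (wChart i * zChart j))

/-- The value of the cochain `g a b c t` on `z^i z^j - z^j z^i`. -/
def zzVal (a : ℂ) (i j : Fin 3) : Chart :=
  2 * MvPolynomial.C a * (cyc i j : Chart) * (zChart i * zChart j)

/-- The value of the cochain `g a b c t` on `w_i w_j - w_j w_i`. -/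
def wwVal (b : ℂ) (i j : Fin 3) : Chart :=
  -2 * MvPolynomial.C b * (cyc i j : Chart) * (wChart i * wChart j)

theorem toChart_g_zz (a b c t : ℂ) (i j : Fin 3) :
    toChart (g a b c t (.zz i j)) = Matrix.single 2 0 (zzVal a i j) := by
  have h : toChart (cls [zHi i, zLo j]) = Matrix.single 2 0 (zChart i * zChart j) := by
    rw [toChart_cls (p := 2) (q := 0) (u := [zHi i, zLo j]) ⟨rfl, rfl, rfl⟩ (by simp)]
    simp [chartWord, chartVal, coord]
  rw [g_zz, map_smul, h, smul_single_chart, zzVal]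
  simp [C_two]

theorem toChart_g_ww (a b c t : ℂ) (i j : Fin 3) :
    toChart (g a b c t (.ww i j)) = Matrix.single 0 2 (wwVal b i j) := by
  have h : toChart (cls [wLo i, wHi j]) = Matrix.single 0 2 (wChart i * wChart j) := by
    rw [toChart_cls (p := 0) (q := 2) (u := [wLo i, wHi j]) ⟨rfl, rfl, rfl⟩ (by simp)]
    simp [chartWord, chartVal, coord]
  rw [g_ww, map_smul, h, smul_single_chart, wwVal]
  simp [C_two]

theorem toChart_onComm (a b k t : ℂ) (i j : Fin 3) :
    toChart (onComm (g a b (3 * k) t) i j) = Matrix.single 1 1 (commVal a b k i j) := by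
  have h : ∀ i j, toChart (cls [wHi i, zHi j]) = Matrix.single 1 1 (wChart i * zChart j) := by
    intro i j
    rw [toChart_cls (p := 1) (q := 1) (u := [wHi i, zHi j]) ⟨rfl, rfl, rfl⟩ (by simp)]
    simp [chartWord, chartVal, coord]
  rw [onComm, commVal]
  by_cases hij : i = j
  · subst hij
    -- The trace part is one third of -c - c with c = 3k. The parameter t enters both relations
    -- equally and cancels.
    have h1 : (1 / 3 : ℂ) • (g a b (3 * k) t .wz1 - g a b (3 * k) t .zw1) = (-2 * k) • e 1 := by
      simp only [g, g10, g10dual, gInv0, gInv1]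
      module
    rw [if_pos rfl, if_pos rfl, g_comm_self, h1, map_add, map_add, map_smul, map_smul,
      map_smul, h, h, toChart_e, smul_single_chart, smul_single_chart, smul_single_chart,
      ← Matrix.single_add, ← Matrix.single_add]
    congr 1
    simp [C_two]
    ring
  · rw [if_neg hij, if_neg hij, add_zero, g_comm_ne _ _ _ _ _ _ hij, map_smul, h,
      smul_single_chart]
    congr 1
    split_ifs <;> simp <;> ring

theorem toChart_g_moment (a b k t : ℂ) :
    toChart (g a b (3 * k) t .wz1) =
      Matrix.single 1 1 (-3 * MvPolynomial.C k + MvPolynomial.C t) ∧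
    toChart (g a b (3 * k) t .zw2) = Matrix.single 2 2 (MvPolynomial.C k + MvPolynomial.C t) ∧
    toChart (g a b (3 * k) t .wz0) = Matrix.single 0 0 (-MvPolynomial.C k + MvPolynomial.C t) := by
  have h1 : g a b (3 * k) t .wz1 = (-3 * k + t) • e 1 := by
    simp only [g, g10, g10dual, gInv0, gInv1]
    module
  have h2 : g a b (3 * k) t .zw2 = (k + t) • e 2 := by
    simp only [g, g10, g10dual, gInv0, gInv1]
    module
  have h3 : g a b (3 * k) t .wz0 = (-k + t) • e 0 := by
    simp only [g, g10, g10dual, gInv0, gInv1]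
    module
  rw [h1, h2, h3, map_smul, map_smul, map_smul, toChart_e, toChart_e, toChart_e,
    smul_single_chart, smul_single_chart, smul_single_chart]
  simp [C_three]

/-! ### The deformed product in the chart -/

open MvPolynomial in
theorem pderiv_x (p : Fin 2 ⊕ Fin 2) (i : Fin 2) :
    pderiv p (x i) = if p = Sum.inl i then 1 else 0 := by
  rw [x, pderiv_X, Pi.single_apply]
  simp only [eq_comm]

open MvPolynomial in
theorem pderiv_ξ (p : Fin 2 ⊕ Fin 2) (i : Fin 2) :
    pderiv p (ξ i) = if p = Sum.inr i then 1 else 0 := by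
  rw [ξ, pderiv_X, Pi.single_apply]
  simp only [eq_comm]

open MvPolynomial Sum in
/-- The bidifferential operator of the deformation `g a b (3 k) t`. -/
def bidiff (a b k : ℂ) (f h : Chart) : Chart :=
  ((2 * C a + 2 * C b) * (ξ 0 * x 0 + ξ 1 * x 1) - 2 * C k) * (pderiv (inr 0) f * pderiv (inl 0) h)
  + (-(2 * C a + 2 * C b) * (ξ 0 * x 0 + ξ 1 * x 1) - 2 * C k)
      * (pderiv (inr 1) f * pderiv (inl 1) h)
  + (-4 * C a + 2 * C b) * (ξ 0 * x 1) * (pderiv (inr 0) f * pderiv (inl 1) h)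
  + (4 * C a - 2 * C b) * (ξ 1 * x 0) * (pderiv (inr 1) f * pderiv (inl 0) h)
  + (2 * C a - 4 * C b) * (ξ 0 * ξ 1) * (pderiv (inr 0) f * pderiv (inr 1) h)
  + 6 * C a * (x 0 * x 1) * (pderiv (inl 0) f * pderiv (inl 1) h)

/-- Pairs `f₀ + ε f₁` of functions on the chart, with the deformed product. -/
def Twisted (a b k : ℂ) := Chart × Chart

namespace Twisted

variable {a b k : ℂ}

instance : AddCommGroup (Twisted a b k) := inferInstanceAs (AddCommGroup (Chart × Chart))

instance : Module ℂ (Twisted a b k) := inferInstanceAs (Module ℂ (Chart × Chart))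

theorem ext' {u v : Twisted a b k} (h1 : u.1 = v.1) (h2 : u.2 = v.2) : u = v := Prod.ext h1 h2

theorem add_fst (u v : Twisted a b k) : (u + v).1 = u.1 + v.1 := rfl

theorem add_snd (u v : Twisted a b k) : (u + v).2 = u.2 + v.2 := rfl

theorem smul_fst (r : ℂ) (u : Twisted a b k) : (r • u).1 = r • u.1 := rfl

theorem smul_snd (r : ℂ) (u : Twisted a b k) : (r • u).2 = r • u.2 := rfl

theorem zero_fst : (0 : Twisted a b k).1 = 0 := rfl

theorem zero_snd : (0 : Twisted a b k).2 = 0 := rfl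

instance : Mul (Twisted a b k) :=
  ⟨fun u v => (u.1 * v.1, u.1 * v.2 + u.2 * v.1 + bidiff a b k u.1 v.1)⟩

instance : One (Twisted a b k) := ⟨(1, 0)⟩

theorem mul_fst (u v : Twisted a b k) : (u * v).1 = u.1 * v.1 := rfl

theorem mul_snd (u v : Twisted a b k) :
    (u * v).2 = u.1 * v.2 + u.2 * v.1 + bidiff a b k u.1 v.1 := rfl

theorem one_fst : (1 : Twisted a b k).1 = 1 := rfl

theorem one_snd : (1 : Twisted a b k).2 = 0 := rfl

instance : Ring (Twisted a b k) :=
  { (inferInstance : AddCommGroup (Twisted a b k)),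
    (inferInstance : Mul (Twisted a b k)), (inferInstance : One (Twisted a b k)) with
    left_distrib := fun u v w => ext'
      (by simp only [mul_fst, add_fst]; ring)
      (by simp only [mul_snd, add_fst, add_snd, bidiff, map_add]; ring)
    right_distrib := fun u v w => ext'
      (by simp only [mul_fst, add_fst]; ring)
      (by simp only [mul_snd, add_fst, add_snd, bidiff, map_add]; ring)
    zero_mul := fun u => ext'
      (by simp only [mul_fst, zero_fst, zero_mul])
      (by simp only [mul_snd, zero_fst, zero_snd, bidiff, map_zero]; ring)
    mul_zero := fun u => ext'
      (by simp only [mul_fst, zero_fst, mul_zero])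
      (by simp only [mul_snd, zero_fst, zero_snd, bidiff, map_zero]; ring)
    one_mul := fun u => ext'
      (by simp only [mul_fst, one_fst, one_mul])
      (by simp only [mul_snd, one_fst, one_snd, bidiff, Derivation.map_one_eq_zero]; ring)
    mul_one := fun u => ext'
      (by simp only [mul_fst, one_fst, mul_one])
      (by simp only [mul_snd, one_fst, one_snd, bidiff, Derivation.map_one_eq_zero]; ring)
    -- By the Leibniz rule in each argument, a biderivation of a commutative algebra satisfies the
    -- Hochschild cocycle identity whatever its coefficients; no condition on a, b, k arises.
    mul_assoc := fun u v w => ext'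
      (by simp only [mul_fst, mul_assoc])
      (by simp only [mul_snd, mul_fst, bidiff, MvPolynomial.pderiv_mul]; ring) }

instance : Algebra ℂ (Twisted a b k) := Algebra.ofModule
  (fun r u v => ext'
    (by simp only [mul_fst, smul_fst, MvPolynomial.smul_eq_C_mul]; ring)
    (by
      simp only [mul_snd, smul_fst, smul_snd, bidiff, MvPolynomial.smul_eq_C_mul,
        MvPolynomial.pderiv_C_mul]
      ring))
  (fun r u v => ext'
    (by simp only [mul_fst, smul_fst, MvPolynomial.smul_eq_C_mul]; ring)
    (by
      simp only [mul_snd, smul_fst, smul_snd, bidiff, MvPolynomial.smul_eq_C_mul,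
        MvPolynomial.pderiv_C_mul]
      ring))

/-- The function modulo `ε`. -/
def fstHom : Twisted a b k →+* Chart where
  toFun u := u.1
  map_one' := rfl
  map_mul' _ _ := rfl
  map_zero' := rfl
  map_add' _ _ := rfl

theorem fstHom_apply (u : Twisted a b k) : fstHom u = u.1 := rfl

/-- The multiples of `ε`. -/
def inr : Chart →ₗ[ℂ] Twisted a b k := LinearMap.inr ℂ Chart Chart

theorem inr_fst (f : Chart) : (inr f : Twisted a b k).1 = 0 := rfl

theorem inr_snd (f : Chart) : (inr f : Twisted a b k).2 = f := rfl

theorem mul_inr (u : Twisted a b k) (f : Chart) : u * inr f = inr (fstHom u * f) :=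
  ext' (by simp only [mul_fst, inr_fst, mul_zero])
    (by simp only [mul_snd, inr_fst, inr_snd, bidiff, map_zero, fstHom_apply]; ring)

theorem inr_mul (u : Twisted a b k) (f : Chart) : inr f * u = inr (f * fstHom u) :=
  ext' (by simp only [mul_fst, inr_fst, zero_mul])
    (by simp only [mul_snd, inr_fst, inr_snd, bidiff, map_zero, fstHom_apply]; ring)

end Twisted

/-! ### The lift of the quiver relations in the chart -/

open MvPolynomial in
/-- The infinitesimal change of the arrows. -/
def arrowShift (a b k t : ℂ) : Arrow → Chart
  | zLo _ => 0
  | zHi i => ![0, 4 * C a * x 1, 2 * C a] i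
  | wLo i => ![0, 0, 3 * C k + C t] i
  | wHi i => ![(-C a - C b) * ξ 0, (-3 * C a + C b) * ξ 1,
      (3 * C a + C b) * (ξ 0 * x 0) + (C a - C b) * (ξ 1 * x 1) + C k + C t] i

/-- The deformed arrows. -/
def arrowPair (a b k t : ℂ) (y : Arrow) : Twisted a b k := (chartVal y.coord, arrowShift a b k t y)

/-- The product of the deformed arrows of a word. -/
def pairWord (a b k t : ℂ) (u : List Arrow) : Twisted a b k := (u.map (arrowPair a b k t)).prod

theorem single_sub (p q : Fin 3) (f h : Chart) :
    Matrix.single p q (f - h) = Matrix.single p q f - Matrix.single p q h :=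
  map_sub (Matrix.singleAddMonoidHom (α := Chart) p q) f h

theorem prod_single {R : Type*} [Semiring R] (f : Arrow → R) {p q : Fin 3} {u : List Arrow}
    (hu : PathFrom p q u) (h : u ≠ []) :
    (u.map fun y => Matrix.single y.tgt y.src (f y)).prod = Matrix.single p q (u.map f).prod := by
  induction u generalizing p with
  | nil => exact absurd rfl h
  | cons y u ih =>
    obtain ⟨rfl, hu⟩ := hu
    by_cases h0 : u = []
    · subst h0
      have hq : y.src = q := hu
      subst hq
      simp
    · rw [List.map_cons, List.prod_cons, ih hu h0, Matrix.single_mul_single_same, List.map_cons,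
        List.prod_cons]

theorem fstHom_pairWord (a b k t : ℂ) (u : List Arrow) :
    Twisted.fstHom (pairWord a b k t u) = chartWord u := by
  rw [pairWord, map_list_prod, List.map_map]
  rfl

theorem pairWord_two_snd (a b k t : ℂ) (y₁ y₂ : Arrow) : (pairWord a b k t [y₁, y₂]).2 =
    chartVal y₁.coord * arrowShift a b k t y₂ + arrowShift a b k t y₁ * chartVal y₂.coord +
      bidiff a b k (chartVal y₁.coord) (chartVal y₂.coord) := by
  have : pairWord a b k t [y₁, y₂] = arrowPair a b k t y₁ * arrowPair a b k t y₂ := by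
    simp [pairWord]
  rw [this, Twisted.mul_snd]
  rfl

theorem pairWord_three_snd (a b k t : ℂ) (y₁ y₂ y₃ : Arrow) :
    (pairWord a b k t [y₁, y₂, y₃]).2 =
      chartVal y₁.coord * (chartVal y₂.coord * arrowShift a b k t y₃ +
        arrowShift a b k t y₂ * chartVal y₃.coord +
        bidiff a b k (chartVal y₂.coord) (chartVal y₃.coord)) +
      arrowShift a b k t y₁ * (chartVal y₂.coord * chartVal y₃.coord) +
      bidiff a b k (chartVal y₁.coord) (chartVal y₂.coord * chartVal y₃.coord) := by
  have : pairWord a b k t [y₁, y₂, y₃] =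
      arrowPair a b k t y₁ * (arrowPair a b k t y₂ * arrowPair a b k t y₃) := by
    simp [pairWord]
  rw [this, Twisted.mul_snd, Twisted.mul_snd]
  rfl

/-- The tip `s` and its replacement differ by the value of the cochain. -/
def TipLifts (a b k t : ℂ) (s : List Arrow) : Prop :=
  ∃ p q : Fin 3, PathFrom p q s ∧ ∃ V : Chart,
    toChart (onTip (g a b (3 * k) t) s) = Matrix.single p q V ∧
    (pairWord a b k t s).2 = ((replacement s).map fun q =>
      MvPolynomial.C (q.1 : ℂ) * (pairWord a b k t q.2).2).sum + V

/-- This lemma and the following ones check, rule by rule, that products of the deformed arrows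
satisfy the relations up to g exactly and not just up to a coboundary. The terms of `arrowShift`
absorb the difference between `bidiff` and the prescribed values; t appears only as a shift of w_3,
because z^3 = 1 in the chart. -/
theorem tipLifts_zz (a b k t : ℂ) (i j : Fin 3) (h : i < j) :
    TipLifts a b k t [zHi i, zLo j] := by
  refine ⟨2, 0, ⟨rfl, rfl, rfl⟩, _, toChart_g_zz a b (3 * k) t i j, ?_⟩
  rw [replacement, rule, if_pos h]
  simp only [Option.getD_some, List.map_cons, List.map_nil, List.sum_cons, List.sum_nil,
    pairWord_two_snd, bidiff]
  fin_cases i <;> fin_cases j <;> simp at h <;>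
    simp [zzVal, cyc, arrowShift, chartVal, coord, zChart, wChart, pderiv_x, pderiv_ξ] <;> ring

theorem tipLifts_ww (a b k t : ℂ) (i j : Fin 3) (h : i < j) :
    TipLifts a b k t [wLo i, wHi j] := by
  refine ⟨0, 2, ⟨rfl, rfl, rfl⟩, _, toChart_g_ww a b (3 * k) t i j, ?_⟩
  rw [replacement, rule, if_pos h]
  simp only [Option.getD_some, List.map_cons, List.map_nil, List.sum_cons, List.sum_nil,
    pairWord_two_snd, bidiff]
  fin_cases i <;> fin_cases j <;> simp at h <;>
    simp [wwVal, cyc, arrowShift, chartVal, coord, zChart, wChart, pderiv_x, pderiv_ξ] <;> ring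

theorem tipLifts_zw_last (a b k t : ℂ) : TipLifts a b k t [zLo 2, wLo 2] := by
  refine ⟨1, 1, ⟨rfl, rfl, rfl⟩, -3 * MvPolynomial.C k + MvPolynomial.C t - commVal a b k 2 2,
    ?_, ?_⟩
  · rw [onTip, if_pos ⟨rfl, rfl⟩, map_sub, (toChart_g_moment a b k t).1, toChart_onComm,
      single_sub]
  rw [replacement, rule, if_pos ⟨rfl, rfl⟩]
  simp only [Option.getD_some, List.map_cons, List.map_nil, List.sum_cons, List.sum_nil,
    pairWord_two_snd, bidiff]
  simp [commVal, arrowShift, chartVal, coord, zChart, wChart, pderiv_x, pderiv_ξ]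
  ring

theorem tipLifts_zw (a b k t : ℂ) (i j : Fin 3) (h : ¬(i = 2 ∧ j = 2)) :
    TipLifts a b k t [zLo i, wLo j] := by
  refine ⟨1, 1, ⟨rfl, rfl, rfl⟩, -commVal a b k j i, ?_, ?_⟩
  · rw [onTip, if_neg h, map_neg, toChart_onComm, Matrix.single_neg]
  rw [replacement, rule, if_neg h]
  simp only [Option.getD_some, List.map_cons, List.map_nil, List.sum_cons, List.sum_nil,
    pairWord_two_snd, bidiff]
  fin_cases i <;> fin_cases j <;> simp at h <;>
    simp [commVal, arrowShift, chartVal, coord, zChart, wChart, pderiv_x, pderiv_ξ] <;> ring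

theorem tipLifts_wz_last (a b k t : ℂ) : TipLifts a b k t [wHi 2, zHi 2] := by
  refine ⟨1, 1, ⟨rfl, rfl, rfl⟩, -3 * MvPolynomial.C k + MvPolynomial.C t,
    (toChart_g_moment a b k t).1, ?_⟩
  rw [replacement, rule, if_pos ⟨rfl, rfl⟩]
  simp only [Option.getD_some, List.map_cons, List.map_nil, List.sum_cons, List.sum_nil,
    pairWord_two_snd, bidiff]
  simp [arrowShift, chartVal, coord, zChart, wChart, pderiv_x, pderiv_ξ]
  ring

theorem tipLifts_zwHi_last (a b k t : ℂ) : TipLifts a b k t [zHi 2, wHi 2] := by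
  refine ⟨2, 2, ⟨rfl, rfl, rfl⟩, MvPolynomial.C k + MvPolynomial.C t,
    (toChart_g_moment a b k t).2.1, ?_⟩
  rw [replacement, rule, if_pos ⟨rfl, rfl⟩]
  simp only [Option.getD_some, List.map_cons, List.map_nil, List.sum_cons, List.sum_nil,
    pairWord_two_snd, bidiff]
  simp [arrowShift, chartVal, coord, zChart, wChart, pderiv_x, pderiv_ξ]
  ring

theorem tipLifts_wzLo_last (a b k t : ℂ) : TipLifts a b k t [wLo 2, zLo 2] := by
  refine ⟨0, 0, ⟨rfl, rfl, rfl⟩, -MvPolynomial.C k + MvPolynomial.C t,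
    (toChart_g_moment a b k t).2.2, ?_⟩
  rw [replacement, rule, if_pos ⟨rfl, rfl⟩]
  simp only [Option.getD_some, List.map_cons, List.map_nil, List.sum_cons, List.sum_nil,
    pairWord_two_snd, bidiff]
  simp [arrowShift, chartVal, coord, zChart, wChart, pderiv_x, pderiv_ξ]
  ring

theorem tipLifts_wzw (a b k t : ℂ) (i l j : Fin 3) (h : i < j ∧ ¬(l = 2 ∧ j = 2)) :
    TipLifts a b k t [wHi i, zHi l, wHi j] := by
  refine ⟨1, 2, ⟨rfl, rfl, rfl, rfl⟩, commVal a b k i l * wChart j + zChart l * wwVal b i j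
    - commVal a b k j l * wChart i, ?_, ?_⟩
  · simp only [onTip, map_sub, map_add, map_mul, toChart_onComm, toChart_g_ww, toChart_arr,
      arrowMatrix, Matrix.single_mul_single_same, single_sub, Matrix.single_add]
  rw [replacement, rule, if_pos h]
  simp only [Option.getD_some, List.map_cons, List.map_nil, List.sum_cons, List.sum_nil,
    pairWord_three_snd, bidiff]
  fin_cases i <;> fin_cases j <;> fin_cases l <;> simp at h <;>
    simp [commVal, wwVal, cyc, arrowShift, chartVal, coord, zChart, wChart, pderiv_x, pderiv_ξ] <;>
    ring

theorem tipLifts_zwz (a b k t : ℂ) (i l j : Fin 3) (h : i < j ∧ ¬(l = 2 ∧ j = 2)) :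
    TipLifts a b k t [zHi i, wHi l, zHi j] := by
  refine ⟨2, 1, ⟨rfl, rfl, rfl, rfl⟩, zChart i * commVal a b k l j + zzVal a i j * wChart l
    - zChart j * commVal a b k l i, ?_, ?_⟩
  · simp only [onTip, map_sub, map_add, map_mul, toChart_onComm, toChart_g_zz, toChart_arr,
      arrowMatrix, Matrix.single_mul_single_same, single_sub, Matrix.single_add]
  rw [replacement, rule, if_pos h]
  simp only [Option.getD_some, List.map_cons, List.map_nil, List.sum_cons, List.sum_nil,
    pairWord_three_snd, bidiff]
  fin_cases i <;> fin_cases j <;> fin_cases l <;> simp at h <;>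
    simp [commVal, zzVal, cyc, arrowShift, chartVal, coord, zChart, wChart, pderiv_x, pderiv_ξ] <;>
    ring

theorem tipLifts_wwz (a b k t : ℂ) (l : Fin 3) (h : l = 0 ∨ l = 1) :
    TipLifts a b k t [wLo 2, wHi l, zHi 2] := by
  refine ⟨0, 1, ⟨rfl, rfl, rfl, rfl⟩, wwVal b 0 l * zChart 0 + wwVal b 1 l * zChart 1
    + wwVal b 2 l * zChart 2 + wChart l * (-3 * MvPolynomial.C k + MvPolynomial.C t)
    - (if l = 1 then wwVal b 0 1 * zChart 0 else 0), ?_, ?_⟩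
  · simp only [onTip, map_sub, map_add, map_mul, toChart_g_ww, toChart_arr, Fin.sum_univ_three,
      (toChart_g_moment a b k t).1]
    rw [single_sub, apply_ite toChart, apply_ite (Matrix.single (0 : Fin 3) (1 : Fin 3)), map_mul,
      toChart_g_ww, toChart_arr, map_zero, Matrix.single_zero]
    simp only [arrowMatrix, Matrix.single_mul_single_same]
    rw [Matrix.single_add, Matrix.single_add, Matrix.single_add]
  rcases h with rfl | rfl <;> rw [replacement, rule, if_pos ⟨rfl, rfl⟩] <;>
  simp only [if_pos, one_ne_zero, if_neg, not_false_eq_true, Option.getD_some, List.map_cons,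
    List.map_nil, List.sum_cons, List.sum_nil, pairWord_three_snd, bidiff] <;>
  simp [wwVal, cyc, arrowShift, chartVal, coord, zChart, wChart, pderiv_x, pderiv_ξ] <;>
  ring

theorem tipLifts (a b k t : ℂ) (s : List Arrow) (hs : IsTip s = true) : TipLifts a b k t s := by
  unfold IsTip rule at hs
  split at hs <;> (try split_ifs at hs) <;>
    simp only [Option.isSome_none, Option.isSome_some, Bool.false_eq_true] at hs
  · exact tipLifts_zz _ _ _ _ _ _ (by assumption)
  · exact tipLifts_ww _ _ _ _ _ _ (by assumption)
  · rename_i h; obtain ⟨rfl, rfl⟩ := h; exact tipLifts_zw_last _ _ _ _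
  · exact tipLifts_zw _ _ _ _ _ _ (by assumption)
  · rename_i h; obtain ⟨rfl, rfl⟩ := h; exact tipLifts_wz_last _ _ _ _
  · rename_i h; obtain ⟨rfl, rfl⟩ := h; exact tipLifts_zwHi_last _ _ _ _
  · rename_i h; obtain ⟨rfl, rfl⟩ := h; exact tipLifts_wzLo_last _ _ _ _
  · exact tipLifts_wzw _ _ _ _ _ _ _ (by assumption)
  · exact tipLifts_zwz _ _ _ _ _ _ _ (by assumption)
  · rename_i h _; obtain ⟨rfl, rfl⟩ := h; exact tipLifts_wwz _ _ _ _ _ (Or.inl (by assumption))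
  · rename_i h _ _; obtain ⟨rfl, rfl⟩ := h; exact tipLifts_wwz _ _ _ _ _ (Or.inr (by assumption))

theorem ne_nil_of_isTip {s : List Arrow} (hs : IsTip s = true) : s ≠ [] := by
  rintro rfl
  simp [IsTip, rule] at hs

theorem ne_nil_of_mem_replacement {s : List Arrow} (hs : s ≠ []) {q : ℤ × List Arrow}
    (hq : q ∈ replacement s) : q.2 ≠ [] := by
  intro h
  have := (replacement_lt s q hq).1
  rw [h] at this
  exact hs (List.length_eq_zero_iff.1 this.symm)

theorem chartWord_tip {s : List Arrow} (hs : IsTip s = true) {p q : Fin 3} (hp : PathFrom p q s) :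
    chartWord s = ((replacement s).map fun r => (r.1 : ℂ) • chartWord r.2).sum := by
  have h := congrArg (fun u => toChart u p q) (cls_tip hs)
  rw [toChart_cls hp (ne_nil_of_isTip hs), Matrix.single_apply_same] at h
  rw [h]
  -- The ends of a word are known only if it occurs in the replacement, so the induction runs over
  -- lists whose members all do.
  have : ∀ l : List (ℤ × List Arrow), (∀ r ∈ l, r ∈ replacement s) →
      toChart (l.map fun r => (r.1 : ℂ) • cls r.2).sum p q =
        (l.map fun r => (r.1 : ℂ) • chartWord r.2).sum := by
    intro l hl
    induction l with
    | nil => simp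
    | cons r l ih =>
      have hr := hl r (by simp)
      rw [List.map_cons, List.sum_cons, map_add, Matrix.add_apply,
        ih fun r' hr' => hl r' (by simp [hr']), map_smul, Matrix.smul_apply,
        toChart_cls (replacement_pathFrom hr hp)
          (ne_nil_of_mem_replacement (ne_nil_of_isTip hs) hr), Matrix.single_apply_same,
        List.map_cons, List.sum_cons]
  exact this _ fun _ h => h

theorem sum_smul_single {R : Type*} [Semiring R] [Algebra ℂ R] (p q : Fin 3)
    (l : List (ℤ × List Arrow)) (F : List Arrow → R) :
    (l.map fun r => (r.1 : ℂ) • Matrix.single p q (F r.2)).sum =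
      Matrix.single p q (l.map fun r => (r.1 : ℂ) • F r.2).sum := by
  induction l with
  | nil => simp
  | cons r l ih =>
    rw [List.map_cons, List.sum_cons, ih, List.map_cons, List.sum_cons, Matrix.smul_single,
      Matrix.single_add]

theorem prod_single_sum {R : Type*} [Semiring R] [Algebra ℂ R] (f : Arrow → R) {s : List Arrow}
    (hs : s ≠ []) {p q : Fin 3} (hp : PathFrom p q s) :
    ((replacement s).map fun r =>
      (r.1 : ℂ) • (r.2.map fun y => Matrix.single y.tgt y.src (f y)).prod).sum =
      Matrix.single p q ((replacement s).map fun r => (r.1 : ℂ) • (r.2.map f).prod).sum := by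
  rw [← sum_smul_single p q _ fun u => (u.map f).prod]
  refine congrArg _ (List.map_congr_left fun r hr => ?_)
  rw [prod_single f (replacement_pathFrom hr hp) (ne_nil_of_mem_replacement hs hr)]

namespace Twisted

variable {a b k : ℂ}

theorem sum_fst (l : List (ℤ × List Arrow)) (F : List Arrow → Twisted a b k) :
    (l.map fun r => (r.1 : ℂ) • F r.2).sum.1 = (l.map fun r => (r.1 : ℂ) • (F r.2).1).sum := by
  induction l with
  | nil => rfl
  | cons r l ih =>
    rw [List.map_cons, List.sum_cons, add_fst, ih, smul_fst, List.map_cons, List.sum_cons]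

theorem sum_snd (l : List (ℤ × List Arrow)) (F : List Arrow → Twisted a b k) :
    (l.map fun r => (r.1 : ℂ) • F r.2).sum.2 = (l.map fun r => (r.1 : ℂ) • (F r.2).2).sum := by
  induction l with
  | nil => rfl
  | cons r l ih =>
    rw [List.map_cons, List.sum_cons, add_snd, ih, smul_snd, List.map_cons, List.sum_cons]

theorem mul_map_inr (A : Matrix (Fin 3) (Fin 3) (Twisted a b k)) (V : Matrix (Fin 3) (Fin 3) Chart) :
    A * V.map inr = (A.map fstHom * V).map inr := by
  ext i j
  simp [Matrix.mul_apply, mul_inr, map_sum]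

theorem map_inr_mul (A : Matrix (Fin 3) (Fin 3) (Twisted a b k)) (V : Matrix (Fin 3) (Fin 3) Chart) :
    V.map inr * A = (V * A.map fstHom).map inr := by
  ext i j
  simp [Matrix.mul_apply, inr_mul, map_sum]

/-- The function modulo `ε`, as a linear map. -/
def fstLin : Twisted a b k →ₗ[ℂ] Chart := LinearMap.fst ℂ Chart Chart

theorem inr_injective : Function.Injective (inr : Chart → Twisted a b k) :=
  fun _ _ h => congrArg Prod.snd h

end Twisted

/-- Matrices over the deformed functions, as a lift of the quiver relations. -/
def chartLift (a b k t : ℂ) : Lift (g a b (3 * k) t) (Matrix (Fin 3) (Fin 3) (Twisted a b k)) where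
  E p := Matrix.single p p 1
  X y := Matrix.single y.tgt y.src (arrowPair a b k t y)
  Δ := (Twisted.inr.mapMatrix (m := Fin 3) (n := Fin 3)) ∘ₗ toChart.toLinearMap
  idem p q := by
    split_ifs with h
    · subst h; simp
    · simp [h]
  tgt y := by simp
  src y := by simp
  E_mul p v := by
    refine (Twisted.mul_map_inr _ (toChart v)).trans ?_
    rw [Matrix.map_single, map_one, ← toChart_e, ← map_mul]
    rfl
  mul_E p v := by
    refine (Twisted.map_inr_mul _ (toChart v)).trans ?_
    rw [Matrix.map_single, map_one, ← toChart_e, ← map_mul]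
    rfl
  X_mul y v := by
    refine (Twisted.mul_map_inr _ (toChart v)).trans ?_
    have : toChart (arr y) = Matrix.single y.tgt y.src (chartVal y.coord) := by
      rw [toChart_arr, arrowMatrix_eq, chartVal]
    rw [Matrix.map_single, Twisted.fstHom_apply, arrowPair, ← this, ← map_mul]
    rfl
  mul_X y v := by
    refine (Twisted.map_inr_mul _ (toChart v)).trans ?_
    have : toChart (arr y) = Matrix.single y.tgt y.src (chartVal y.coord) := by
      rw [toChart_arr, arrowMatrix_eq, chartVal]
    rw [Matrix.map_single, Twisted.fstHom_apply, arrowPair, ← this, ← map_mul]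
    rfl
  tip s hs := by
    obtain ⟨p, q, hp, V, hV, h⟩ := tipLifts a b k t s hs
    have h0 := ne_nil_of_isTip hs
    rw [prod_single _ hp h0, prod_single_sum _ h0 hp, LinearMap.comp_apply,
      AlgHom.toLinearMap_apply, hV, LinearMap.mapMatrix_apply, Matrix.map_single,
      ← Matrix.single_add]
    congr 1
    refine Twisted.ext' ?_ ?_
    · rw [Twisted.add_fst, Twisted.inr_fst, add_zero,
        Twisted.sum_fst _ fun u => (u.map (arrowPair a b k t)).prod]
      have := chartWord_tip hs hp
      simp only [← fstHom_pairWord a b k t] at this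
      exact this
    · rw [Twisted.add_snd, Twisted.inr_snd,
        Twisted.sum_snd _ fun u => (u.map (arrowPair a b k t)).prod]
      refine h.trans ?_
      simp only [MvPolynomial.smul_eq_C_mul]
      rfl

theorem chartLift_Δ_injective (a b k t : ℂ) : Function.Injective (chartLift a b k t).Δ := by
  intro u v h
  refine toChart_injective (Matrix.ext fun i j => ?_)
  exact Twisted.inr_injective (congrFun (congrFun h i) j)

theorem chartLift_path (a b k t : ℂ) {p q : Fin 3} {u : List Arrow} (hu : PathFrom p q u) :
    (chartLift a b k t).E p * (chartLift a b k t).word u =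
      Matrix.single p q (pairWord a b k t u) := by
  by_cases h : u = []
  · subst h
    have : p = q := hu
    subst this
    rw [Lift.word_nil, mul_one]
    rfl
  · rw [Lift.E_mul_word_self _ hu h]
    exact prod_single _ hu h

theorem chartLift_sec_fst (a b k t : ℂ) (u : Lam) (i j : Fin 3) :
    ((chartLift a b k t).sec u i j).1 = toChart u i j := by
  suffices h : (LinearMap.mapMatrix (m := Fin 3) (n := Fin 3) Twisted.fstLin) ∘ₗ
      (chartLift a b k t).sec = toChart.toLinearMap from
    congrFun (congrFun (LinearMap.congr_fun h u) i) j
  refine irrBasis.ext fun s => ?_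
  rw [irrBasis_apply, LinearMap.comp_apply, Lift.sec_irr, Lift.el, chartLift_path a b k t s.2.1,
    AlgHom.toLinearMap_apply, toChart_irr, ← fstHom_pairWord a b k t, LinearMap.mapMatrix_apply,
    Matrix.map_single]
  rfl

theorem isCocycle_barCochain_g (a b c t : ℂ) : IsCocycle (barCochain (g a b c t)) := by
  have := (chartLift a b (c / 3) t).isCocycle (chartLift_Δ_injective _ _ _ _)
  rwa [mul_div_cancel₀ c three_ne_zero] at this

/-! ### The commutator of the cocycle -/

/-- The bracket of the deformation in the chart. -/
def commBracket (a b k : ℂ) (f h : Chart) : Chart := bidiff a b k f h - bidiff a b k h f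

theorem toChart_eq_single {u : Lam} (hu : u = e 0 * u * e 0) :
    toChart u = Matrix.single 0 0 (fn u) := by
  conv_lhs => rw [hu, map_mul, map_mul, toChart_e]
  rw [Matrix.single_mul_mul_single]
  simp [fn]

/-- In the commutative corner at node 0 the sections of u and v are pairs f₀ + ε f₁ in a single
matrix entry. The section of u v = v u and the mixed terms f₀ h₁ + f₁ h₀ are symmetric and drop out
of the commutator; what remains is `bidiff` antisymmetrised. -/
theorem fn_commutator (a b k t : ℂ) {u v : Lam} (hu : u = e 0 * u * e 0) (hv : v = e 0 * v * e 0) :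
    fn (barCochain (g a b (3 * k) t) u v - barCochain (g a b (3 * k) t) v u) =
      commBracket a b k (fn u) (fn v) := by
  set T := chartLift a b k t
  set m := barCochain (g a b (3 * k) t)
  have hbar := isBarCochain_barCochain (g a b (3 * k) t)
  have hsec : ∀ u, u = e 0 * u * e 0 → ∃ f : Twisted a b k,
      T.sec u = Matrix.single 0 0 f ∧ f.1 = fn u := by
    intro u hu
    -- The bar cochain vanishes on idempotents, so the section respects multiplication by them and
    -- stays in the corner.
    have h1 : T.sec u = T.E 0 * T.sec u * T.E 0 := by
      conv_lhs => rw [hu]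
      rw [← T.sec_e]
      have h2 := T.sec_mul (e 0) u
      have h3 := T.sec_mul (e 0 * u) (e 0)
      rw [hbar.left_e, map_zero, add_zero] at h2
      rw [hbar.right_e, map_zero, add_zero] at h3
      rw [h2, h3]
    refine ⟨T.sec u 0 0, ?_, ?_⟩
    · conv_lhs => rw [h1]
      change Matrix.single 0 0 1 * T.sec u * Matrix.single 0 0 1 = _
      rw [Matrix.single_mul_mul_single, one_mul, mul_one]
    · exact chartLift_sec_fst a b k t u 0 0
  obtain ⟨F, hF, hF'⟩ := hsec u hu
  obtain ⟨H, hH, hH'⟩ := hsec v hv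
  have huv : u * v = v * u := by
    refine toChart_injective ?_
    rw [map_mul, map_mul, toChart_eq_single hu, toChart_eq_single hv,
      Matrix.single_mul_single_same, Matrix.single_mul_single_same, mul_comm]
  have h1 := T.sec_mul u v
  have h2 := T.sec_mul v u
  rw [hF, hH, Matrix.single_mul_single_same] at h1 h2
  rw [huv] at h1
  have h3 := congrArg (fun A : Matrix (Fin 3) (Fin 3) (Twisted a b k) => (A 0 0).2) h1
  have h4 := congrArg (fun A : Matrix (Fin 3) (Fin 3) (Twisted a b k) => (A 0 0).2) h2
  simp only [Matrix.single_apply_same, Matrix.add_apply, Twisted.add_snd, Twisted.mul_snd, hF',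
    hH'] at h3 h4
  have h5 : ∀ u, (T.Δ u 0 0).2 = fn u := fun _ => rfl
  rw [h5] at h3 h4
  rw [fn, map_sub, Matrix.sub_apply, commBracket]
  change fn (m u v) - fn (m v u) = _
  linear_combination h4 - h3

-- With b = -a the diagonal quadratic coefficient 2a + 2b vanishes, and the remaining quadratic ones
-- become ±6a, which is ±1 for a = -1/6. The constant term is -2k = s.
open Sum MvPolynomial in
theorem commBracket_eq_bracket (s : ℂ) (f h : Chart) :
    commBracket (-1 / 6) (1 / 6) (-s / 2) f h = bracket s f h := by
  have hI : (C (-Complex.I) * C Complex.I : Chart) = 1 := by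
    rw [← C_mul, neg_mul, Complex.I_mul_I, neg_neg, C_1]
  have h1 : (C (-1 / 6) : Chart) = -C (1 / 6) := by rw [← C_neg]; congr 1; ring
  have h2 : (6 * C (1 / 6) : Chart) = 1 := by
    rw [show (6 : Chart) = C 6 from (map_ofNat C 6).symm, ← C_mul, ← C_1]; congr 1; norm_num
  have h3 : (C s : Chart) = -2 * C (-s / 2) := by
    rw [show (-2 : Chart) = C (-2) by rw [C_neg, C_two], ← C_mul]
    congr 1
    ring
  rw [bracket, piBivector, ← mul_assoc, hI, one_mul, commBracket, bidiff, bidiff, h1, h3]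
  simp only [wedge]
  linear_combination (
    ξ 0 * x 1 * (pderiv (inr 0) f * pderiv (inl 1) h - pderiv (inl 1) f * pderiv (inr 0) h)
    - ξ 1 * x 0 * (pderiv (inr 1) f * pderiv (inl 0) h - pderiv (inl 0) f * pderiv (inr 1) h)
    - ξ 0 * ξ 1 * (pderiv (inr 0) f * pderiv (inr 1) h - pderiv (inr 1) f * pderiv (inr 0) h)
    - x 0 * x 1 * (pderiv (inl 0) f * pderiv (inl 1) h - pderiv (inl 1) f * pderiv (inl 0) h)) * h2

/-! ### The Jacobi identity -/

/-- The commutator of two derivations is a derivation, and this one kills the variables. -/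
theorem pderiv_comm {σ R : Type*} [CommRing R] (i j : σ) (f : MvPolynomial σ R) :
    MvPolynomial.pderiv i (MvPolynomial.pderiv j f) =
      MvPolynomial.pderiv j (MvPolynomial.pderiv i f) := by
  classical
  have : ⁅(MvPolynomial.pderiv i : Derivation R (MvPolynomial σ R) (MvPolynomial σ R)),
      (MvPolynomial.pderiv j : Derivation R (MvPolynomial σ R) (MvPolynomial σ R))⁆ = 0 := by
    apply MvPolynomial.derivation_ext
    intro l
    rw [Derivation.commutator_apply, MvPolynomial.pderiv_X, MvPolynomial.pderiv_X,
      Derivation.zero_apply]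
    simp only [Pi.single_apply]
    split_ifs <;> simp
  have h := DFunLike.congr_fun this f
  rw [Derivation.commutator_apply, Derivation.zero_apply, sub_eq_zero] at h
  exact h

open Sum MvPolynomial in
theorem bracket_eq (s : ℂ) (f h : Chart) : bracket s f h =
    C s * (wedge (inr 0) (inl 0) f h + wedge (inr 1) (inl 1) f h)
      - ξ 0 * ξ 1 * wedge (inr 0) (inr 1) f h + ξ 0 * x 1 * wedge (inr 0) (inl 1) f h
      - ξ 1 * x 0 * wedge (inr 1) (inl 0) f h - x 0 * x 1 * wedge (inl 0) (inl 1) f h := by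
  have hI : (C (-Complex.I) * C Complex.I : Chart) = 1 := by
    rw [← C_mul, neg_mul, Complex.I_mul_I, neg_neg, C_1]
  rw [bracket, piBivector, ← mul_assoc, hI, one_mul]

-- Conceptually, -iΠ_s is s times the canonical bivector minus E_1 ∧ E_2 with E_i = x^i ∂_{x^i} -
-- ξ_i ∂_{ξ_i}; the fields E_1, E_2 commute and preserve the canonical bivector, so all Schouten
-- brackets vanish. The proof expands instead, after putting mixed second derivatives into a fixed
-- order.
set_option maxRecDepth 4000 in
open Sum MvPolynomial in
theorem bracket_jacobi (s : ℂ) (f h k : Chart) :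
    bracket s f (bracket s h k) + bracket s h (bracket s k f) + bracket s k (bracket s f h) = 0 := by
  simp only [bracket_eq, wedge, map_add, map_sub, pderiv_mul, pderiv_C, pderiv_x, pderiv_ξ]
  have hc : ∀ (i j : Fin 2 ⊕ Fin 2) (f : Chart), pderiv i (pderiv j f) = pderiv j (pderiv i f) :=
    pderiv_comm
  simp only [hc (inl 1) (inl 0), hc (inr 0) (inl 0), hc (inr 0) (inl 1), hc (inr 1) (inl 0),
    hc (inr 1) (inl 1), hc (inr 1) (inr 0), reduceCtorEq, if_false, inl.injEq, inr.injEq, if_true,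
    Fin.isValue, zero_ne_one, one_ne_zero]
  ring

/-! ### Comparison with the Poisson structure -/

theorem fn_wz (i j : Fin 3) : fn (cls [wLo i, zLo j]) = wChart i * zChart j := by
  rw [fn, toChart_cls (p := 0) (q := 0) (u := [wLo i, zLo j]) ⟨rfl, rfl, rfl⟩ (by simp),
    Matrix.single_apply_same]
  simp [chartWord, chartVal, coord]

theorem wz_mem (i j : Fin 3) : cls [wLo i, zLo j] = e 0 * cls [wLo i, zLo j] * e 0 := by
  have hp : PathFrom 0 0 [wLo i, zLo j] := ⟨rfl, rfl, rfl⟩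
  rw [e_mul_cls hp (by simp)]
  exact (((trivialLift 0).word_mul_E hp (by simp) 0).trans (if_pos rfl)).symm

open MvPolynomial Sum in
theorem commBracket_ξ_ξ (a b k : ℂ) (v : Fin 2 ⊕ Fin 2 → ℂ) :
    eval v (commBracket a b k (wChart 0 * zChart 2) (wChart 1 * zChart 2)) =
      (2 * a - 4 * b) * (v (inr 0) * v (inr 1)) := by
  simp [commBracket, bidiff, wChart, zChart, x, ξ]

open MvPolynomial Sum in
theorem commBracket_ξ_x (a b k : ℂ) (v : Fin 2 ⊕ Fin 2 → ℂ) :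
    eval v (commBracket a b k (wChart 0 * zChart 2) (wChart 0 * zChart 0)) =
      ((2 * a + 2 * b) * (v (inr 0) * v (inl 0) + v (inr 1) * v (inl 1)) - 2 * k) * v (inr 0) := by
  simp [commBracket, bidiff, wChart, zChart, x, ξ]

theorem params_of_commBracket {a b k a' b' k' : ℂ}
    (h : ∀ i j l n, commBracket a b k (wChart i * zChart j) (wChart l * zChart n) =
      commBracket a' b' k' (wChart i * zChart j) (wChart l * zChart n)) :
    a = a' ∧ b = b' ∧ k = k' := by
  -- The bracket {ξ_1, ξ_2} at x = 0, ξ = (1, 1) is 2a - 4b. The bracket {ξ_1, ξ_1 x^1} at ξ = (1,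
  -- 0) is -2k for x = 0 and 2a + 2b - 2k for x = (1, 0).
  have h1 := congrArg (MvPolynomial.eval (Sum.elim ![0, 0] ![1, 1])) (h 0 2 1 2)
  have h2 := congrArg (MvPolynomial.eval (Sum.elim ![0, 0] ![1, 0])) (h 0 2 0 0)
  have h3 := congrArg (MvPolynomial.eval (Sum.elim ![1, 0] ![1, 0])) (h 0 2 0 0)
  rw [commBracket_ξ_ξ, commBracket_ξ_ξ] at h1
  rw [commBracket_ξ_x, commBracket_ξ_x] at h2 h3
  simp at h1 h2 h3
  refine ⟨?_, ?_, h2⟩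
  · linear_combination h1 / 6 + h3 / 3 + 2 / 3 * h2
  · linear_combination -h1 / 6 + h3 / 6 + 1 / 3 * h2

theorem matches_iff (s a b c t : ℂ) {u v : Lam} (hu : u = e 0 * u * e 0) (hv : v = e 0 * v * e 0) :
    Matches s (barCochain (g a b c t)) u v ↔
      commBracket a b (c / 3) (fn u) (fn v) =
        commBracket (-1 / 6) (1 / 6) (-s / 2) (fn u) (fn v) := by
  have h := fn_commutator a b (c / 3) t hu hv
  rw [mul_div_cancel₀ c three_ne_zero] at h
  rw [Matches, h, commBracket_eq_bracket]

theorem matches_wz_iff (s a b c t : ℂ) :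
    (∀ i j k l : Fin 3, Matches s (barCochain (g a b c t)) (cls [wLo i, zLo j])
      (cls [wLo k, zLo l])) ↔ a = -1 / 6 ∧ b = 1 / 6 ∧ c = -(3 * s) / 2 := by
  constructor
  · intro h
    have h' : ∀ i j l n, commBracket a b (c / 3) (wChart i * zChart j) (wChart l * zChart n) =
        commBracket (-1 / 6) (1 / 6) (-s / 2) (wChart i * zChart j) (wChart l * zChart n) := by
      intro i j l n
      have := (matches_iff s a b c t (wz_mem i j) (wz_mem l n)).1 (h i j l n)
      rwa [fn_wz, fn_wz] at this
    obtain ⟨h1, h2, h3⟩ := params_of_commBracket h'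
    exact ⟨h1, h2, by linear_combination 3 * h3⟩
  · rintro ⟨rfl, rfl, rfl⟩ i j k l
    rw [matches_iff _ _ _ _ _ (wz_mem i j) (wz_mem k l)]
    congr 1
    ring

theorem matches_all_iff (s a b c t : ℂ) :
    (∀ u v : Lam, u = e 0 * u * e 0 → v = e 0 * v * e 0 →
      Matches s (barCochain (g a b c t)) u v) ↔ a = -1 / 6 ∧ b = 1 / 6 ∧ c = -(3 * s) / 2 := by
  constructor
  · intro h
    exact (matches_wz_iff s a b c t).1 fun i j k l => h _ _ (wz_mem i j) (wz_mem k l)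
  · rintro ⟨rfl, rfl, rfl⟩ u v hu hv
    rw [matches_iff _ _ _ _ _ hu hv]
    congr 1
    ring

/-! ### Coboundaries -/

/-- One factor in the corner suffices. This matters because a cochain β whose coboundary is taken
need not preserve the corner. -/
theorem fn_mul_of_left {u : Lam} (hu : u = e 0 * u * e 0) (v : Lam) : fn (u * v) = fn u * fn v := by
  rw [fn, map_mul, toChart_eq_single hu, Matrix.single_mul_apply_same]
  rfl

theorem fn_mul_of_right {v : Lam} (hv : v = e 0 * v * e 0) (u : Lam) : fn (u * v) = fn u * fn v := by
  rw [fn, map_mul, toChart_eq_single hv, Matrix.mul_single_apply_same]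
  rfl

/-- The sum ∑ w_i z^i in the lift is computed twice: the rule for w_3 z^3 gives Δ of the value of g,
and the section gives Δ of the sum of the values of m, since the sum vanishes in Λ. -/
theorem sum_barCochain_wz (a b c t : ℂ) :
    ∑ i, barCochain (g a b c t) (arr (wLo i)) (arr (zLo i)) = g a b c t .wz0 := by
  obtain ⟨k, rfl⟩ : ∃ k, c = 3 * k := ⟨c / 3, (mul_div_cancel₀ c three_ne_zero).symm⟩
  set T := chartLift a b k t
  apply chartLift_Δ_injective a b k t
  have h1 : ∑ i, T.X (wLo i) * T.X (zLo i) = T.Δ (g a b (3 * k) t .wz0) := by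
    have := T.tip [wLo 2, zLo 2] rfl
    simp [replacement, rule, onTip] at this
    rw [Fin.sum_univ_three, this]
    abel
  have h2 : ∑ i, T.X (wLo i) * T.X (zLo i) = T.sec (∑ i, arr (wLo i) * arr (zLo i)) +
      T.Δ (∑ i, barCochain (g a b (3 * k) t) (arr (wLo i)) (arr (zLo i))) := by
    simp only [map_sum, ← Finset.sum_add_distrib, ← T.sec_mul, T.sec_arr]
  have h3 : ∑ i, arr (wLo i) * arr (zLo i) = 0 := by
    simpa [arr] using mk_eq QuiverRel.moment_wz0
  rw [h3, map_zero, zero_add, h1] at h2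
  exact h2.symm

/-- Evaluation at the origin of the chart. -/
def atOrigin : Lam →+* Matrix (Fin 3) (Fin 3) ℂ :=
  (RingHom.mapMatrix (MvPolynomial.eval (0 : Fin 2 ⊕ Fin 2 → ℂ))).comp toChart.toRingHom

theorem atOrigin_arr_wLo (i : Fin 3) : atOrigin (arr (wLo i)) = 0 := by
  have : MvPolynomial.eval (0 : Fin 2 ⊕ Fin 2 → ℂ) (wChart i) = 0 := by
    fin_cases i <;> simp [wChart, x, ξ]
  change (toChart (arr (wLo i))).map (MvPolynomial.eval 0) = 0
  rw [toChart_arr, arrowMatrix, Matrix.map_single, this, Matrix.single_zero]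

/-- A path from 1 to 0 has an arrow w as its leftmost letter, and all w_i vanish where x = ξ = 0. -/
theorem atOrigin_upper (u : Lam) : atOrigin u 0 1 = 0 := by
  have hu : u ∈ Submodule.span ℂ (Set.range irr) := span_irr ▸ Submodule.mem_top
  induction hu using Submodule.span_induction with
  | mem v hv =>
    obtain ⟨⟨⟨p, q, u⟩, hu, hirr⟩, rfl⟩ := hv
    change MvPolynomial.eval 0 (toChart (irr _) 0 1) = 0
    rw [toChart_irr, Matrix.single_apply]
    split_ifs with h
    · obtain ⟨rfl, rfl⟩ := h
      change MvPolynomial.eval 0 (chartWord u) = 0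
      change PathFrom _ _ u at hu
      rcases u with _ | ⟨y, u⟩
      · simp [PathFrom] at hu
      · have : MvPolynomial.eval (0 : Fin 2 ⊕ Fin 2 → ℂ) (chartVal y.coord) = 0 := by
          have h0 := hu.1
          rcases y with i | i | i | i <;> simp [Arrow.tgt] at h0
          fin_cases i <;> simp [chartVal, coord, wChart, x, ξ]
        rw [chartWord, List.map_cons, List.prod_cons, map_mul, this, zero_mul]
    · simp
  | zero => simp
  | add u v _ _ hu hv => rw [map_add, Matrix.add_apply, hu, hv, add_zero]
  | smul r v _ hv =>
    have : atOrigin (r • v) = r • atOrigin v := by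
      ext i j
      change MvPolynomial.eval 0 (toChart (r • v) i j) = r * MvPolynomial.eval 0 (toChart v i j)
      rw [map_smul, Matrix.smul_apply, MvPolynomial.smul_eval]
    rw [this, Matrix.smul_apply, hv, smul_zero]

/-- If the bar cochains of `g a b c t` and `g 0 0 0 τ` differ by a coboundary, the parameters
agree. -/
theorem params_eq_of_coboundary {a b c t τ : ℂ} (β : Lam → Lam) (hβ : ∀ u v, β (u + v) = β u + β v)
    (h : ∀ u v, barCochain (g a b c t) u v + β (u * v) =
      barCochain (g 0 0 0 τ) u v + (u * β v + β u * v)) :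
    a = 0 ∧ b = 0 ∧ c = 0 ∧ t = τ := by
  -- For commuting u, v in the corner, the function of u β(v) + β(u) v - β(u v) is symmetric in u
  -- and v, so the coboundary disappears from commutators.
  have hcomm : ∀ i j l n, commBracket a b (c / 3) (wChart i * zChart j) (wChart l * zChart n) =
      commBracket 0 0 0 (wChart i * zChart j) (wChart l * zChart n) := by
    intro i j l n
    have hu := wz_mem i j
    have hv := wz_mem l n
    rw [← fn_wz, ← fn_wz]
    set u := cls [wLo i, zLo j]
    set v := cls [wLo l, zLo n]
    have h0 := fn_commutator a b (c / 3) t hu hv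
    rw [mul_div_cancel₀ c three_ne_zero] at h0
    rw [← h0]
    have huv : u * v = v * u := by
      refine toChart_injective ?_
      rw [map_mul, map_mul, toChart_eq_single hu, toChart_eq_single hv,
        Matrix.single_mul_single_same, Matrix.single_mul_single_same, mul_comm]
    have h1 := congrArg fn (h u v)
    have h2 := congrArg fn (h v u)
    have hadd : ∀ u v, fn (u + v) = fn u + fn v := fun u v => by simp [fn]
    have hsub : ∀ u v, fn (u - v) = fn u - fn v := fun u v => by simp [fn]
    rw [hadd, hadd, hadd, fn_mul_of_left hu, fn_mul_of_right hv] at h1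
    rw [hadd, hadd, hadd, fn_mul_of_left hv, fn_mul_of_right hu, ← huv] at h2
    have h3 := fn_commutator 0 0 0 τ hu hv
    rw [mul_zero] at h3
    rw [← h3, hsub, hsub]
    linear_combination h1 - h2
  obtain ⟨rfl, rfl, hc⟩ := params_of_commBracket hcomm
  have hc' : c = 0 := by linear_combination 3 * hc
  subst hc'
  refine ⟨rfl, rfl, rfl, ?_⟩
  have h1 : ∀ t, g 0 0 0 t .wz0 = t • e 0 := fun t => by simp [g, gInv1]
  have h2 := fun t => (sum_barCochain_wz 0 0 0 t).trans (h1 t)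
  have h3 : ∑ i, arr (wLo i) * arr (zLo i) = 0 := by
    simpa [arr] using mk_eq QuiverRel.moment_wz0
  have hβ0 : β 0 = 0 := by simpa using hβ 0 0
  have hs : ∑ i, β (arr (wLo i) * arr (zLo i)) = 0 := by
    have := map_sum (AddMonoidHom.mk' β hβ) (fun i => arr (wLo i) * arr (zLo i)) Finset.univ
    rw [h3, map_zero] at this
    exact this.symm
  -- Summing the coboundary relation over the pairs (w_i, z^i) removes β(∑ w_i z^i) = 0. The two
  -- remaining terms vanish at the origin: the first contains w_i, the second the (0, 1) entry of
  -- β(w_i).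
  have h4 : t • e 0 = τ • e 0 +
      ∑ i, (arr (wLo i) * β (arr (zLo i)) + β (arr (wLo i)) * arr (zLo i)) := by
    rw [← h2, ← h2, ← Finset.sum_add_distrib,
      ← Finset.sum_congr rfl fun i _ => h (arr (wLo i)) (arr (zLo i)), Finset.sum_add_distrib,
      hs, add_zero]
  have h5 := congrArg (fun u => atOrigin u 0 0) h4
  have h6 : ∀ (A : Matrix (Fin 3) (Fin 3) ℂ) (i : Fin 3),
      (A * atOrigin (arr (zLo i))) 0 0 = A 0 1 * MvPolynomial.eval 0 (zChart i) := by
    intro A i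
    have : atOrigin (arr (zLo i)) = Matrix.single 1 0 (MvPolynomial.eval 0 (zChart i)) := by
      change (toChart (arr (zLo i))).map (MvPolynomial.eval 0) = _
      rw [toChart_arr, arrowMatrix, Matrix.map_single]
    rw [this, Matrix.mul_single_apply_same]
  have h7 : ∀ t : ℂ, atOrigin (t • e 0) 0 0 = t := by
    intro t
    change MvPolynomial.eval 0 (toChart (t • e 0) 0 0) = t
    rw [map_smul, toChart_e]
    simp
  simp only [h7, map_sum, map_add, map_mul, Matrix.sum_apply, Matrix.add_apply, h6,
    atOrigin_upper, atOrigin_arr_wLo, zero_mul, Matrix.zero_apply, add_zero,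
    Finset.sum_const_zero] at h5
  exact h5

/-! ### Functions on the complement of `z = 0` -/

-- The base will be the dual numbers, so domain arguments are not available. For a monomial d of f
-- with the largest exponent at a, the coefficient at d + a + b of the product sees only f · X_a
-- X_b, because q does not involve X_a.
open MvPolynomial in
theorem eq_zero_of_mul_eq_zero_of_degreeOf {σ R : Type*} [CommRing R] {a : σ} (b : σ)
    {q f : MvPolynomial σ R} (hq : degreeOf a q = 0) (h : f * (X a * X b + q) = 0) : f = 0 := by
  by_contra hf
  obtain ⟨d, hd, hmax⟩ := f.support.exists_max_image (fun d => d a) (support_nonempty.2 hf)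
  have h1 := congrArg (coeff (d + Finsupp.single b 1 + Finsupp.single a 1)) h
  rw [mul_add, mul_comm (X a), ← mul_assoc, coeff_add, coeff_mul_X, coeff_mul_X, coeff_zero] at h1
  have h2 : coeff (d + Finsupp.single b 1 + Finsupp.single a 1) (f * q) = 0 := by
    by_contra h3
    have h4 := monomial_le_degreeOf a (mem_support_iff.2 h3)
    have h5 := degreeOf_mul_le a f q
    have h6 : degreeOf a f ≤ d a := degreeOf_le_iff.2 hmax
    simp only [Finsupp.add_apply, Finsupp.single_eq_same] at h4
    omega
  rw [h2, add_zero] at h1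
  exact (mem_support_iff.1 hd) h1

section Vanish

open MvPolynomial

variable {σ R : Type*} [CommRing R]

theorem eq_zero_of_mul_X_eq_zero {a : σ} {f : MvPolynomial σ R} (h : f * X a = 0) : f = 0 := by
  ext d
  rw [← coeff_mul_X, h, coeff_zero, coeff_zero]

open Classical in
/-- The restriction of a polynomial to the hyperplane where a coordinate vanishes. -/
def vanish (a : σ) : MvPolynomial σ R →ₐ[R] MvPolynomial σ R :=
  aeval fun b => if b = a then 0 else X b

theorem vanish_X_self (a : σ) : vanish a (X a : MvPolynomial σ R) = 0 := by simp [vanish]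

theorem vanish_X {a b : σ} (h : b ≠ a) : vanish a (X b : MvPolynomial σ R) = X b := by
  simp [vanish, h]

@[simp]
theorem vanish_C (a : σ) (r : R) : vanish a (C r : MvPolynomial σ R) = C r :=
  aeval_C _ _

theorem X_dvd_sub_vanish (a : σ) (f : MvPolynomial σ R) : X a ∣ f - vanish a f := by
  induction f using MvPolynomial.induction_on with
  | C r => simp
  | add f h hf hh =>
    rw [map_add, add_sub_add_comm]
    exact dvd_add hf hh
  | mul_X f b hf =>
    rw [map_mul]
    by_cases hb : b = a
    · subst hb
      rw [vanish_X_self, mul_zero, sub_zero]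
      exact dvd_mul_left _ _
    · rw [vanish_X hb, ← sub_mul]
      exact dvd_mul_of_dvd_left hf _

theorem X_dvd_of_vanish {a : σ} {f : MvPolynomial σ R} (h : vanish a f = 0) : X a ∣ f := by
  simpa [h] using X_dvd_sub_vanish a f

end Vanish

section Family

open MvPolynomial

variable {k : Type} [CommRing k] (τ : k)

/-- The equation of the locus `w_i z^i = τ`. -/
def locusEq : MvPolynomial (Fin 3 ⊕ Fin 3) k :=
  (∑ i : Fin 3, X (Sum.inr i) * X (Sum.inl i)) - C τ

/-- The class of a polynomial on the locus `w_i z^i = τ`. -/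
def mkC : MvPolynomial (Fin 3 ⊕ Fin 3) k →+* Coord τ := Ideal.Quotient.mk _

theorem mkC_surjective : Function.Surjective (mkC τ) := Ideal.Quotient.mk_surjective

theorem mkC_eq_iff {f h : MvPolynomial (Fin 3 ⊕ Fin 3) k} :
    mkC τ f = mkC τ h ↔ ∃ r, f - h = r * locusEq τ := by
  refine Ideal.Quotient.eq.trans (Ideal.mem_span_singleton'.trans ?_)
  exact ⟨fun ⟨r, hr⟩ => ⟨r, hr.symm⟩, fun ⟨r, hr⟩ => ⟨r, hr.symm⟩⟩

theorem mkC_eq_zero_iff {f : MvPolynomial (Fin 3 ⊕ Fin 3) k} :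
    mkC τ f = 0 ↔ ∃ r, f = r * locusEq τ := by
  rw [← map_zero (mkC τ), mkC_eq_iff]
  simp

theorem mkC_X (c : Fin 3 ⊕ Fin 3) : mkC τ (X c) = Sum.elim (zc τ) (wc τ) c := by
  cases c <;> rfl

theorem vanish_locusEq (i : Fin 3) : vanish (Sum.inl i) (locusEq τ) =
    X (Sum.inr (i + 1)) * X (Sum.inl (i + 1)) +
      (X (Sum.inr (i + 2)) * X (Sum.inl (i + 2)) - C τ) := by
  fin_cases i <;>
    simp [locusEq, Fin.sum_univ_three, vanish_X, vanish_X_self] <;> ring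

theorem degreeOf_aux {c c₁ c₂ : Fin 3 ⊕ Fin 3} (h₁ : c ≠ c₁) (h₂ : c ≠ c₂) :
    degreeOf c (X c₁ * X c₂ - C τ : MvPolynomial (Fin 3 ⊕ Fin 3) k) = 0 := by
  have h := degreeOf_add_le c (X c₁ * X c₂ : MvPolynomial (Fin 3 ⊕ Fin 3) k) (C (-τ))
  have h' := degreeOf_mul_le c (X c₁ : MvPolynomial (Fin 3 ⊕ Fin 3) k) (X c₂)
  rw [degreeOf_X_of_ne h₁, degreeOf_X_of_ne h₂] at h'
  rw [degreeOf_C, C_neg, ← sub_eq_add_neg] at h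
  omega

theorem eq_zero_of_mul_vanish_locusEq {i : Fin 3} {f : MvPolynomial (Fin 3 ⊕ Fin 3) k}
    (h : f * vanish (Sum.inl i) (locusEq τ) = 0) : f = 0 := by
  rw [vanish_locusEq] at h
  refine eq_zero_of_mul_eq_zero_of_degreeOf _ (degreeOf_aux τ ?_ ?_) h
  · simp
  · simp

/-- The equation of the locus remains a nonzerodivisor on the hyperplane z^i = 0. So if f z^i is a
multiple p of the equation, p vanishes on that hyperplane, and z^i can be cancelled. -/
theorem zc_mul_cancel {i : Fin 3} {r : Coord τ} (h : r * zc τ i = 0) : r = 0 := by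
  obtain ⟨f, rfl⟩ := mkC_surjective τ r
  change mkC τ f * mkC τ (X (Sum.inl i)) = 0 at h
  rw [← map_mul, mkC_eq_zero_iff] at h
  obtain ⟨p, hp⟩ := h
  have h1 := congrArg (vanish (Sum.inl i)) hp
  rw [map_mul, map_mul, vanish_X_self, mul_zero] at h1
  obtain ⟨p', rfl⟩ := X_dvd_of_vanish (eq_zero_of_mul_vanish_locusEq τ h1.symm)
  rw [mkC_eq_zero_iff]
  refine ⟨p', sub_eq_zero.1 (eq_zero_of_mul_X_eq_zero (a := Sum.inl i) ?_)⟩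
  rw [sub_mul, hp]
  ring

theorem zc_mem_nonZeroDivisors (i : Fin 3) : zc τ i ∈ nonZeroDivisors (Coord τ) :=
  mem_nonZeroDivisors_iff_right.2 fun _ h => zc_mul_cancel τ h

/-- This says that z^1, z^2 is a regular sequence on the locus: on z^1 = z^2 = 0 the equation
becomes w_3 z^3 = τ, still given by a nonzerodivisor, so the multiplier t restricted to z^1 = 0 is
divisible by z^2. -/
theorem dvd_of_dvd_mul {r : Coord τ} (h : zc τ 0 ∣ r * zc τ 1) : zc τ 0 ∣ r := by
  obtain ⟨s, hs⟩ := h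
  obtain ⟨f, rfl⟩ := mkC_surjective τ r
  obtain ⟨p, rfl⟩ := mkC_surjective τ s
  change mkC τ f * mkC τ (X (Sum.inl 1)) = mkC τ (X (Sum.inl 0)) * mkC τ p at hs
  rw [← map_mul, ← map_mul, mkC_eq_iff] at hs
  obtain ⟨t, ht⟩ := hs
  have h1 := congrArg (vanish (Sum.inl 0)) ht
  rw [map_sub, map_mul, map_mul, map_mul, vanish_X_self, zero_mul, sub_zero,
    vanish_X (by simp)] at h1
  have h2 := congrArg (vanish (Sum.inl 1)) h1
  rw [map_mul, map_mul, vanish_X_self, mul_zero, vanish_locusEq] at h2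
  have h3 : vanish (Sum.inl 1) (vanish (Sum.inl 0) t) = 0 := by
    refine eq_zero_of_mul_eq_zero_of_degreeOf (a := Sum.inr (2 : Fin 3)) (Sum.inl 2)
      (q := - C τ) ?_ (Eq.trans ?_ h2.symm)
    · rw [← C_neg, degreeOf_C]
    · rw [map_add, map_sub, map_mul, map_mul, zero_add, vanish_X_self, vanish_X (by simp),
        vanish_X (by simp), vanish_X (b := Sum.inl (0 + 2)) (by simp), vanish_C, zero_add, mul_zero, zero_add, sub_eq_add_neg]
  obtain ⟨t', ht'⟩ := X_dvd_of_vanish h3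
  rw [ht', mul_comm (X _), mul_right_comm] at h1
  have h4 : vanish (Sum.inl 0) f = t' * vanish (Sum.inl 0) (locusEq τ) :=
    sub_eq_zero.1 (eq_zero_of_mul_X_eq_zero (a := Sum.inl 1) (by rw [sub_mul, h1, sub_self]))
  obtain ⟨q₁, h5⟩ := X_dvd_sub_vanish (Sum.inl 0) f
  obtain ⟨q₂, h6⟩ := X_dvd_sub_vanish (Sum.inl 0) (locusEq τ)
  refine ⟨mkC τ (q₁ - t' * q₂), ?_⟩
  change mkC τ f = mkC τ (X (Sum.inl 0)) * _
  rw [← map_mul, mkC_eq_iff]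
  exact ⟨t', by linear_combination h5 + h4 - t' * h6⟩

theorem pow_dvd_of_dvd_mul (N M : ℕ) {r : Coord τ} (h : zc τ 0 ^ N ∣ r * zc τ 1 ^ M) :
    zc τ 0 ^ N ∣ r := by
  have h1 : ∀ M {r : Coord τ}, zc τ 0 ∣ r * zc τ 1 ^ M → zc τ 0 ∣ r := by
    intro M
    induction M with
    | zero => intro r h; simpa using h
    | succ M ih =>
      intro r h
      rw [pow_succ, ← mul_assoc] at h
      exact ih (dvd_of_dvd_mul τ h)
  induction N generalizing r with
  | zero => simp
  | succ N ih =>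
    obtain ⟨r', rfl⟩ := h1 M ((dvd_pow_self _ N.succ_ne_zero).trans h)
    rw [pow_succ']
    refine mul_dvd_mul_left _ (ih ?_)
    obtain ⟨s, hs⟩ := h
    refine ⟨s, sub_eq_zero.1 (zc_mul_cancel τ (i := 0) ?_)⟩
    rw [sub_mul, sub_eq_zero, mul_right_comm, mul_comm r', hs, pow_succ]
    ring

theorem algebraMap_loc_injective (i : Fin 3) :
    Function.Injective (algebraMap (Coord τ) (Loc τ i)) :=
  IsLocalization.injective _ (Submonoid.powers_le.2 (zc_mem_nonZeroDivisors τ i))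

theorem algebraMap_loc₂_injective (i j : Fin 3) :
    Function.Injective (algebraMap (Coord τ) (Loc₂ τ i j)) :=
  IsLocalization.injective _ (Submonoid.powers_le.2
    (mul_mem (zc_mem_nonZeroDivisors τ i) (zc_mem_nonZeroDivisors τ j)))

theorem resLeft_algebraMap (i j : Fin 3) (r : Coord τ) :
    resLeft τ i j (algebraMap _ _ r) = algebraMap _ _ r := by
  simp [resLeft, IsLocalization.Away.awayToAwayRight_eq]

theorem resRight_algebraMap (i j : Fin 3) (r : Coord τ) :
    resRight τ i j (algebraMap _ _ r) = algebraMap _ _ r := by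
  simp [resRight, IsLocalization.Away.awayToAwayLeft_eq]

theorem eq_algebraMap_of_mul {i : Fin 3} {f : Loc τ i} {N : ℕ} {r : Coord τ}
    (h : f * algebraMap _ _ (zc τ i) ^ N = algebraMap _ _ (r * zc τ i ^ N)) :
    f = algebraMap _ _ r := by
  rw [map_mul, map_pow] at h
  exact ((IsLocalization.Away.algebraMap_isUnit (zc τ i)).pow N).mul_right_cancel h

/-- A function on the complement of `z = 0` extends to `V × V*`. -/
theorem algebraMap_functions_surjective (f : Functions τ) :
    ∃ r : Coord τ, f = algebraMap (Coord τ) (Functions τ) r := by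
  have key : ∀ i j, resLeft τ i j (f.1 i) = resRight τ i j (f.1 j) := f.2
  obtain ⟨N, r₀, h₀⟩ := IsLocalization.Away.surj (zc τ 0) (f.1 0)
  obtain ⟨M, r₁, h₁⟩ := IsLocalization.Away.surj (zc τ 1) (f.1 1)
  -- Clearing denominators in the agreement on the first overlap. By regularity the power of z^1
  -- divides r₀, so the function has no pole along z^1 = 0.
  have h2 : r₀ * zc τ 1 ^ M = r₁ * zc τ 0 ^ N := by
    apply algebraMap_loc₂_injective τ 0 1
    have e0 := congrArg (resLeft τ 0 1) h₀
    have e1 := congrArg (resRight τ 0 1) h₁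
    rw [map_mul, map_pow, resLeft_algebraMap, resLeft_algebraMap] at e0
    rw [map_mul, map_pow, resRight_algebraMap, resRight_algebraMap, ← key] at e1
    rw [map_mul, map_mul, map_pow, map_pow, ← e0, ← e1]
    ring
  obtain ⟨r, hr⟩ := pow_dvd_of_dvd_mul τ N M ⟨r₁, h2.trans (mul_comm _ _)⟩
  have h3 : f.1 0 = algebraMap _ _ r := by
    refine eq_algebraMap_of_mul τ (N := N) ?_
    rw [h₀, hr, mul_comm]
  refine ⟨r, Subtype.ext (funext fun i => ?_)⟩
  change f.1 i = algebraMap _ _ r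
  -- On every other open the function is forced by the overlap with the first one, as the locus
  -- algebra embeds into each localisation.
  obtain ⟨K, s, hs⟩ := IsLocalization.Away.surj (zc τ i) (f.1 i)
  refine eq_algebraMap_of_mul τ (N := K) ?_
  rw [hs]
  congr 1
  apply algebraMap_loc₂_injective τ 0 i
  have e := congrArg (resRight τ 0 i) hs
  rw [map_mul, map_pow, resRight_algebraMap, resRight_algebraMap, ← key, h3,
    resLeft_algebraMap] at e
  rw [← e, map_mul, map_pow]

theorem algebraMap_functions_apply (r : Coord τ) (i : Fin 3) :
    (algebraMap (Coord τ) (Functions τ) r).1 i = algebraMap (Coord τ) (Loc τ i) r := rfl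

theorem algebraMap_functions_injective :
    Function.Injective (algebraMap (Coord τ) (Functions τ)) := fun r s h =>
  algebraMap_loc_injective τ 0 (congrFun (congrArg Subtype.val h) 0)

/-- The weights of the coordinates. -/
abbrev coordWeight : Fin 3 ⊕ Fin 3 → ℤ := Sum.elim (fun _ => (1 : ℤ)) (fun _ => (-1 : ℤ))

section Graded

attribute [local instance] MvPolynomial.weightedGradedAlgebra

theorem weightedHomogeneousComponent_mul {σ : Type*} {w : σ → ℤ} (m : ℤ) {n : ℤ}
    (f : MvPolynomial σ k) {h : MvPolynomial σ k} (hh : IsWeightedHomogeneous w h n) :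
    weightedHomogeneousComponent w (m + n) (f * h) = weightedHomogeneousComponent w m f * h := by
  have := DirectSum.coe_decompose_mul_add_of_right_mem (i := m)
    (weightedHomogeneousSubmodule k w) (a := f) hh
  rw [← weightedDecomposition.decompose'_apply, ← weightedDecomposition.decompose'_apply]
  exact this

end Graded

theorem locusEq_homogeneous : IsWeightedHomogeneous coordWeight (locusEq τ) 0 := by
  refine IsWeightedHomogeneous.sub (IsWeightedHomogeneous.sum _ _ _ fun i _ => ?_)
    (isWeightedHomogeneous_C _ _)
  exact (isWeightedHomogeneous_X k coordWeight (Sum.inr i)).mul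
    (isWeightedHomogeneous_X k coordWeight (Sum.inl i))

theorem mem_weightPart_iff {n : ℤ} {r : Coord τ} :
    r ∈ weightPart τ n ↔ ∃ f, IsWeightedHomogeneous coordWeight f n ∧ mkC τ f = r := Iff.rfl

/-- The equation of the locus has weight 0, so taking homogeneous components respects the ideal. The
component of weight n of a representative therefore represents r, once the regular element z^i is
cancelled. -/
theorem mem_weightPart_of_mul {n : ℤ} {N : ℕ} {r : Coord τ} {i : Fin 3}
    (h : r * zc τ i ^ N ∈ weightPart τ (n + N)) : r ∈ weightPart τ n := by
  obtain ⟨s, hs, h⟩ := (mem_weightPart_iff τ).1 h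
  obtain ⟨f, rfl⟩ := mkC_surjective τ r
  change mkC τ s = mkC τ f * mkC τ (X (Sum.inl i)) ^ N at h
  rw [← map_pow, ← map_mul, mkC_eq_iff] at h
  obtain ⟨p, hp⟩ := h
  have hX : IsWeightedHomogeneous coordWeight
      ((X (Sum.inl i) : MvPolynomial (Fin 3 ⊕ Fin 3) k) ^ N) (N : ℤ) := by
    simpa using (isWeightedHomogeneous_X k coordWeight (Sum.inl i)).pow N
  have h1 := congrArg (weightedHomogeneousComponent coordWeight (n + N)) hp
  have h2 := weightedHomogeneousComponent_mul (n + N) p (locusEq_homogeneous τ)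
  rw [add_zero] at h2
  rw [map_sub, weightedHomogeneousComponent_mul n f hX, hs.weightedHomogeneousComponent_same,
    h2] at h1
  refine (mem_weightPart_iff τ).2 ⟨weightedHomogeneousComponent coordWeight n f,
    weightedHomogeneousComponent_isWeightedHomogeneous _ _, ?_⟩
  have h3 : mkC τ (weightedHomogeneousComponent coordWeight n f) * zc τ i ^ N =
      mkC τ f * zc τ i ^ N := by
    change mkC τ _ * mkC τ (X (Sum.inl i)) ^ N = mkC τ f * mkC τ (X (Sum.inl i)) ^ N
    rw [← map_pow, ← map_mul, ← map_mul, mkC_eq_iff]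
    exact ⟨p - weightedHomogeneousComponent coordWeight (n + N) p, by
      linear_combination hp - h1⟩
  exact (mul_cancel_right_mem_nonZeroDivisors (pow_mem (zc_mem_nonZeroDivisors τ i) N)).1 h3

theorem hasWeight_algebraMap_iff {n : ℤ} {r : Coord τ} :
    HasWeight τ n (algebraMap (Coord τ) (Functions τ) r) ↔ r ∈ weightPart τ n := by
  constructor
  · intro h
    obtain ⟨N, s, hs, h⟩ := h 0
    rw [algebraMap_functions_apply, ← map_mul] at h
    exact mem_weightPart_of_mul τ (i := 0) ((algebraMap_loc_injective τ 0 h).symm ▸ hs)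
  · intro h i
    exact ⟨0, r, by simpa using h, by rw [algebraMap_functions_apply, pow_zero, map_one, mul_one]⟩

/-- Matrices of functions on `V × V*` as matrices of functions away from `z = 0`. -/
def matIncl : Matrix (Fin 3) (Fin 3) (Coord τ) →+* Matrix (Fin 3) (Fin 3) (Functions τ) :=
  (algebraMap (Coord τ) (Functions τ)).mapMatrix

theorem matIncl_injective : Function.Injective (matIncl τ) :=
  Matrix.map_injective (algebraMap_functions_injective τ)

theorem matIncl_mem_iff {A : Matrix (Fin 3) (Fin 3) (Coord τ)} :
    matIncl τ A ∈ tiltingEnd τ ↔ ∀ p q : Fin 3, A p q ∈ weightPart τ ((p : ℤ) - (q : ℤ)) :=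
  forall_congr' fun _ => forall_congr' fun _ => hasWeight_algebraMap_iff τ

theorem exists_matIncl (A : Matrix (Fin 3) (Fin 3) (Functions τ)) : ∃ B, matIncl τ B = A := by
  choose B hB using fun p q => algebraMap_functions_surjective τ (A p q)
  exact ⟨Matrix.of B, Matrix.ext fun p q => (hB p q).symm⟩

/-- An element of the base ring as a scalar matrix. -/
def scalarMat : k →+* Matrix (Fin 3) (Fin 3) (Coord τ) :=
  (Matrix.scalar (Fin 3)).comp (algebraMap k (Coord τ))

theorem scalarMat_mul_apply (r : k) (A : Matrix (Fin 3) (Fin 3) (Coord τ)) (p q : Fin 3) :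
    (scalarMat τ r * A) p q = algebraMap k (Coord τ) r * A p q :=
  Matrix.diagonal_mul _ _ _ _

theorem mul_scalarMat (r : k) (A : Matrix (Fin 3) (Fin 3) (Coord τ)) :
    A * scalarMat τ r = scalarMat τ r * A :=
  (Matrix.scalar_commute _ (fun _ => Commute.all _ _) A).eq.symm

theorem scal_matIncl (r : k) (A : Matrix (Fin 3) (Fin 3) (Coord τ)) :
    scal τ r (matIncl τ A) = matIncl τ (scalarMat τ r * A) := by
  refine Matrix.ext fun p q => ?_
  change algebraMap k (Coord τ) r • algebraMap (Coord τ) (Functions τ) (A p q) =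
    algebraMap (Coord τ) (Functions τ) ((scalarMat τ r * A) p q)
  rw [scalarMat_mul_apply, map_mul, Algebra.smul_def]

end Family

/-! ### Equivalences of first order deformations -/

section Scal

variable {k : Type} [CommRing k] (τ : k)

theorem scal_add (r : k) (A B : Matrix (Fin 3) (Fin 3) (Functions τ)) :
    scal τ r (A + B) = scal τ r A + scal τ r B := by
  obtain ⟨A, rfl⟩ := exists_matIncl τ A
  obtain ⟨B, rfl⟩ := exists_matIncl τ B
  rw [← map_add, scal_matIncl, scal_matIncl, scal_matIncl, mul_add, map_add]

theorem scal_mul (r : k) (A B : Matrix (Fin 3) (Fin 3) (Functions τ)) :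
    scal τ r A * B = scal τ r (A * B) := by
  obtain ⟨A, rfl⟩ := exists_matIncl τ A
  obtain ⟨B, rfl⟩ := exists_matIncl τ B
  rw [← map_mul, scal_matIncl, scal_matIncl, ← map_mul, mul_assoc]

theorem mul_scal (r : k) (A B : Matrix (Fin 3) (Fin 3) (Functions τ)) :
    A * scal τ r B = scal τ r (A * B) := by
  obtain ⟨A, rfl⟩ := exists_matIncl τ A
  obtain ⟨B, rfl⟩ := exists_matIncl τ B
  rw [← map_mul, scal_matIncl, scal_matIncl, ← map_mul, ← mul_assoc, mul_scalarMat, mul_assoc]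

theorem scal_scal (r s : k) (A : Matrix (Fin 3) (Fin 3) (Functions τ)) :
    scal τ r (scal τ s A) = scal τ (r * s) A := by
  obtain ⟨A, rfl⟩ := exists_matIncl τ A
  rw [scal_matIncl, scal_matIncl, scal_matIncl, map_mul (scalarMat τ), mul_assoc]

theorem scal_zero_left (A : Matrix (Fin 3) (Fin 3) (Functions τ)) : scal τ 0 A = 0 := by
  obtain ⟨A, rfl⟩ := exists_matIncl τ A
  rw [scal_matIncl, map_zero, zero_mul, map_zero]

theorem add_scal_mem_tiltingEnd {A B : Matrix (Fin 3) (Fin 3) (Functions τ)}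
    (hA : A ∈ tiltingEnd τ) (r : k) (hB : B ∈ tiltingEnd τ) : A + scal τ r B ∈ tiltingEnd τ := by
  obtain ⟨A, rfl⟩ := exists_matIncl τ A
  obtain ⟨B, rfl⟩ := exists_matIncl τ B
  rw [matIncl_mem_iff] at hA hB
  rw [scal_matIncl, ← map_add, matIncl_mem_iff]
  intro p q
  refine add_mem (hA p q) ?_
  rw [scalarMat_mul_apply, ← Algebra.smul_def]
  exact Submodule.smul_mem _ r (hB p q)

end Scal

theorem ε_mul_ε : ε * ε = 0 := DualNumber.eps_mul_eps

/-- A linear endomorphism of `Λ` that respects products and fixes the idempotents and the arrows is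
the identity. -/
theorem eq_id_of_arr (α : Lam →ₗ[ℂ] Lam) (hmul : ∀ u v, α (u * v) = α u * α v)
    (he : ∀ a, α (e a) = e a) (harr : ∀ y, α (arr y) = arr y) : α = LinearMap.id := by
  refine irrBasis.ext fun t => ?_
  rw [irrBasis_apply, LinearMap.id_apply, irr, hmul, he]
  congr 1
  have h1 : α 1 = 1 := by rw [← sum_e, map_sum]; exact Finset.sum_congr rfl fun a _ => he a
  induction t.1.2.2 with
  | nil => exact h1
  | cons y u ih => rw [cls_cons, hmul, harr, ih]

/-- Two deformations of `Λ` that are isomorphic to the same algebra differ by a coboundary. -/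
theorem exists_coboundary_of_ring {K : Type*} [Ring K] (S : K → K) (c : ℂ → K → K)
    (hS : ∀ A B, S (A + B) = S A + S B) (hc : ∀ r A B, c r (A + B) = c r A + c r B)
    (hSS : ∀ A, S (S A) = 0) (hSc : ∀ r A, S (c r A) = c r (S A))
    (S_mul : ∀ A B, S A * B = S (A * B)) (mul_S : ∀ A B, A * S B = S (A * B))
    {m m' : Lam →ₗ[ℂ] Lam →ₗ[ℂ] Lam} (φ ψ : Lam →+ K)
    (φ_smul : ∀ r u, φ (r • u) = c r (φ u)) (ψ_smul : ∀ r u, ψ (r • u) = c r (ψ u))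
    (hφ : ∀ u, ∃ v w, φ u = ψ v + S (ψ w))
    (inj : ∀ {u v u' v'}, ψ u + S (ψ v) = ψ u' + S (ψ v') → u = u' ∧ v = v')
    (φ_mul : ∀ u v, φ u * φ v = φ (u * v) + S (φ (m u v)))
    (ψ_mul : ∀ u v, ψ u * ψ v = ψ (u * v) + S (ψ (m' u v)))
    (h_e : ∀ a, φ (e a) = ψ (e a)) (h_arr : ∀ y, S (φ (arr y)) = S (ψ (arr y))) :
    ∃ β : Lam → Lam, (∀ u v, β (u + v) = β u + β v) ∧
      ∀ u v, m u v + β (u * v) = m' u v + (u * β v + β u * v) := by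
  -- Write φ u = ψ(α u) + ε ψ(β u). Uniqueness of such a decomposition makes α an algebra map, and
  -- comparing the ε-parts of products makes β the cochain sought once α is the identity.
  choose α β hp using hφ
  have hS0 : S 0 = 0 := by simpa using hS 0 0
  have hadd : ∀ u v, α (u + v) = α u + α v ∧ β (u + v) = β u + β v := fun u v => inj <| by
    rw [← hp, map_add, hp, hp, map_add, map_add, hS]
    abel
  have hsmul : ∀ (r : ℂ) u, α (r • u) = r • α u ∧ β (r • u) = r • β u := fun r u => inj <| by
    rw [← hp, φ_smul, hp, ψ_smul, ψ_smul, hc, hSc]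
  have hε : ∀ u, S (φ u) = S (ψ (α u)) := fun u => by rw [hp, hS, hSS, add_zero]
  have hmul : ∀ u v, α (u * v) = α u * α v ∧
      β (u * v) + α (m u v) = m' (α u) (α v) + (α u * β v + β u * α v) := fun u v => inj <| by
    rw [map_add, hS, ← add_assoc, ← hp, ← hε, ← φ_mul, hp u, hp v, add_mul, mul_add, mul_add,
      S_mul, mul_S, S_mul, mul_S, hSS, add_zero, ψ_mul, ψ_mul, ψ_mul, hS,
      hS, hSS, hSS, add_zero, add_zero, map_add, map_add, hS, hS]
    abel
  have he : ∀ a, α (e a) = e a := fun a => by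
    refine (inj (v := β (e a)) (v' := 0) ?_).1
    rw [← hp, h_e, map_zero, hS0, add_zero]
  -- The arrows are known only modulo ε. After multiplication by ε the class α(y) appears as the
  -- ε-part of a decomposition, where it can be compared.
  have harr : ∀ y, α (arr y) = arr y := fun y => by
    refine (inj (u := 0) (u' := 0) ?_).2
    rw [← hε, h_arr]
  have hα : ∀ u, α u = u := LinearMap.congr_fun (eq_id_of_arr
    { toFun := α
      map_add' := fun u v => (hadd u v).1
      map_smul' := fun r u => (hsmul r u).1 } (fun u v => (hmul u v).1) he harr)
  refine ⟨β, fun u v => (hadd u v).2, fun u v => ?_⟩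
  have := (hmul u v).2
  rw [hα, hα, hα] at this
  rw [add_comm, this]

theorem exists_coboundary {m m' : Lam →ₗ[ℂ] Lam →ₗ[ℂ] Lam} {τ : ℂ} (h : IsKodairaSpencer m τ)
    (h' : IsKodairaSpencer m' τ) : ∃ β : Lam → Lam, (∀ u v, β (u + v) = β u + β v) ∧
      ∀ u v, m u v + β (u * v) = m' u v + (u * β v + β u * v) := by
  obtain ⟨φ, φ_smul, φ_mem, -, φ_mul, φ_e, φ_arr⟩ := h
  obtain ⟨ψ, ψ_smul, ψ_mem, ψ_unique, ψ_mul, ψ_e, ψ_arr⟩ := h'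
  have hSS : ∀ A, scal (τ • ε) ε (scal (τ • ε) ε A) = 0 := fun A => by
    rw [scal_scal, ε_mul_ε, scal_zero_left]
  refine exists_coboundary_of_ring (scal (τ • ε) ε)
    (fun r => scal (τ • ε) (algebraMap ℂ (DualNumber ℂ) r)) (scal_add _ _) (fun _ => scal_add _ _)
    hSS (fun r A => ?_) (scal_mul _ _) (mul_scal _ _) φ ψ φ_smul ψ_smul (fun u => ?_)
    (fun {u v u' v'} huv => ?_) (fun u v => φ_mul u v) (fun u v => ψ_mul u v) (fun a => ?_)
    (fun y => ?_)
  · rw [scal_scal, scal_scal, mul_comm]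
  · obtain ⟨⟨v, w⟩, hvw, -⟩ := ψ_unique (φ u) (φ_mem u)
    exact ⟨v, w, hvw⟩
  · have := (ψ_unique _ (add_scal_mem_tiltingEnd _ (ψ_mem u) ε (ψ_mem v))).unique
      (y₁ := (u, v)) (y₂ := (u', v')) rfl huv
    exact Prod.mk.inj this
  · rw [φ_e, ψ_e]
  · obtain ⟨Y, hY⟩ := φ_arr y
    obtain ⟨Y', hY'⟩ := ψ_arr y
    rw [hY, hY', scal_add, scal_add, hSS, hSS]

/-! ### The Kodaira–Spencer lift -/

/-- The product of the values of the coordinates along a word. -/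
def valWord {R : Type*} [CommRing R] (f : Fin 3 ⊕ Fin 3 → R) (u : List Arrow) : R :=
  (u.map fun y => f y.coord).prod

theorem map_valWord {R S : Type*} [CommRing R] [CommRing S] (F : R →+* S) (f : Fin 3 ⊕ Fin 3 → R)
    (u : List Arrow) : F (valWord f u) = valWord (fun c => F (f c)) u := by
  rw [valWord, map_list_prod, List.map_map]
  rfl

/-- The moment map `∑ w_i z^i`. -/
def moment {R : Type*} [CommRing R] (f : Fin 3 ⊕ Fin 3 → R) : R :=
  ∑ i, f (Sum.inr i) * f (Sum.inl i)

/-- The coordinates commute up to the moment map: `s - f_s` is a multiple of `∑ w_i z^i`. -/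
def TipMoment (s : List Arrow) : Prop :=
  ∃ p q : Fin 3, PathFrom p q s ∧ ∃ (n : ℂ) (v : List Arrow), PathFrom p q v ∧
    (∀ τ : ℂ, onTip (g 0 0 0 τ) s = (τ * n) • (e p * cls v)) ∧
    ∀ (R : Type) [CommRing R] [Algebra ℂ R] (f : Fin 3 ⊕ Fin 3 → R), valWord f s =
      ((replacement s).map fun r => (r.1 : ℂ) • valWord f r.2).sum +
        n • (moment f * valWord f v)

theorem g_ks (τ : ℂ) (r : T₂) : g 0 0 0 τ r = τ • gInv1 r := by simp [g]

theorem onComm_ks (τ : ℂ) (i j : Fin 3) : onComm (g 0 0 0 τ) i j = 0 := by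
  simp [onComm, g_ks, gInv1]

theorem tipMoment_of_zero {s : List Arrow} {p q : Fin 3} (hs : PathFrom p q s)
    (h : ∀ τ : ℂ, onTip (g 0 0 0 τ) s = 0)
    (h' : ∀ (R : Type) [CommRing R] [Algebra ℂ R] (f : Fin 3 ⊕ Fin 3 → R), valWord f s =
      ((replacement s).map fun r => (r.1 : ℂ) • valWord f r.2).sum) : TipMoment s :=
  ⟨p, q, hs, 0, s, hs, fun τ => by rw [h, mul_zero, zero_smul],
    fun R _ _ f => by rw [zero_smul, add_zero]; exact h' R f⟩

/-- For commuting coordinates most rules merely permute the factors, and their value under g is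
zero. The four rules that replace z^3 w_3 or w_3 z^3 at the level of pairs contribute the moment map
itself, with the trivial path left over; the two rules for w_3 w_k z^3 contribute it times w_k. -/
theorem tipMoment (s : List Arrow) (hs : IsTip s = true) : TipMoment s := by
  unfold IsTip rule at hs
  split at hs <;> (try split_ifs at hs) <;>
    simp only [Option.isSome_none, Option.isSome_some, Bool.false_eq_true] at hs
  · rename_i i j h
    refine tipMoment_of_zero (p := 2) (q := 0) ⟨rfl, rfl, rfl⟩ (fun τ => ?_) fun R _ _ f => ?_
    · simp [onTip, g_ks, gInv1]
    · simp [replacement, rule, h, valWord, coord, mul_comm]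
  · rename_i i j h
    refine tipMoment_of_zero (p := 0) (q := 2) ⟨rfl, rfl, rfl⟩ (fun τ => ?_) fun R _ _ f => ?_
    · simp [onTip, g_ks, gInv1]
    · simp [replacement, rule, h, valWord, coord, mul_comm]
  · rename_i h
    obtain ⟨rfl, rfl⟩ := h
    refine ⟨1, 1, ⟨rfl, rfl, rfl⟩, 1, [], rfl, fun τ => ?_, fun R _ _ f => ?_⟩
    · simp [onTip, onComm_ks, g_ks, gInv1, cls]
    · simp [replacement, rule, valWord, coord, moment, Fin.sum_univ_three]
      ring
  · rename_i i j h
    refine tipMoment_of_zero (p := 1) (q := 1) ⟨rfl, rfl, rfl⟩ (fun τ => ?_) fun R _ _ f => ?_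
    · rw [onTip, if_neg h, onComm_ks]
      exact neg_zero
    · simp [replacement, rule, h, valWord, coord, mul_comm]
  · rename_i h
    obtain ⟨rfl, rfl⟩ := h
    refine ⟨1, 1, ⟨rfl, rfl, rfl⟩, 1, [], rfl, fun τ => ?_, fun R _ _ f => ?_⟩
    · simp [onTip, g_ks, gInv1, cls]
    · simp [replacement, rule, valWord, coord, moment, Fin.sum_univ_three]
      ring
  · rename_i h
    obtain ⟨rfl, rfl⟩ := h
    refine ⟨2, 2, ⟨rfl, rfl, rfl⟩, 1, [], rfl, fun τ => ?_, fun R _ _ f => ?_⟩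
    · simp [onTip, g_ks, gInv1, cls]
    · simp [replacement, rule, valWord, coord, moment, Fin.sum_univ_three]
      ring
  · rename_i h
    obtain ⟨rfl, rfl⟩ := h
    refine ⟨0, 0, ⟨rfl, rfl, rfl⟩, 1, [], rfl, fun τ => ?_, fun R _ _ f => ?_⟩
    · simp [onTip, g_ks, gInv1, cls]
    · simp [replacement, rule, valWord, coord, moment, Fin.sum_univ_three]
      ring
  · rename_i i l j h
    refine tipMoment_of_zero (p := 1) (q := 2) ⟨rfl, rfl, rfl, rfl⟩ (fun τ => ?_)
      fun R _ _ f => ?_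
    · simp [onTip, onComm_ks, g_ks, gInv1]
    · rw [replacement, rule, if_pos h]
      simp [valWord, coord]
      ring
  · rename_i i l j h
    refine tipMoment_of_zero (p := 2) (q := 1) ⟨rfl, rfl, rfl, rfl⟩ (fun τ => ?_)
      fun R _ _ f => ?_
    · simp [onTip, onComm_ks, g_ks, gInv1]
    · rw [replacement, rule, if_pos h]
      simp [valWord, coord]
      ring
  · rename_i h l
    obtain ⟨rfl, rfl⟩ := h
    subst l
    refine ⟨0, 1, ⟨rfl, rfl, rfl, rfl⟩, 1, [wLo 0], ⟨rfl, rfl⟩, fun τ => ?_, fun R _ _ f => ?_⟩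
    · rw [e_mul_cls (p := 0) (q := 1) (u := [wLo 0]) ⟨rfl, rfl⟩ (by simp)]
      have : arr (wLo 0) * e 1 = arr (wLo 0) := arr_mul_e_src (wLo 0)
      simpa [onTip, g_ks, gInv1, cls] using congrArg (τ • ·) this
    · simp [replacement, rule, valWord, coord, moment, Fin.sum_univ_three]
      ring
  · rename_i h _ l
    obtain ⟨rfl, rfl⟩ := h
    subst l
    refine ⟨0, 1, ⟨rfl, rfl, rfl, rfl⟩, 1, [wLo 1], ⟨rfl, rfl⟩, fun τ => ?_, fun R _ _ f => ?_⟩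
    · rw [e_mul_cls (p := 0) (q := 1) (u := [wLo 1]) ⟨rfl, rfl⟩ (by simp)]
      have : arr (wLo 1) * e 1 = arr (wLo 1) := arr_mul_e_src (wLo 1)
      simpa [onTip, g_ks, gInv1, cls] using congrArg (τ • ·) this
    · simp [replacement, rule, valWord, coord, moment, Fin.sum_univ_three]
      ring

section Flat

variable {R : Type} [CommRing R] [Algebra ℂ R] (γ : T₂ → Lam) (f : Fin 3 ⊕ Fin 3 → R)

/-- Paths as matrices, if the moment map vanishes. -/
def flatLift (hf : moment f = 0) : Lift γ (Matrix (Fin 3) (Fin 3) R) where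
  E p := Matrix.single p p 1
  X y := Matrix.single y.tgt y.src (f y.coord)
  Δ := 0
  idem p q := by
    split_ifs with h
    · subst h; simp
    · simp [h]
  tgt y := by simp
  src y := by simp
  E_mul := by simp
  mul_E := by simp
  X_mul := by simp
  mul_X := by simp
  tip s hs := by
    obtain ⟨p, q, hp, n, v, hv, -, h⟩ := tipMoment s hs
    have h0 := ne_nil_of_isTip hs
    rw [prod_single (fun y => f y.coord) hp h0, prod_single_sum _ h0 hp, LinearMap.zero_apply,
      add_zero]
    have := h R f
    rw [hf, zero_mul, smul_zero, add_zero] at this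
    exact congrArg _ this

theorem flatLift_sec_mul (hf : moment f = 0) (u v : Lam) :
    (flatLift γ f hf).sec (u * v) = (flatLift γ f hf).sec u * (flatLift γ f hf).sec v := by
  rw [Lift.sec_mul]
  exact (add_zero _).symm

theorem flatLift_path (hf : moment f = 0) {p q : Fin 3} {u : List Arrow} (hu : PathFrom p q u) :
    (flatLift γ f hf).sec (e p * cls u) = Matrix.single p q (valWord f u) := by
  induction u generalizing p with
  | nil =>
    have : p = q := hu
    subst this
    rw [cls, List.map_nil, List.prod_nil, mul_one, Lift.sec_e]
    rfl
  | cons y u ih =>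
    obtain ⟨rfl, hu⟩ := hu
    rw [cls_cons, ← mul_assoc, e_tgt_mul_arr, ← arr_mul_e_src, mul_assoc, flatLift_sec_mul, ih hu,
      Lift.sec_arr]
    exact (Matrix.single_mul_single_same _ _ _ _ _).trans (by simp [valWord])

end Flat

section

variable (τ : ℂ)

/-- The dual number `ε` as a function on the locus `w_i z^i = τ ε`. -/
def epsC : Coord (τ • ε) := algebraMap (DualNumber ℂ) _ ε

/-- The coordinates on the locus `w_i z^i = τ ε`. -/
def coordVal : Fin 3 ⊕ Fin 3 → Coord (τ • ε) := Sum.elim (zc _) (wc _)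

theorem epsC_mul_epsC : epsC τ * epsC τ = 0 := by
  rw [epsC, ← map_mul, ε_mul_ε, map_zero]

theorem moment_coordVal : moment (coordVal τ) = τ • epsC τ := by
  have h : mkC (τ • ε) (locusEq (τ • ε)) = 0 := (mkC_eq_zero_iff _).2 ⟨1, (one_mul _).symm⟩
  rw [locusEq, map_sub, map_sum, sub_eq_zero] at h
  have h1 : moment (coordVal τ) = mkC (τ • ε) (MvPolynomial.C (τ • ε)) := by
    rw [← h]
    refine Finset.sum_congr rfl fun i _ => ?_
    rw [map_mul]
    rfl
  have h2 : mkC (τ • ε) (MvPolynomial.C (τ • ε)) =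
      algebraMap (DualNumber ℂ) (Coord (τ • ε)) (τ • ε) := rfl
  rw [h1, h2, Algebra.algebraMap_eq_smul_one, smul_assoc, ← Algebra.algebraMap_eq_smul_one, epsC]

/-- Functions modulo `ε`. -/
abbrev Reduced := Coord (τ • ε) ⧸ Ideal.span {epsC τ}

/-- Reduction modulo `ε`. -/
def red : Coord (τ • ε) →ₐ[ℂ] Reduced τ := Ideal.Quotient.mkₐ ℂ _

/-- Multiplication by `ε`. -/
def mulEps : Reduced τ →ₗ[ℂ] Coord (τ • ε) :=
  ((Ideal.span {epsC τ}).liftQ (LinearMap.mulRight (Coord (τ • ε)) (epsC τ)) (by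
    rw [Ideal.span_le, Set.singleton_subset_iff]
    exact epsC_mul_epsC τ)).restrictScalars ℂ

theorem mulEps_red (r : Coord (τ • ε)) : mulEps τ (red τ r) = r * epsC τ := rfl

theorem red_surjective : Function.Surjective (red τ) := Ideal.Quotient.mk_surjective

theorem mul_mulEps (r : Coord (τ • ε)) (s : Reduced τ) :
    r * mulEps τ s = mulEps τ (red τ r * s) := by
  obtain ⟨s, rfl⟩ := red_surjective τ s
  rw [← map_mul, mulEps_red, mulEps_red, mul_assoc]

theorem mul_map_mulEps (A : Matrix (Fin 3) (Fin 3) (Coord (τ • ε)))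
    (B : Matrix (Fin 3) (Fin 3) (Reduced τ)) :
    A * B.map (mulEps τ) = (A.map (red τ) * B).map (mulEps τ) := by
  refine Matrix.ext fun i j => ?_
  simp only [Matrix.mul_apply, Matrix.map_apply, map_sum, mul_mulEps]

theorem map_mulEps_mul (A : Matrix (Fin 3) (Fin 3) (Coord (τ • ε)))
    (B : Matrix (Fin 3) (Fin 3) (Reduced τ)) :
    B.map (mulEps τ) * A = (B * A.map (red τ)).map (mulEps τ) := by
  refine Matrix.ext fun i j => ?_
  simp only [Matrix.mul_apply, Matrix.map_apply, map_sum, mul_comm _ (A _ _), mul_mulEps,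
    mul_comm _ (red τ _)]

theorem moment_red : moment (fun c => red τ (coordVal τ c)) = 0 := by
  have h := congrArg (red τ) (moment_coordVal τ)
  rw [moment, map_sum, map_smul (red τ) τ (epsC τ)] at h
  have h1 : red τ (epsC τ) = 0 := Ideal.Quotient.eq_zero_iff_mem.2 (Ideal.mem_span_singleton_self _)
  rw [h1, smul_zero] at h
  exact Eq.trans (Finset.sum_congr rfl fun i _ => (map_mul (red τ) _ _).symm) h

theorem red_valWord (u : List Arrow) :
    valWord (fun c => red τ (coordVal τ c)) u = red τ (valWord (coordVal τ) u) := by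
  rw [valWord, valWord, map_list_prod, List.map_map]
  rfl

/-- Elements of `Λ` as matrices of functions modulo `ε`. -/
def redLift : Lift (g 0 0 0 τ) (Matrix (Fin 3) (Fin 3) (Reduced τ)) :=
  flatLift _ _ (moment_red τ)

/-- Matrices of functions on the locus `w_i z^i = τ ε`, as a lift of the quiver relations. -/
def coordLift : Lift (g 0 0 0 τ) (Matrix (Fin 3) (Fin 3) (Coord (τ • ε))) where
  E p := Matrix.single p p 1
  X y := Matrix.single y.tgt y.src (coordVal τ y.coord)
  -- The section of Λ is multiplicative only modulo ε. Passing through functions modulo ε and then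
  -- multiplying by ε gives a genuine bimodule map.
  Δ := ((mulEps τ).mapMatrix (m := Fin 3) (n := Fin 3)) ∘ₗ (redLift τ).sec
  idem p q := by
    split_ifs with h
    · subst h; simp
    · simp [h]
  tgt y := by simp
  src y := by simp
  E_mul p v := by
    refine (mul_map_mulEps τ _ ((redLift τ).sec v)).trans ?_
    have : (redLift τ).sec (e p) = Matrix.single p p 1 := (redLift τ).sec_e p
    rw [Matrix.map_single, map_one, ← this, redLift, ← flatLift_sec_mul]
    rfl
  mul_E p v := by
    refine (map_mulEps_mul τ _ ((redLift τ).sec v)).trans ?_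
    have : (redLift τ).sec (e p) = Matrix.single p p 1 := (redLift τ).sec_e p
    rw [Matrix.map_single, map_one, ← this, redLift, ← flatLift_sec_mul]
    rfl
  X_mul y v := by
    refine (mul_map_mulEps τ _ ((redLift τ).sec v)).trans ?_
    have : (redLift τ).sec (arr y) = Matrix.single y.tgt y.src (red τ (coordVal τ y.coord)) :=
      (redLift τ).sec_arr y
    rw [Matrix.map_single, ← this, redLift, ← flatLift_sec_mul]
    rfl
  mul_X y v := by
    refine (map_mulEps_mul τ _ ((redLift τ).sec v)).trans ?_
    have : (redLift τ).sec (arr y) = Matrix.single y.tgt y.src (red τ (coordVal τ y.coord)) :=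
      (redLift τ).sec_arr y
    rw [Matrix.map_single, ← this, redLift, ← flatLift_sec_mul]
    rfl
  tip s hs := by
    obtain ⟨p, q, hp, n, v, hv, h, h'⟩ := tipMoment s hs
    have h0 := ne_nil_of_isTip hs
    have h1 := h' _ (coordVal τ)
    rw [prod_single (fun y => coordVal τ y.coord) hp h0, prod_single_sum _ h0 hp, h,
      LinearMap.comp_apply, map_smul (redLift τ).sec (τ * n) (e p * cls v),
      map_smul ((mulEps τ).mapMatrix (m := Fin 3) (n := Fin 3)) (τ * n)
        ((redLift τ).sec (e p * cls v)), redLift, flatLift_path _ _ _ hv,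
      LinearMap.mapMatrix_apply, Matrix.map_single, Matrix.smul_single, ← Matrix.single_add,
      red_valWord, mulEps_red]
    refine congrArg _ (h1.trans (congrArg _ ?_))
    rw [ moment_coordVal, smul_mul_assoc, smul_smul, mul_comm n, mul_comm (epsC τ)]

end

/-! ### Functions of weight p - q as combinations of paths -/

theorem single_mul_prod {R : Type*} [CommRing R] (f : Fin 3 ⊕ Fin 3 → R) {p q : Fin 3}
    {u : List Arrow} (hu : PathFrom p q u) :
    Matrix.single p p 1 * (u.map fun y => Matrix.single y.tgt y.src (f y.coord)).prod =
      Matrix.single p q (valWord f u) := by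
  by_cases h : u = []
  · subst h
    have : p = q := hu
    subst this
    exact mul_one _
  · rw [prod_single (fun y => f y.coord) hu h, Matrix.single_mul_single_same, one_mul]
    rfl

open MvPolynomial in
theorem isWeightedHomogeneous_valWord {k : Type} [CommRing k] {p q : Fin 3} {u : List Arrow}
    (hu : PathFrom p q u) :
    IsWeightedHomogeneous coordWeight (valWord (X : _ → MvPolynomial (Fin 3 ⊕ Fin 3) k) u)
      ((p : ℤ) - (q : ℤ)) := by
  induction u generalizing p with
  | nil =>
    have : p = q := hu
    rw [this, sub_self]
    exact isWeightedHomogeneous_one _ _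
  | cons y u ih =>
    obtain ⟨rfl, hu⟩ := hu
    have h := (isWeightedHomogeneous_X k coordWeight y.coord).mul (ih hu)
    have hw : coordWeight y.coord + ((y.src : ℤ) - (q : ℤ)) = (y.tgt : ℤ) - (q : ℤ) := by
      cases y <;> simp [coord, Arrow.src, Arrow.tgt] <;> ring
    rw [hw] at h
    exact h

theorem weight_coordWeight (d : Fin 3 ⊕ Fin 3 →₀ ℕ) : Finsupp.weight coordWeight d =
    (d (Sum.inl 0) : ℤ) + d (Sum.inl 1) + d (Sum.inl 2)
      - (d (Sum.inr 0) + d (Sum.inr 1) + d (Sum.inr 2)) := by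
  rw [Finsupp.weight_apply, Finsupp.sum_fintype _ _ (by simp), Fintype.sum_sum_type,
    Fin.sum_univ_three, Fin.sum_univ_three]
  simp
  ring

/-- An arrow that ends at `p`, whose coordinate occurs in a monomial of weight `p - q`. -/
theorem exists_arrow {d : Fin 3 ⊕ Fin 3 →₀ ℕ} (hd : d ≠ 0) {p q : Fin 3}
    (h : Finsupp.weight coordWeight d = (p : ℤ) - (q : ℤ)) :
    ∃ y : Arrow, y.tgt = p ∧ d y.coord ≠ 0 := by
  rw [weight_coordWeight] at h
  -- If no letter ending at p occurs in d: for p = 1 nothing is left; for p = 0 only z's are left,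
  -- of weight -q ≤ 0; for p = 2 only w's are left, of weight 2 - q ≥ 0. In each case d = 0.
  by_contra! hy
  have hz : ∀ i, (p : ℕ) = 1 ∨ (p : ℕ) = 2 → d (Sum.inl i) = 0 := by
    rintro i (hp | hp)
    · exact hy (zLo i) (Fin.ext hp.symm)
    · exact hy (zHi i) (Fin.ext hp.symm)
  have hw : ∀ i, (p : ℕ) = 0 ∨ (p : ℕ) = 1 → d (Sum.inr i) = 0 := by
    rintro i (hp | hp)
    · exact hy (wLo i) (Fin.ext hp.symm)
    · exact hy (wHi i) (Fin.ext hp.symm)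
  have hp := p.2
  have hq := q.2
  apply hd
  ext c
  have h0 := hz 0
  have h1 := hz 1
  have h2 := hz 2
  have h3 := hw 0
  have h4 := hw 1
  have h5 := hw 2
  rcases c with i | i <;> fin_cases i <;>
    simp only [Fin.zero_eta, Fin.mk_one, Fin.reduceFinMk, Finsupp.coe_zero, Pi.zero_apply] <;> omega

open MvPolynomial in
/-- Each monomial of weight `p - q` is the value of a path from `q` to `p`. -/
theorem exists_path_of_monomial {k : Type} [CommRing k] (q : Fin 3) (N : ℕ) :
    ∀ (p : Fin 3) (d : Fin 3 ⊕ Fin 3 →₀ ℕ), d.degree = N →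
      Finsupp.weight coordWeight d = (p : ℤ) - (q : ℤ) →
      ∃ u, PathFrom p q u ∧ valWord X u = (monomial d 1 : MvPolynomial (Fin 3 ⊕ Fin 3) k) := by
  induction N with
  | zero =>
    intro p d hN hd
    rw [Finsupp.degree_eq_zero_iff] at hN
    subst hN
    rw [map_zero] at hd
    have hp := p.2
    have : p = q := Fin.ext (by omega)
    subst this
    exact ⟨[], rfl, rfl⟩
  | succ N ih =>
    intro p d hN hd
    obtain ⟨y, rfl, hy⟩ := exists_arrow (fun h => by simp [h] at hN) hd
    obtain ⟨d', rfl⟩ : ∃ d', d = d' + Finsupp.single y.coord 1 :=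
      ⟨d - Finsupp.single y.coord 1,
        (tsub_add_cancel_of_le (Finsupp.single_le_iff.2 (Nat.one_le_iff_ne_zero.2 hy))).symm⟩
    rw [map_add, Finsupp.degree_single] at hN
    rw [map_add, Finsupp.weight_single, one_smul] at hd
    have hw : coordWeight y.coord = (y.tgt : ℤ) - (y.src : ℤ) := by
      cases y <;> simp [coord, Arrow.src, Arrow.tgt]
    obtain ⟨u, hu, hu'⟩ := ih y.src d' (by omega) (by omega)
    refine ⟨y :: u, ⟨rfl, hu⟩, ?_⟩
    change X y.coord * valWord X u = _
    rw [hu', mul_comm, X, monomial_mul, one_mul]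

section

variable (τ : ℂ)

theorem valWord_coordVal (u : List Arrow) :
    valWord (coordVal τ) u = mkC (τ • ε) (valWord MvPolynomial.X u) := by
  rw [map_valWord]
  congr 1
  funext c
  exact (mkC_X _ c).symm

theorem coordLift_irr (t : IrrPath) : (coordLift τ).sec (irr t) =
    Matrix.single t.1.1 t.1.2.1 (valWord (coordVal τ) t.1.2.2) :=
  ((coordLift τ).sec_irr t).trans (single_mul_prod (coordVal τ) t.2.1)

theorem redLift_sec (u : Lam) : (redLift τ).sec u = ((coordLift τ).sec u).map (red τ) := by
  suffices h : (redLift τ).sec =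
      (red τ).toLinearMap.mapMatrix (m := Fin 3) (n := Fin 3) ∘ₗ (coordLift τ).sec from
    LinearMap.congr_fun h u
  refine irrBasis.ext fun t => ?_
  rw [irrBasis_apply, LinearMap.comp_apply, coordLift_irr]
  refine (flatLift_path _ _ (moment_red τ) t.2.1).trans ?_
  rw [red_valWord]
  exact (Matrix.map_single _ _ _ (red τ).toLinearMap).symm

theorem coordLift_Δ (u : Lam) :
    (coordLift τ).Δ u = scalarMat (τ • ε) ε * (coordLift τ).sec u := by
  refine Matrix.ext fun i j => ?_
  change mulEps τ ((redLift τ).sec u i j) = _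
  rw [redLift_sec, scalarMat_mul_apply, mul_comm]
  exact mulEps_red τ _

theorem coordLift_mem_weightPart (u : Lam) (p q : Fin 3) :
    (coordLift τ).sec u p q ∈ weightPart (τ • ε) ((p : ℤ) - (q : ℤ)) := by
  have hu : u ∈ Submodule.span ℂ (Set.range irr) := span_irr ▸ Submodule.mem_top
  induction hu using Submodule.span_induction with
  | mem v hv =>
    obtain ⟨t, rfl⟩ := hv
    rw [coordLift_irr, Matrix.single_apply]
    split_ifs with h
    · obtain ⟨rfl, rfl⟩ := h
      exact (mem_weightPart_iff _).2
        ⟨_, isWeightedHomogeneous_valWord t.2.1, (valWord_coordVal τ _).symm⟩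
    · exact zero_mem _
  | zero => rw [map_zero]; exact zero_mem _
  | add u v _ _ hu hv => rw [map_add]; exact add_mem hu hv
  | smul r v _ hv =>
    rw [map_smul (coordLift τ).sec r v]
    have := Submodule.smul_mem _ (algebraMap ℂ (DualNumber ℂ) r) hv
    rwa [algebraMap_smul] at this

theorem scalarMat_algebraMap_mul (r : ℂ) (A : Matrix (Fin 3) (Fin 3) (Coord (τ • ε))) :
    scalarMat (τ • ε) (algebraMap ℂ (DualNumber ℂ) r) * A = r • A := by
  refine Matrix.ext fun i j => ?_
  rw [scalarMat_mul_apply, ← Algebra.smul_def, algebraMap_smul]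
  rfl

/-- The matrices that the deformation of `Λ` reaches. -/
def reached : AddSubgroup (Matrix (Fin 3) (Fin 3) (Coord (τ • ε))) :=
  ((coordLift τ).sec.toAddMonoidHom.coprod
    ((AddMonoidHom.mulLeft (scalarMat (τ • ε) ε)).comp (coordLift τ).sec.toAddMonoidHom)).range

theorem mem_reached {A : Matrix (Fin 3) (Fin 3) (Coord (τ • ε))} : A ∈ reached τ ↔
    ∃ u v, (coordLift τ).sec u + scalarMat (τ • ε) ε * (coordLift τ).sec v = A :=
  ⟨fun ⟨p, hp⟩ => ⟨p.1, p.2, hp⟩, fun ⟨u, v, h⟩ => ⟨(u, v), h⟩⟩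

/-- As ε² = 0, the pairs u + ε v are stable under multiplication by x + y ε, so a sum of monomials
with dual number coefficients can be treated term by term. -/
theorem scalarMat_mul_mem_reached (r : DualNumber ℂ) {A : Matrix (Fin 3) (Fin 3) (Coord (τ • ε))}
    (hA : A ∈ reached τ) : scalarMat (τ • ε) r * A ∈ reached τ := by
  obtain ⟨u, v, rfl⟩ := (mem_reached τ).1 hA
  obtain ⟨x, y, rfl⟩ : ∃ x y : ℂ,
      r = algebraMap ℂ (DualNumber ℂ) x + algebraMap ℂ (DualNumber ℂ) y * ε :=
    ⟨r.fst, r.snd, by ext <;> simp [ε, Algebra.algebraMap_eq_smul_one]⟩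
  have hε : scalarMat (τ • ε) ε * scalarMat (τ • ε) ε = 0 := by
    rw [← map_mul, ε_mul_ε, map_zero]
  refine (mem_reached τ).2 ⟨x • u, x • v + y • u, ?_⟩
  rw [map_add (scalarMat (τ • ε)), map_mul (scalarMat (τ • ε)), map_add,
    map_smul (coordLift τ).sec, map_smul (coordLift τ).sec, map_smul (coordLift τ).sec,
    ← scalarMat_algebraMap_mul, ← scalarMat_algebraMap_mul, ← scalarMat_algebraMap_mul]
  set a := scalarMat (τ • ε) (algebraMap ℂ (DualNumber ℂ) x)
  set b := scalarMat (τ • ε) (algebraMap ℂ (DualNumber ℂ) y)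
  set η := scalarMat (τ • ε) ε
  have ha : η * a = a * η := mul_scalarMat _ _ _
  have hb : η * b = b * η := mul_scalarMat _ _ _
  rw [mul_add, ← mul_assoc, ← mul_assoc, ha, hb, add_mul, mul_add, mul_add, mul_assoc b η (η * _),
    ← mul_assoc η η, hε, zero_mul, mul_zero, add_zero, ← mul_assoc]
  abel

/-- The path need not be irreducible: right reduction in `coordLift` writes its value as a section
plus ε times a section. -/
theorem single_mem_reached {p q : Fin 3} {u : List Arrow} (hu : PathFrom p q u) :
    Matrix.single p q (valWord (coordVal τ) u) ∈ reached τ := by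
  rw [← single_mul_prod (coordVal τ) hu]
  by_cases h : u = []
  · subst h
    refine (mem_reached τ).2 ⟨e p, 0, ?_⟩
    rw [map_zero, mul_zero, add_zero, Lift.sec_e]
    exact (mul_one _).symm
  · have h1 := (coordLift τ).E_mul_word_self hu h
    rw [(coordLift τ).word_eq_sec hu h, coordLift_Δ] at h1
    refine (mem_reached τ).2 ⟨_, _, h1.symm.trans ?_⟩
    rw [← coordLift_Δ, ← (coordLift τ).word_eq_sec hu h]
    rfl

theorem mem_reached_of_weight {A : Matrix (Fin 3) (Fin 3) (Coord (τ • ε))}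
    (hA : ∀ p q : Fin 3, A p q ∈ weightPart (τ • ε) ((p : ℤ) - (q : ℤ))) : A ∈ reached τ := by
  rw [Matrix.matrix_eq_sum_single A]
  refine sum_mem fun p _ => sum_mem fun q _ => ?_
  obtain ⟨f, hf, h⟩ := (mem_weightPart_iff _).1 (hA p q)
  rw [← h, f.as_sum, map_sum]
  have hs : ∀ (s : Finset (Fin 3 ⊕ Fin 3 →₀ ℕ)) (F : _ → Coord (τ • ε)),
      Matrix.single p q (∑ d ∈ s, F d) = ∑ d ∈ s, Matrix.single p q (F d) := fun s F =>
    map_sum (Matrix.singleAddMonoidHom (α := Coord (τ • ε)) p q) F s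
  rw [hs]
  refine sum_mem fun d hd => ?_
  obtain ⟨u, hu, hu'⟩ := exists_path_of_monomial (k := DualNumber ℂ) q _ p d rfl
    (hf (MvPolynomial.mem_support_iff.1 hd))
  have h1 : Matrix.single p q (mkC (τ • ε) (MvPolynomial.monomial d (f.coeff d))) =
      scalarMat (τ • ε) (f.coeff d) * Matrix.single p q (valWord (coordVal τ) u) := by
    refine Matrix.ext fun i j => ?_
    rw [scalarMat_mul_apply, Matrix.single_apply, Matrix.single_apply]
    split_ifs
    · rw [valWord_coordVal, hu', ← mul_one (f.coeff d), ← MvPolynomial.C_mul_monomial, mul_one,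
        map_mul]
      rfl
    · rw [mul_zero]
  rw [h1]
  exact scalarMat_mul_mem_reached τ _ (single_mem_reached τ hu)

end

/-! ### Restriction to the chart and uniqueness of the decomposition -/

section

variable (τ : ℂ)

/-- Dual numbers over `ℂ` as constant functions in the chart. -/
def dualC : DualNumber ℂ →+* DualNumber Chart where
  toFun r := .inl (MvPolynomial.C r.fst) + .inr (MvPolynomial.C r.snd)
  map_one' := by refine TrivSqZeroExt.ext ?_ ?_ <;> simp
  map_zero' := by refine TrivSqZeroExt.ext ?_ ?_ <;> simp
  map_add' r s := by refine TrivSqZeroExt.ext ?_ ?_ <;> simp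
  map_mul' r s := by refine TrivSqZeroExt.ext ?_ ?_ <;> simp

theorem dualC_fst (r : DualNumber ℂ) : (dualC r).fst = MvPolynomial.C r.fst := by simp [dualC]

theorem dualC_snd (r : DualNumber ℂ) : (dualC r).snd = MvPolynomial.C r.snd := by simp [dualC]

/-- The coordinates on the chart `z^3 = 1` of the locus `w_i z^i = τ ε`. -/
def dualVal (c : Fin 3 ⊕ Fin 3) : DualNumber Chart :=
  .inl (chartVal c) + .inr (if c = Sum.inr 2 then MvPolynomial.C τ else 0)

/-- Restriction to the chart of functions on the locus `w_i z^i = τ ε`. -/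
def toDual : Coord (τ • ε) →+* DualNumber Chart :=
  Ideal.Quotient.lift _ (MvPolynomial.eval₂Hom dualC (dualVal τ)) (by
    intro f hf
    rw [← RingHom.mem_ker]
    revert f
    change Ideal.span _ ≤ _
    rw [Ideal.span_le, Set.singleton_subset_iff, SetLike.mem_coe, RingHom.mem_ker]
    -- Since z^3 = 1, shifting w_3 by τε turns the chart identity ∑ w_i z^i = 0 into the equation of
    -- the deformed locus.
    rw [map_sub, map_sum]
    simp only [map_mul, MvPolynomial.eval₂Hom_X', MvPolynomial.eval₂Hom_C]
    refine TrivSqZeroExt.ext ?_ ?_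
    · simp [Fin.sum_univ_three, dualVal, dualC_fst, chartVal, ε, zChart, wChart]
    · simp [Fin.sum_univ_three, dualVal, dualC_snd, chartVal, ε, zChart, wChart])

theorem toDual_algebraMap (r : DualNumber ℂ) :
    toDual τ (algebraMap (DualNumber ℂ) (Coord (τ • ε)) r) = dualC r :=
  MvPolynomial.eval₂Hom_C _ _ r

theorem toDual_coordVal (c : Fin 3 ⊕ Fin 3) : toDual τ (coordVal τ c) = dualVal τ c := by
  cases c <;> exact MvPolynomial.eval₂Hom_X' _ _ _

theorem toDual_eps_mul (r : Coord (τ • ε)) :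
    (toDual τ (algebraMap (DualNumber ℂ) (Coord (τ • ε)) ε * r)).fst = 0 ∧
      (toDual τ (algebraMap (DualNumber ℂ) (Coord (τ • ε)) ε * r)).snd = (toDual τ r).fst := by
  rw [map_mul, toDual_algebraMap]
  have h : dualC ε = DualNumber.eps := by
    refine TrivSqZeroExt.ext ?_ ?_
    · simp [dualC_fst, ε]
    · simp [dualC_snd, ε]
  rw [h]
  constructor <;> simp

theorem toDual_sec_fst (u : Lam) (p q : Fin 3) :
    (toDual τ ((coordLift τ).sec u p q)).fst = toChart u p q := by
  have hu : u ∈ Submodule.span ℂ (Set.range irr) := span_irr ▸ Submodule.mem_top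
  induction hu using Submodule.span_induction with
  | mem v hv =>
    obtain ⟨t, rfl⟩ := hv
    rw [coordLift_irr, toChart_irr, Matrix.single_apply, Matrix.single_apply]
    split_ifs
    · rw [map_valWord, ← TrivSqZeroExt.fstHom_apply (R := Chart) (M := Chart) (S := ℂ)]
      change (TrivSqZeroExt.fstHom ℂ Chart Chart).toRingHom _ = _
      rw [map_valWord]
      have : ∀ c, (TrivSqZeroExt.fstHom ℂ Chart Chart).toRingHom (dualVal τ c) = chartVal c :=
        fun c => by
          change (dualVal τ c).fst = _
          rw [dualVal, TrivSqZeroExt.fst_add, TrivSqZeroExt.fst_inl, TrivSqZeroExt.fst_inr, add_zero]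
      simp only [toDual_coordVal, this]
      rfl
    · rw [map_zero]; rfl
  | zero => rw [map_zero, map_zero]; exact congrArg TrivSqZeroExt.fst (map_zero (toDual τ))
  | add u v _ _ hu hv =>
    rw [map_add, map_add, Matrix.add_apply, Matrix.add_apply, map_add, TrivSqZeroExt.fst_add,
      hu, hv]
  | smul r v _ hv =>
    rw [map_smul (coordLift τ).sec r v, ← scalarMat_algebraMap_mul, scalarMat_mul_apply, map_mul,
      toDual_algebraMap, TrivSqZeroExt.fst_mul, hv, map_smul, Matrix.smul_apply,
      MvPolynomial.smul_eq_C_mul, dualC_fst]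
    rfl

/-- Restricted to the chart, the part free of ε is the embedding of Λ, which determines u; after
subtraction the coefficient of ε determines v in the same way. This is flatness of the deformation.
-/
theorem sec_add_eps_injective {u v u' v' : Lam}
    (h : (coordLift τ).sec u + scalarMat (τ • ε) ε * (coordLift τ).sec v =
      (coordLift τ).sec u' + scalarMat (τ • ε) ε * (coordLift τ).sec v') : u = u' ∧ v = v' := by
  have h1 : u = u' := by
    refine toChart_injective (Matrix.ext fun p q => ?_)
    have := congrArg (fun A => (toDual τ (A p q)).fst) h
    simpa only [Matrix.add_apply, map_add, TrivSqZeroExt.fst_add, scalarMat_mul_apply,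
      (toDual_eps_mul τ _).1, add_zero, toDual_sec_fst] using this
  subst h1
  refine ⟨rfl, toChart_injective (Matrix.ext fun p q => ?_)⟩
  have := congrArg (fun A => (toDual τ (A p q)).snd) (add_left_cancel h)
  simpa only [scalarMat_mul_apply, (toDual_eps_mul τ _).2, toDual_sec_fst] using this

/-- Elements of `Λ` as endomorphisms of `O ⊕ O(1) ⊕ O(2)` on the deformation. -/
def deformed : Lam →+ Matrix (Fin 3) (Fin 3) (Functions (τ • ε)) :=
  (matIncl (τ • ε)).toAddMonoidHom.comp (coordLift τ).sec.toAddMonoidHom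

theorem deformed_apply (u : Lam) : deformed τ u = matIncl (τ • ε) ((coordLift τ).sec u) := rfl

theorem deformed_add_scal (u v : Lam) : deformed τ u + scal (τ • ε) ε (deformed τ v) =
    matIncl (τ • ε) ((coordLift τ).sec u + scalarMat (τ • ε) ε * (coordLift τ).sec v) := by
  rw [deformed_apply, deformed_apply, scal_matIncl, map_add (matIncl (τ • ε))]

theorem deformed_mul (u v : Lam) : deformed τ u * deformed τ v =
    deformed τ (u * v) + scal (τ • ε) ε (deformed τ (barCochain (g 0 0 0 τ) u v)) := by
  rw [deformed_add_scal, deformed_apply, deformed_apply, ← map_mul (matIncl (τ • ε)),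
    Lift.sec_mul, coordLift_Δ]

theorem deformed_e (a : Fin 3) : deformed τ (e a) = Matrix.single a a 1 := by
  rw [deformed_apply, Lift.sec_e]
  refine (Matrix.map_single _ _ _ (algebraMap (Coord (τ • ε)) (Functions (τ • ε)))).trans ?_
  rw [map_one]

theorem deformed_arr (y : Arrow) : deformed τ (arr y) = arrowEnd (τ • ε) y := by
  rw [deformed_apply, Lift.sec_arr]
  refine (Matrix.map_single _ _ _ (algebraMap (Coord (τ • ε)) (Functions (τ • ε)))).trans ?_
  cases y <;> rfl

theorem deformed_bijective (A : Matrix (Fin 3) (Fin 3) (Functions (τ • ε)))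
    (hA : A ∈ tiltingEnd (τ • ε)) :
    ∃! p : Lam × Lam, A = deformed τ p.1 + scal (τ • ε) ε (deformed τ p.2) := by
  obtain ⟨A, rfl⟩ := exists_matIncl _ A
  obtain ⟨u, v, huv⟩ := (mem_reached τ).1 (mem_reached_of_weight τ ((matIncl_mem_iff _).1 hA))
  refine ⟨(u, v), ((deformed_add_scal τ u v).trans (congrArg _ huv)).symm, fun p hp => ?_⟩
  have h1 := Eq.trans hp (deformed_add_scal τ p.1 p.2)
  obtain ⟨h2, h3⟩ := sec_add_eps_injective τ (huv.trans (matIncl_injective _ h1))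
  exact Prod.ext h2.symm h3.symm

/-- The deformation with parameter `t = τ` is the Kodaira–Spencer deformation. -/
theorem isKodairaSpencer : IsKodairaSpencer (barCochain (g 0 0 0 τ)) τ := by
  refine ⟨deformed τ, fun r u => ?_, fun u => (matIncl_mem_iff _).2 (coordLift_mem_weightPart τ u),
    deformed_bijective τ, deformed_mul τ, deformed_e τ, fun y => ⟨0, ?_⟩⟩
  · rw [deformed_apply, deformed_apply, scal_matIncl, scalarMat_algebraMap_mul,
      map_smul (coordLift τ).sec r u]
  · rw [deformed_arr, ← map_zero (matIncl (τ • ε)), scal_matIncl, mul_zero,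
      map_zero (matIncl (τ • ε)), add_zero]

end

/-- The model with a = b = c = 0 and t = τ is equivalent to the endomorphism algebra; any other
parameters with this property differ from it by a coboundary, which the corner at node 0 and the
origin exclude. -/
theorem isKodairaSpencer_iff (a b c t τ : ℂ) :
    IsKodairaSpencer (barCochain (g a b c t)) τ ↔ a = 0 ∧ b = 0 ∧ c = 0 ∧ t = τ := by
  constructor
  · intro h
    obtain ⟨β, hβ, hm⟩ := exists_coboundary h (isKodairaSpencer τ)
    exact params_eq_of_coboundary β hβ hm
  · rintro ⟨rfl, rfl, rfl, rfl⟩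
    exact isKodairaSpencer t

end CotangentP2

end

theorem mainTheorem4 (s : ℂ) :
    (∀ f h k : CotangentP2.Chart,
      CotangentP2.bracket s f (CotangentP2.bracket s h k)
        + CotangentP2.bracket s h (CotangentP2.bracket s k f)
        + CotangentP2.bracket s k (CotangentP2.bracket s f h) = 0) ∧
    ∀ a b c t : ℂ, ∃ m : CotangentP2.Lam →ₗ[ℂ] CotangentP2.Lam →ₗ[ℂ] CotangentP2.Lam,
      (∀ m', CotangentP2.IsBarCochain (CotangentP2.g a b c t) m' ↔ m' = m) ∧
      CotangentP2.IsCocycle m ∧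
      ((∀ u v : CotangentP2.Lam,
          u = CotangentP2.e 0 * u * CotangentP2.e 0 →
          v = CotangentP2.e 0 * v * CotangentP2.e 0 →
          CotangentP2.Matches s m u v) ↔
        a = -1 / 6 ∧ b = 1 / 6 ∧ c = -(3 * s) / 2) ∧
      ((∀ i j k l : Fin 3,
          CotangentP2.Matches s m
            (CotangentP2.cls [CotangentP2.Arrow.wLo i, CotangentP2.Arrow.zLo j])
            (CotangentP2.cls [CotangentP2.Arrow.wLo k, CotangentP2.Arrow.zLo l])) ↔
        a = -1 / 6 ∧ b = 1 / 6 ∧ c = -(3 * s) / 2) ∧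
      (∀ τ : ℂ, CotangentP2.IsKodairaSpencer m τ ↔ a = 0 ∧ b = 0 ∧ c = 0 ∧ t = τ) := by
  refine ⟨CotangentP2.bracket_jacobi s, fun a b c t =>
    ⟨CotangentP2.barCochain (CotangentP2.g a b c t), CotangentP2.isBarCochain_iff _,
      CotangentP2.isCocycle_barCochain_g a b c t, CotangentP2.matches_all_iff s a b c t,
      CotangentP2.matches_wz_iff s a b c t, fun τ =>
      CotangentP2.isKodairaSpencer_iff a b c t τ⟩⟩
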